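/- **Notation.** Let $d\in\mathbb N$ and let $g\in C_0^\infty(\mathbb R^d)$, $g\neq 0$, be a fixed window. For a tempered distribution $f\in\mathcal S'(\mathbb R^d)$ put $V_gf(x,\xi)=\langle f, e^{-2\pi i\xi\cdot y}g(y-x)\rangle$ (bilinear pairing), i.e. $V_gf(x,\cdot)$ is the Fourier transform of $f\cdot g(\cdot-x)$. For $1\le p,q\le\infty$ the norm of the Wiener amalgam space $W(\mathcal FL^p,L^q)$ is $$\|f\|_{W(\mathcal FL^p,L^q)}=\bigl\|\,\|V_gf(x,\cdot)\|_{L^p}\,\bigr\|_{L^q_x}\in[0,\infty].$$ Let $Sp(d,\mathbb R)$ be the group of real symplectic $2d\times 2d$ matrices $\mathcal A=\begin{pmatrix}A&B\\C&D\end{pmatrix}$. Put $\rho(u,v)f(t)=e^{2\pi i v\cdot t+\pi i u\cdot v}f(t+u)$. The metaplectic operator $\mu(\mathcal A)$ is the unitary operator on $L^2(\mathbb R^d)$, unique up to a factor of modulus one, with $\mu(\mathcal A)\rho(w)=\rho(\mathcal Aw)\mu(\mathcal A)$ for all $w=(u,v)\in\mathbb R^{2d}$; the same symbol denotes its unique continuous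 extension to $\mathcal S'(\mathbb R^d)$ (weak-* topology). The norms below do not depend on the choice of the factor. For $1\le p,q\le\infty$, with $1/p+1/p'=1$ and $1/\infty=0$, let $$\mu_1(p,q)=\begin{cases}-1/p&\text{if }\min(1/p,1/p')\ge 1/q,\\ 1/q-1&\text{if }\min(1/q,1/2)\ge 1/p',\\ -2/p+1/q&\text{if }\min(1/q,1/2)\ge 1/p,\end{cases}$$ $$\mu_2(p,q)=\begin{cases}-1/p&\text{if }\max(1/p,1/p')\le 1/q,\\ 1/q-1&\text{if }\max(1/q,1/2)\le 1/p',\\ -2/p+1/q&\text{if }\max(1/q,1/2)\le 1/p\end{cases}$$ (the cases cover all $p,q$, and the values agree where cases overlap). **Theorem 4.2.** (i) Let $1\le p\le q\le\infty$. There is a constant $K>0$, depending only on $d,g,p,q$, such that for every $\mathcal A=\begin{pmatrix}A&B\\C&D\end{pmatrix}\in Sp(d,\mathbb R)$ with $\det B\ne 0$ and $B^*=B$, with eigenvalues $\lambda_1,\dots,\lambda_d$ of $B$ (counted with multiplicity), and for every $f\in\mathcal S'(\mathbb R^d)$, $$\|\mu(\mathcal A)f\|_{W(\mathcal FL^p,L^q)}\le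 K\,\alpha'(\mathcal A,p,q)\,\|f\|_{W(\mathcal FL^q,L^p)},$$ $$\alpha'(\mathcal A,p,q)=|\det(B+iA)(B+iD)|^{1/2}\prod_{j=1}^d(\max\{1,|\lambda_j|\})^{\mu_1(p,q)-1/2}(\min\{1,|\lambda_j|\})^{\mu_2(p,q)-1/2}.$$ (ii) There is a constant $K>0$, depending only on $d,g$, such that for every $\mathcal A=\begin{pmatrix}A&B\\C&D\end{pmatrix}\in Sp(d,\mathbb R)$ with $\det A\ne0$, $\det B\neq 0$ and $A^*=A$, with eigenvalues $\nu_1,\dots,\nu_d$ of $A$ (counted with multiplicity), and for every $f\in\mathcal S'(\mathbb R^d)$, $$\|\mu(\mathcal A)f\|_{W(\mathcal FL^1,L^\infty)}\le K\,\beta'(\mathcal A)\,\|f\|_{W(\mathcal FL^\infty,L^1)},$$ $$\beta'(\mathcal A)=|\det B|^{-1}|\det(B+iA)(A+iC)|^{1/2}\prod_{j=1}^d(\max\{1,|\nu_j|\})^{-1/2}(\min\{1,|\nu_j|\})^{-3/2}.$$ -/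

import Mathlib

open MeasureTheory SchwartzMap
open scoped ENNReal

noncomputable section

namespace Metaplectic

/-- The Euclidean space `ℝᵈ`. -/
abbrev Rd (d : ℕ) := EuclideanSpace ℝ (Fin d)

/-- The Hilbert space `L²(ℝᵈ)`. -/
abbrev L2 (d : ℕ) := Lp ℂ 2 (volume : Measure (Rd d))

/-- The character `y ↦ e^{-2πi ξ·y}` of `ℝᵈ`. -/
def character {d : ℕ} (ξ : Rd d) : Rd d → ℂ := fun y =>
  Complex.exp (((-(2 * Real.pi * inner ℝ ξ y) : ℝ) : ℂ) * Complex.I)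

theorem expI_hasTemperateGrowth :
    (fun t : ℝ => Complex.exp ((t : ℂ) * Complex.I)).HasTemperateGrowth := by
  have hd : ∀ n : ℕ, iteratedDeriv n (fun t : ℝ => Complex.exp ((t : ℂ) * Complex.I)) =
      fun t : ℝ => Complex.I ^ n * Complex.exp ((t : ℂ) * Complex.I) := by
    intro n
    induction n with
    | zero => simp
    | succ n ih =>
      rw [iteratedDeriv_succ, ih]
      funext t
      have h : HasDerivAt (fun t : ℝ => (t : ℂ) * Complex.I) (1 * Complex.I) t :=
        (Complex.ofRealCLM.hasDerivAt (x := t)).mul_const Complex.I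
      have h2 := (h.cexp.const_mul (Complex.I ^ n)).deriv
      rw [h2]
      ring
  refine ⟨?_, fun n => ⟨0, 1, fun x => ?_⟩⟩
  · exact (Complex.ofRealCLM.contDiff.mul contDiff_const).cexp
  · rw [norm_iteratedFDeriv_eq_norm_iteratedDeriv, hd]
    simp [Complex.norm_exp_ofReal_mul_I]

theorem character_hasTemperateGrowth {d : ℕ} (ξ : Rd d) :
    (character ξ).HasTemperateGrowth := by
  have h : (fun y : Rd d => (-(2 * Real.pi * inner ℝ ξ y) : ℝ)).HasTemperateGrowth := by
    fun_prop
  exact expI_hasTemperateGrowth.comp h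

/-- The Schwartz function `y ↦ e^{-2πi ξ·y} g(y - x)`. -/
def shiftedWindow {d : ℕ} (g : 𝓢(Rd d, ℂ)) (x ξ : Rd d) : 𝓢(Rd d, ℂ) :=
  smulLeftCLM ℂ (character ξ) (compSubConstCLM ℂ x g)

theorem shiftedWindow_apply {d : ℕ} (g : 𝓢(Rd d, ℂ)) (x ξ y : Rd d) :
    shiftedWindow g x ξ y = character ξ y * g (y - x) := by
  simp [shiftedWindow, character_hasTemperateGrowth]

/-- The short-time Fourier transform `V_g f(x, ξ) = ⟨f, e^{-2πi ξ·} g(· - x)⟩` of a tempered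
distribution: the value at `ξ` of the Fourier transform of `f · T_x g`. -/
def stft {d : ℕ} (g : 𝓢(Rd d, ℂ)) (f : 𝓢'(Rd d, ℂ)) (x ξ : Rd d) : ℂ :=
  f (shiftedWindow g x ξ)

/-- The norm of the Wiener amalgam space `W(𝓕L^p, L^q)` with window `g`,
`‖ ‖f · T_x g‖_{𝓕L^p} ‖_{L^q_x}`, where `‖h‖_{𝓕L^p}` is the `L^p` norm of the Fourier transform
of `h`. It takes values in `[0, ∞]`, and `f` belongs to the space iff it is finite. -/
def amalgamNorm {d : ℕ} (g : 𝓢(Rd d, ℂ)) (p q : ℝ≥0∞) (f : 𝓢'(Rd d, ℂ)) : ℝ≥0∞ :=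
  eLpNorm (fun x : Rd d => eLpNorm (fun ξ : Rd d => stft g f x ξ) p volume) q volume

/-- The Schrödinger representation `ρ(u, v)` of the Heisenberg group, on functions:
`ρ(u, v) f(t) = e^{2πi v·t + πi u·v} f(t + u)`. -/
def heisenberg {d : ℕ} (u v : Rd d) (f : Rd d → ℂ) : Rd d → ℂ := fun t =>
  Complex.exp (((2 * Real.pi * inner ℝ v t + Real.pi * inner ℝ u v : ℝ) : ℂ) * Complex.I) *
    f (t + u)

/-- The unitary operator `U` on `L²(ℝᵈ)` is a metaplectic operator over the block matrix
`𝒜 = (A, B; C, D)`: it satisfies `U ρ(w) = ρ(𝒜 w) U` for all `w = (u, v)` in phase space. By the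
Stone-von Neumann theorem this determines `U` up to a constant of modulus one. -/
def IsMetaplecticL2 {d : ℕ} (A B C D : Matrix (Fin d) (Fin d) ℝ) (U : L2 d ≃ₗᵢ[ℂ] L2 d) : Prop :=
  ∀ (u v : Rd d) (f h : L2 d),
    (h : Rd d → ℂ) =ᵐ[volume] heisenberg u v (f : Rd d → ℂ) →
    (U h : Rd d → ℂ) =ᵐ[volume]
      heisenberg (A.toEuclideanLin u + B.toEuclideanLin v)
        (C.toEuclideanLin u + D.toEuclideanLin v) (U f : Rd d → ℂ)

/-- `T` is the metaplectic operator `μ(𝒜)`, `𝒜 = (A, B; C, D)`, acting on tempered distributions: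
the continuous (for the weak-* topology) extension to `𝓢'(ℝᵈ)` of a metaplectic operator
on `L²(ℝᵈ)` over `𝒜`. The extension is unique, since `L²(ℝᵈ)` is dense in `𝓢'(ℝᵈ)`. -/
def IsMetaplectic {d : ℕ} (A B C D : Matrix (Fin d) (Fin d) ℝ)
    (T : 𝓢'(Rd d, ℂ) →L[ℂ] 𝓢'(Rd d, ℂ)) : Prop :=
  ∃ U : L2 d ≃ₗᵢ[ℂ] L2 d, IsMetaplecticL2 A B C D U ∧
    ∀ f : L2 d, T (Lp.toTemperedDistribution f) = Lp.toTemperedDistribution (U f)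

/-- The reciprocal exponent `1/p` as a real number, with `1/∞ = 0`. -/
def recip (p : ℝ≥0∞) : ℝ := (p⁻¹).toReal

/-- The index `μ₁(p, q)`. With `a = 1/p`, `b = 1/q`, `1 - a = 1/p'`, the three cases are the sets
`I₁* : min(a, 1 - a) ≥ b`, `I₂* : min(b, 1/2) ≥ 1 - a` and `I₃* : min(b, 1/2) ≥ a`.
They cover the unit square and the values agree on the overlaps. -/
def mu1 (p q : ℝ≥0∞) : ℝ :=
  if recip q ≤ min (recip p) (1 - recip p) then -recip p
  else if 1 - recip p ≤ min (recip q) (1 / 2) then recip q - 1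
  else -2 * recip p + recip q

/-- The index `μ₂(p, q)`. With `a = 1/p`, `b = 1/q`, `1 - a = 1/p'`, the three cases are the sets
`I₁ : max(a, 1 - a) ≤ b`, `I₂ : max(b, 1/2) ≤ 1 - a` and `I₃ : max(b, 1/2) ≤ a`.
They cover the unit square and the values agree on the overlaps. -/
def mu2 (p q : ℝ≥0∞) : ℝ :=
  if max (recip p) (1 - recip p) ≤ recip q then -recip p
  else if max (recip q) (1 / 2) ≤ 1 - recip p then recip q - 1
  else -2 * recip p + recip q

/-- The complex matrix `M + iN`. -/
def cplx {d : ℕ} (M N : Matrix (Fin d) (Fin d) ℝ) : Matrix (Fin d) (Fin d) ℂ :=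
  M.map Complex.ofReal + Complex.I • N.map Complex.ofReal

/-- The constant `α'(𝒜, p, q)`, where `ev` lists the eigenvalues of the symmetric matrix `B`. -/
def alpha' {d : ℕ} (A B D : Matrix (Fin d) (Fin d) ℝ) (ev : Fin d → ℝ) (p q : ℝ≥0∞) : ℝ :=
  ‖(cplx B A * cplx B D).det‖ ^ (1 / 2 : ℝ) *
    ∏ j, (max 1 |ev j|) ^ (mu1 p q - 1 / 2) * (min 1 |ev j|) ^ (mu2 p q - 1 / 2)

/-- The constant `β'(𝒜)`, where `ev` lists the eigenvalues of the symmetric matrix `A`. -/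
def beta' {d : ℕ} (A B C : Matrix (Fin d) (Fin d) ℝ) (ev : Fin d → ℝ) : ℝ :=
  |B.det|⁻¹ * ‖(cplx B A * cplx A C).det‖ ^ (1 / 2 : ℝ) *
    ∏ j, (max 1 |ev j|) ^ (-1 / 2 : ℝ) * (min 1 |ev j|) ^ (-3 / 2 : ℝ)

end Metaplectic

end

/-!
A metaplectic operator over a symplectic matrix with invertible block `B` is, up to a constant of
modulus `|det B|^{1/2}`, a product of elementary operators: multiplication by the chirp of `-B⁻¹A`
(the function `e^{πi t·Pt}` with `P = -B⁻¹A`), the Fourier transform, a dilation by `-B`, and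
multiplication by the chirp of `-DB⁻¹`. Everything is done on the transposes of the operators, which
act on Schwartz functions (`exists_transpose`). That the metaplectic operator is this product is a
rigidity statement, `exists_eq_smul_of_intertwining`: two isometric maps that intertwine the
Schrödinger representation in the same way are proportional. Modulation covariance turns the equality
of their inner products into a pointwise one, so that they differ by a multiplication operator, and
translation covariance makes the multiplier constant. No irreducibility theorem is used. The result
for tempered distributions is `IsMetaplectic.exists_eq_smul_precompose`.

The three kinds of factors are then estimated on the amalgam spaces `W(𝓕L^p, L^q)`.

* A chirp costs the `L¹` norm of the Fourier transform of the chirp times a Gaussian, which is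
  `|det(1 + iP)|^{1/2}` (`exists_amalgamNorm_precompose_chirpMul_le`).
* The Fourier transform interchanges the variables of the short-time Fourier transform, and maps
  `W(𝓕L^q, L^p)` to `W(𝓕L^p, L^q)` by Minkowski's inequality, as `p ≤ q`
  (`exists_amalgamNorm_precompose_fourier_le`).
* A dilation of the distribution is a dilation of the window. A symmetric dilation is the product of
  one with eigenvalues at least `1` and one with eigenvalues at most `1` in absolute value. The first
  leads to a narrow window, which is cut out of a fixed one; the second to a wide window, which is
  resolved into translates of a fixed one. A mixed-norm Hausdorff-Young inequality gains in both
  cases over the trivial estimate and gives the exponents `μ₁` and `μ₂`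
  (`exists_amalgamNorm_precompose_diagEquiv_le`).

The product of these constants is `α'`. If `A` is invertible as well, the factors can be regrouped:
the metaplectic operator is a multiple of a convolution with the chirp of `-B⁻¹A`, followed by a
dilation by `A` and multiplication by the chirp of `-CA⁻¹` (`metaplecticFactor_eq_convolution`). The
convolution maps `W(𝓕L^∞, L¹)` to `W(𝓕L¹, L^∞)` with norm at most a multiple of
`|det(1 + iB⁻¹A)|^{1/2}`, because its matrix coefficients with respect to time-frequency shifts of
Gaussians are explicit Gaussians (`exists_amalgamNorm_precompose_convolution_le`). This gives `β'`.

The estimates for windows rest on two facts about a tempered distribution `f`: it commutes with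
integrals of Schwartz functions (`apply_eq_integral`), and a factor in the window becomes a
convolution of the short-time Fourier transform in the frequency variable
(`apply_mul_eq_integral_stft`). All of them hold for arbitrary `f`, with infinite norms allowed, so
that no density argument is needed.
-/

namespace Metaplectic

/-! ### Minkowski's and Hölder's inequalities for mixed norms -/

section Minkowski

variable {X Y : Type*} [MeasurableSpace X] [MeasurableSpace Y] {μ : Measure X} {ν : Measure Y}

theorem measurable_eLpNorm_right [SFinite ν] {F : X → Y → ℝ≥0∞}
    (hF : Measurable (Function.uncurry F)) (p : ℝ≥0∞) :
    Measurable fun x => eLpNorm (F x) p ν := by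
  rcases eq_or_ne p 0 with rfl | hp0
  · simp
  rcases eq_or_ne p ∞ with rfl | hp
  · refine measurable_of_Iic fun c => ?_
    have h : (fun x => eLpNorm (F x) ∞ ν) ⁻¹' Set.Iic c =
        (fun x => ν (Prod.mk x ⁻¹' {z : X × Y | c < F z.1 z.2})) ⁻¹' {0} := by
      ext x
      simp only [Set.mem_preimage, Set.mem_Iic, eLpNorm_exponent_top, eLpNormEssSup,
        enorm_eq_self, Set.mem_singleton_iff]
      constructor
      · intro h
        refine measure_mono_null ?_ (ae_iff.1 (ae_le_essSup (f := F x) (μ := ν)))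
        intro y hy
        exact not_le.2 (h.trans_lt hy)
      · intro h
        refine essSup_le_of_ae_le _ (ae_iff.2 ?_)
        simp only [not_le]
        exact h
    rw [h]
    exact measurable_measure_prodMk_left (measurableSet_lt measurable_const hF)
      (measurableSet_singleton 0)
  · simp_rw [eLpNorm_eq_lintegral_rpow_enorm_toReal hp0 hp, enorm_eq_self]
    exact ((hF.pow_const _).lintegral_prod_right').pow_const _

/-- Minkowski's integral inequality, for finite exponents. -/
theorem lintegral_lintegral_rpow_le [SFinite μ] [SigmaFinite ν] {G : X → Y → ℝ≥0∞}
    (hG : Measurable (Function.uncurry G)) {s : ℝ} (hs : 1 ≤ s) :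
    (∫⁻ y, (∫⁻ x, G x y ∂μ) ^ s ∂ν) ^ (1 / s) ≤ ∫⁻ x, (∫⁻ y, G x y ^ s ∂ν) ^ (1 / s) ∂μ := by
  rcases hs.eq_or_lt with rfl | hs1
  · simp only [ENNReal.rpow_one, div_one]
    rw [lintegral_lintegral_swap hG.aemeasurable]
  have hs0 : 0 < s := one_pos.trans hs1
  set R := ∫⁻ x, (∫⁻ y, G x y ^ s ∂ν) ^ (1 / s) ∂μ with hR
  have hGm : Measurable (Function.uncurry fun (y : Y) (x : X) => G x y) := hG.comp measurable_swap
  have hS : Measurable fun y => ∫⁻ x, G x y ∂μ := hGm.lintegral_prod_right'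
  set S : Y → ℝ≥0∞ := fun y => ∫⁻ x, G x y ∂μ with hSdef
  -- Truncation makes the integral that is divided out finite.
  let T : ℕ → Y → ℝ≥0∞ := fun n => (spanningSets ν n).indicator fun y => min (S y) n
  have hT : ∀ n, Measurable (T n) := fun n =>
    (hS.min measurable_const).indicator (measurableSet_spanningSets ν n)
  have hTS : ∀ n y, T n y ≤ S y := fun n y => by
    by_cases hy : y ∈ spanningSets ν n
    · simp [T, hy]
    · simp [T, hy]
  have hfin : ∀ n, ∫⁻ y, T n y ^ s ∂ν ≠ ∞ := fun n => by
    refine ne_top_of_le_ne_top ?_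
      (lintegral_mono (g := (spanningSets ν n).indicator fun _ => (n : ℝ≥0∞) ^ s) fun y => ?_)
    · rw [lintegral_indicator (measurableSet_spanningSets ν n), setLIntegral_const]
      exact ENNReal.mul_ne_top (ENNReal.rpow_ne_top_of_nonneg hs0.le (ENNReal.natCast_ne_top n))
        (measure_spanningSets_lt_top ν n).ne
    · by_cases hy : y ∈ spanningSets ν n
      · simp only [T, hy, Set.indicator_of_mem]
        exact ENNReal.rpow_le_rpow (min_le_right _ _) hs0.le
      · simp [T, hy, hs0]
  have hconj : s.HolderConjugate (Real.conjExponent s) := Real.HolderConjugate.conjExponent hs1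
  have hc : (s - 1) * Real.conjExponent s = s := by
    simpa using hconj.sub_one_mul_conj
  have key : ∀ n, (∫⁻ y, T n y ^ s ∂ν) ^ (1 / s) ≤ R := fun n => by
    set I := ∫⁻ y, T n y ^ s ∂ν with hI
    have h1 : I ≤ R * I ^ (1 / Real.conjExponent s) := by
      calc I ≤ ∫⁻ y, (∫⁻ x, G x y * T n y ^ (s - 1) ∂μ) ∂ν := by
            refine lintegral_mono fun y => ?_
            rw [lintegral_mul_const _ (hGm.of_uncurry_left)]
            calc T n y ^ s = T n y ^ (1 + (s - 1)) := by ring_nf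
              _ = T n y * T n y ^ (s - 1) := by
                  rw [ENNReal.rpow_add_of_nonneg _ _ zero_le_one (by linarith), ENNReal.rpow_one]
              _ ≤ _ := by gcongr; exact hTS n y
        _ = ∫⁻ x, (∫⁻ y, G x y * T n y ^ (s - 1) ∂ν) ∂μ := by
            refine lintegral_lintegral_swap (Measurable.aemeasurable ?_)
            exact hGm.mul (((hT n).comp measurable_fst).pow_const _)
        _ ≤ ∫⁻ x, (∫⁻ y, G x y ^ s ∂ν) ^ (1 / s) * I ^ (1 / Real.conjExponent s) ∂μ := by
            refine lintegral_mono fun x => ?_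
            refine (ENNReal.lintegral_mul_le_Lp_mul_Lq ν hconj
              (hG.of_uncurry_left).aemeasurable ((hT n).pow_const _).aemeasurable).trans ?_
            simp_rw [← ENNReal.rpow_mul, hc]
            exact le_rfl
        _ = R * I ^ (1 / Real.conjExponent s) := by
            rw [lintegral_mul_const]
            exact ((hG.pow_const _).lintegral_prod_right').pow_const _
    rcases eq_or_ne I 0 with h0 | h0
    · simp [h0, hs0]
    have h2 : I ^ (1 / s) * I ^ (1 / Real.conjExponent s) = I := by
      rw [← ENNReal.rpow_add _ _ h0 (hfin n)]
      have := hconj.inv_add_inv_eq_one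
      rw [one_div, one_div, this, ENNReal.rpow_one]
    have h3 : I ^ (1 / Real.conjExponent s) ≠ 0 := by
      have := hconj.symm.pos.le
      simp [ENNReal.rpow_eq_zero_iff, h0, this]
    have h4 : I ^ (1 / Real.conjExponent s) ≠ ∞ :=
      ENNReal.rpow_ne_top_of_nonneg (by have := hconj.symm.pos; positivity) (hfin n)
    exact (ENNReal.mul_le_mul_iff_left h3 h4).1 (h2.le.trans h1)
  have hmono : ∀ y, Monotone fun n => T n y := fun y m n hmn => by
    by_cases hy : y ∈ spanningSets ν m
    · have hy' := monotone_spanningSets ν hmn hy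
      simp only [T, hy, hy', Set.indicator_of_mem]
      exact min_le_min le_rfl (by exact_mod_cast hmn)
    · simp [T, hy]
  have hsup : ∀ y, ⨆ n, T n y ^ s = S y ^ s := fun y => by
    refine le_antisymm (iSup_le fun n => ENNReal.rpow_le_rpow (hTS n y) hs0.le) ?_
    refine le_of_tendsto' (f := fun n : ℕ => (min (S y) (n : ℝ≥0∞)) ^ s) (x := Filter.atTop)
      (b := ⨆ n, T n y ^ s) ?_ ?_ |>.trans le_rfl
    · refine (ENNReal.continuous_rpow_const.tendsto _).comp ?_
      have : Filter.Tendsto (fun n : ℕ => min (S y) (n : ℝ≥0∞)) Filter.atTop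
          (nhds (min (S y) ∞)) := tendsto_const_nhds.min ENNReal.tendsto_nat_nhds_top
      simpa using this
    · intro n
      let m := max n (spanningSetsIndex ν y)
      refine le_trans ?_ (le_iSup (fun n => T n y ^ s) m)
      have hy : y ∈ spanningSets ν m :=
        monotone_spanningSets ν (le_max_right _ _) (mem_spanningSetsIndex ν y)
      simp only [T, hy, Set.indicator_of_mem]
      exact ENNReal.rpow_le_rpow (min_le_min le_rfl (by exact_mod_cast le_max_left _ _)) hs0.le
  have hI : ∫⁻ y, S y ^ s ∂ν = ⨆ n, ∫⁻ y, T n y ^ s ∂ν := by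
    rw [← lintegral_iSup (fun n => (hT n).pow_const _)]
    · simp_rw [hsup]
    · exact fun m n hmn y => ENNReal.rpow_le_rpow (hmono y hmn) hs0.le
  have hle : ∫⁻ y, S y ^ s ∂ν ≤ R ^ s := by
    rw [hI]
    refine iSup_le fun n => ?_
    have := ENNReal.rpow_le_rpow (key n) hs0.le
    rwa [← ENNReal.rpow_mul, one_div_mul_cancel hs0.ne', ENNReal.rpow_one] at this
  have := ENNReal.rpow_le_rpow hle (one_div_nonneg.2 hs0.le)
  rwa [← ENNReal.rpow_mul R, mul_one_div_cancel hs0.ne', ENNReal.rpow_one] at this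

/-- Minkowski's inequality for mixed norms: the smaller exponent may be moved outside. -/
theorem eLpNorm_eLpNorm_swap_le [SigmaFinite μ] [SigmaFinite ν] {F : X → Y → ℝ≥0∞}
    (hF : Measurable (Function.uncurry F)) {p q : ℝ≥0∞} (hp0 : p ≠ 0) (hpq : p ≤ q) :
    eLpNorm (fun y => eLpNorm (fun x => F x y) p μ) q ν ≤
      eLpNorm (fun x => eLpNorm (fun y => F x y) q ν) p μ := by
  have hFs : Measurable (Function.uncurry fun (y : Y) (x : X) => F x y) := hF.comp measurable_swap
  rcases eq_or_ne q ∞ with rfl | hq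
  · set m : X → ℝ≥0∞ := fun x => eLpNorm (fun y => F x y) ∞ ν with hm
    have hmm : Measurable m := measurable_eLpNorm_right hF ∞
    have h1 : ∀ᵐ x ∂μ, ∀ᵐ y ∂ν, F x y ≤ m x := Filter.Eventually.of_forall fun x => by
      simpa using! ae_le_eLpNormEssSup (f := F x) (μ := ν)
    have h2 : ∀ᵐ y ∂ν, ∀ᵐ x ∂μ, F x y ≤ m x :=
      (Measure.ae_ae_comm (p := fun x y => F x y ≤ m x)
        (measurableSet_le hF (hmm.comp measurable_fst))).1 h1
    rw [eLpNorm_exponent_top]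
    refine essSup_le_of_ae_le _ ?_
    filter_upwards [h2] with y hy
    rw [enorm_eq_self]
    exact eLpNorm_mono_enorm_ae (by simpa using hy)
  have hp : p ≠ ∞ := ne_top_of_le_ne_top hq hpq
  have hq0 : q ≠ 0 := (pos_iff_ne_zero.2 hp0 |>.trans_le hpq).ne'
  have hpr : 0 < p.toReal := ENNReal.toReal_pos hp0 hp
  have hqr : 0 < q.toReal := ENNReal.toReal_pos hq0 hq
  have hle : p.toReal ≤ q.toReal := ENNReal.toReal_mono hq hpq
  simp_rw [eLpNorm_eq_lintegral_rpow_enorm_toReal hp0 hp,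
    eLpNorm_eq_lintegral_rpow_enorm_toReal hq0 hq, enorm_eq_self, ← ENNReal.rpow_mul]
  have h := lintegral_lintegral_rpow_le (μ := μ) (ν := ν) (G := fun x y => F x y ^ p.toReal)
    (hF.pow_const p.toReal)
    (s := q.toReal / p.toReal) ((one_le_div hpr).2 hle)
  have h' := ENNReal.rpow_le_rpow h (one_div_nonneg.2 hpr.le)
  simp_rw [← ENNReal.rpow_mul] at h'
  convert h' using 4 <;> field_simp

theorem eLpNorm_eLpNorm_swap [SigmaFinite μ] [SigmaFinite ν] {F : X → Y → ℝ≥0∞}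
    (hF : Measurable (Function.uncurry F)) {p : ℝ≥0∞} (hp0 : p ≠ 0) :
    eLpNorm (fun y => eLpNorm (fun x => F x y) p μ) p ν =
      eLpNorm (fun x => eLpNorm (fun y => F x y) p ν) p μ :=
  le_antisymm (eLpNorm_eLpNorm_swap_le hF hp0 le_rfl)
    (eLpNorm_eLpNorm_swap_le (F := fun y x => F x y)
      (show Measurable (Function.uncurry fun y x => F x y) from hF.comp measurable_swap)
      hp0 le_rfl)

/-- Minkowski's integral inequality: the norm of an integral is at most the integral of the
norms. -/
theorem eLpNorm_lintegral_le [SigmaFinite μ] [SigmaFinite ν] {F : X → Y → ℝ≥0∞}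
    (hF : Measurable (Function.uncurry F)) {p : ℝ≥0∞} (hp : 1 ≤ p) :
    eLpNorm (fun y => ∫⁻ x, F x y ∂μ) p ν ≤ ∫⁻ x, eLpNorm (fun y => F x y) p ν ∂μ := by
  have := eLpNorm_eLpNorm_swap_le (μ := μ) (ν := ν) hF one_ne_zero hp
  simpa only [eLpNorm_one_eq_lintegral_enorm, enorm_eq_self] using this

theorem eLpNorm_const_mul_ennreal {f : X → ℝ≥0∞} (hf : AEMeasurable f μ) (c p : ℝ≥0∞) :
    eLpNorm (fun x => c * f x) p μ = c * eLpNorm f p μ := by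
  rcases eq_or_ne p 0 with rfl | hp0
  · simp
  rcases eq_or_ne p ∞ with rfl | hp
  · simp only [eLpNorm_exponent_top, eLpNormEssSup, enorm_eq_self]
    exact ENNReal.essSup_const_mul
  · have hpr : 0 < p.toReal := ENNReal.toReal_pos hp0 hp
    simp_rw [eLpNorm_eq_lintegral_rpow_enorm_toReal hp0 hp, enorm_eq_self,
      ENNReal.mul_rpow_of_nonneg _ _ hpr.le]
    rw [lintegral_const_mul'' _ (hf.pow_const _), ENNReal.mul_rpow_of_nonneg _ _ (by positivity),
      ← ENNReal.rpow_mul, mul_one_div_cancel hpr.ne', ENNReal.rpow_one]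

/-- Hölder's inequality. -/
theorem lintegral_mul_le_eLpNorm_mul_eLpNorm {p q : ℝ≥0∞} (hpq : p⁻¹ + q⁻¹ = 1)
    {f g : X → ℝ≥0∞} (hf : AEMeasurable f μ) (hg : AEMeasurable g μ) :
    ∫⁻ x, f x * g x ∂μ ≤ eLpNorm f p μ * eLpNorm g q μ := by
  rcases eq_or_ne p ∞ with rfl | hp
  · obtain rfl : q = 1 := by simpa using hpq
    rw [eLpNorm_one_eq_lintegral_enorm, eLpNorm_exponent_top]
    simp only [enorm_eq_self]
    rw [← lintegral_const_mul'' _ hg]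
    refine lintegral_mono_ae ?_
    filter_upwards [ae_le_eLpNormEssSup (f := f) (μ := μ)] with x hx
    simpa using mul_le_mul_left hx (g x)
  rcases eq_or_ne q ∞ with rfl | hq
  · obtain rfl : p = 1 := by simpa using hpq
    rw [eLpNorm_one_eq_lintegral_enorm, eLpNorm_exponent_top]
    simp only [enorm_eq_self]
    rw [← lintegral_mul_const'' _ hf]
    refine lintegral_mono_ae ?_
    filter_upwards [ae_le_eLpNormEssSup (f := g) (μ := μ)] with x hx
    simpa using mul_le_mul_right hx (f x)
  have hp0 : p ≠ 0 := by rintro rfl; simp at hpq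
  have hq0 : q ≠ 0 := by rintro rfl; simp at hpq
  have hc : p.toReal.HolderConjugate q.toReal := by
    refine ⟨?_, ENNReal.toReal_pos hp0 hp, ENNReal.toReal_pos hq0 hq⟩
    have := congrArg ENNReal.toReal hpq
    rw [ENNReal.toReal_add (by simpa using hp0) (by simpa using hq0)] at this
    simpa using this
  rw [eLpNorm_eq_lintegral_rpow_enorm_toReal hp0 hp, eLpNorm_eq_lintegral_rpow_enorm_toReal hq0 hq]
  exact ENNReal.lintegral_mul_le_Lp_mul_Lq μ hc hf hg

end Minkowski

/-! ### The Hausdorff-Young inequality -/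

section HausdorffYoung

open FourierTransform

variable {V : Type*} [NormedAddCommGroup V] [InnerProductSpace ℝ V] [FiniteDimensional ℝ V]
  [MeasurableSpace V] [BorelSpace V]

/-- Plancherel's theorem for the Fourier integral of a function in `L¹ ∩ L²`. -/
theorem eLpNorm_fourier_two {f : V → ℂ} (hf : Integrable f) (hf2 : MemLp f 2) :
    eLpNorm (𝓕 f) 2 volume = eLpNorm f 2 volume := by
  have hc : Continuous (𝓕 f) :=
    VectorFourier.fourierIntegral_continuous Real.continuous_fourierChar
      (by exact continuous_inner) hf
  have hae : (𝓕 (hf2.toLp f) : Lp ℂ 2 (volume : Measure V)) =ᵐ[volume] 𝓕 f := by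
    refine ae_eq_of_integral_contDiff_smul_eq
      ((Lp.memLp _).locallyIntegrable (by norm_num)) hc.locallyIntegrable ?_
    intro g hg hgc
    have hg₁ : HasCompactSupport (Complex.ofRealCLM ∘ g) := hgc.comp_left rfl
    have hg₂ : ContDiff ℝ (⊤ : ℕ∞) (Complex.ofRealCLM ∘ g) := by fun_prop
    set φ : 𝓢(V, ℂ) := hg₁.toSchwartzMap hg₂ with hφ
    have hφa : ∀ x, φ x = (g x : ℂ) := fun x => rfl
    have h1 : ∫ x, φ x • (𝓕 (hf2.toLp f) : Lp ℂ 2 (volume : Measure V)) x =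
        ∫ x, (𝓕 φ) x • f x := by
      have := DFunLike.congr_fun (Lp.fourier_toTemperedDistribution_eq (hf2.toLp f)) φ
      rw [TemperedDistribution.fourier_apply, Lp.toTemperedDistribution_apply,
        Lp.toTemperedDistribution_apply] at this
      rw [← this]
      refine integral_congr_ae ?_
      filter_upwards [hf2.coeFn_toLp] with x hx
      rw [hx]
    have h2 : ∫ x, (𝓕 φ) x • f x = ∫ x, φ x • 𝓕 f x := by
      have := VectorFourier.integral_fourierIntegral_smul_eq_flip (μ := (volume : Measure V))
        (ν := (volume : Measure V))
        (L := innerₗ V) (f := (φ : V → ℂ)) (g := f) Real.continuous_fourierChar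
        (by exact continuous_inner) φ.integrable hf
      simp only [flip_innerₗ] at this
      exact this
    simpa [hφa] using h1.trans h2
  rw [← eLpNorm_congr_ae hae, ← eLpNorm_congr_ae hf2.coeFn_toLp]
  have h := Lp.norm_fourier_eq (hf2.toLp f)
  rw [Lp.norm_def, Lp.norm_def] at h
  exact (ENNReal.toReal_eq_toReal_iff' (Lp.eLpNorm_ne_top _) (Lp.eLpNorm_ne_top _)).1 h

/-- The layer-cake integral that turns the weak-type bounds into the Hausdorff-Young
inequality. -/
theorem lintegral_rpow_indicator_eq {r M : ℝ} (hr : 2 < r) (hM : 0 ≤ M) :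
    ∫⁻ t in Set.Ioi (0 : ℝ), (Set.Iic M).indicator (fun t => ENNReal.ofReal (t ^ (r - 3))) t =
      ENNReal.ofReal (M ^ (r - 2) / (r - 2)) := by
  rw [← lintegral_indicator measurableSet_Ioi, Set.indicator_indicator, Set.Ioi_inter_Iic,
    lintegral_indicator measurableSet_Ioc, ← ofReal_integral_eq_lintegral_ofReal]
  · rw [← intervalIntegral.integral_of_le hM, integral_rpow (Or.inl (by linarith))]
    rw [show r - 3 + 1 = r - 2 by ring, Real.zero_rpow (by linarith), sub_zero]
  · exact (intervalIntegral.intervalIntegrable_rpow' (by linarith)).1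
  · filter_upwards [ae_restrict_mem measurableSet_Ioc] with t ht
    exact Real.rpow_nonneg ht.1.le _

/-- The weak-type bound behind the Hausdorff-Young inequality: the function is cut at a height
chosen so that the Fourier transform of the upper part is at most `t / 2`. -/
theorem measure_lt_norm_fourier_le {p r : ℝ} (hpr : p.HolderConjugate r) {f : V → ℂ}
    (hfm : Measurable f) (hf : Integrable f) (hf2 : MemLp f 2)
    (hfp : Integrable fun x => ‖f x‖ ^ p) (ha : 0 < ∫ x, ‖f x‖ ^ p) {t : ℝ} (ht : 0 < t) :
    volume {x | t < ‖𝓕 f x‖} ≤ ENNReal.ofReal (4 * t ^ (-2 : ℝ)) *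
      ∫⁻ x, ({x | t * ‖f x‖ ^ (p - 1) ≤ 2 * ∫ x, ‖f x‖ ^ p} : Set V).indicator
        (fun x => ‖f x‖ₑ ^ (2 : ℝ)) x := by
  set a := ∫ x, ‖f x‖ ^ p with haa
  set A : Set V := {x | t * ‖f x‖ ^ (p - 1) ≤ 2 * a} with hA
  have hAm : MeasurableSet A := measurableSet_le
    (measurable_const.mul (hfm.norm.pow_const _)) measurable_const
  have hp1 : 0 < p - 1 := hpr.sub_one_pos
  set f1 : V → ℂ := A.indicator f with hf1
  set f2 : V → ℂ := Aᶜ.indicator f with hf2'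
  have hi1 : Integrable f1 := hf.indicator hAm
  have hi2 : Integrable f2 := hf.indicator hAm.compl
  have hsum : ∀ x, 𝓕 f x = 𝓕 f1 x + 𝓕 f2 x := fun x => by
    have : f = f1 + f2 := (Set.indicator_self_add_compl A f).symm
    conv_lhs => rw [this]
    exact congrFun (VectorFourier.fourierIntegral_add Real.continuous_fourierChar
      (by exact continuous_inner) hi1 hi2) x
  have hb2 : ∀ x, ‖𝓕 f2 x‖ ≤ t / 2 := fun x => by
    calc ‖𝓕 f2 x‖ ≤ ∫ y, ‖f2 y‖ := VectorFourier.norm_fourierIntegral_le_integral_norm _ _ _ _ _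
      _ ≤ ∫ y, (t / (2 * a)) * ‖f y‖ ^ p := by
        refine integral_mono hi2.norm (hfp.const_mul _) fun y => ?_
        by_cases hy : y ∈ A
        · simp only [hf2', Set.indicator_of_notMem (Set.notMem_compl_iff.2 hy), norm_zero]
          positivity
        · simp only [hf2', Set.indicator_of_mem (Set.mem_compl hy)]
          have hy' : 2 * a < t * ‖f y‖ ^ (p - 1) := not_le.1 hy
          have h0 : 0 < ‖f y‖ := by
            rcases (norm_nonneg (f y)).eq_or_lt with h | h
            · rw [← h, Real.zero_rpow hp1.ne', mul_zero] at hy'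
              linarith
            · exact h
          have : ‖f y‖ ^ p = ‖f y‖ ^ (p - 1) * ‖f y‖ := by
            rw [Real.rpow_sub_one h0.ne']
            field_simp
          rw [this, ← mul_assoc, div_mul_eq_mul_div]
          refine le_mul_of_one_le_left h0.le ?_
          rw [one_le_div (by positivity)]
          exact hy'.le
      _ = t / 2 := by
        rw [integral_const_mul, ← haa]
        field_simp
  have hsub : {x | t < ‖𝓕 f x‖} ⊆ {x | ENNReal.ofReal ((t / 2) ^ (2 : ℝ)) ≤ ‖𝓕 f1 x‖ₑ ^ (2 : ℝ)} := by
    intro x hx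
    have h1 : t < ‖𝓕 f x‖ := hx
    rw [hsum] at h1
    have h2 : t / 2 ≤ ‖𝓕 f1 x‖ := by linarith [norm_add_le (𝓕 f1 x) (𝓕 f2 x), hb2 x]
    change ENNReal.ofReal ((t / 2) ^ (2 : ℝ)) ≤ ‖𝓕 f1 x‖ₑ ^ (2 : ℝ)
    rw [← ENNReal.ofReal_rpow_of_pos (by positivity), ← ofReal_norm]
    gcongr
  have hpl : ∫⁻ x, ‖𝓕 f1 x‖ₑ ^ (2 : ℝ) = ∫⁻ x, ‖f1 x‖ₑ ^ (2 : ℝ) := by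
    have h := eLpNorm_fourier_two hi1 (hf2.indicator hAm)
    rw [eLpNorm_eq_lintegral_rpow_enorm_toReal two_ne_zero ENNReal.ofNat_ne_top,
      eLpNorm_eq_lintegral_rpow_enorm_toReal two_ne_zero ENNReal.ofNat_ne_top] at h
    simp only [ENNReal.toReal_ofNat] at h
    have h' := congrArg (fun z : ℝ≥0∞ => z ^ (2 : ℝ)) h
    simp only [← ENNReal.rpow_mul] at h'
    simpa using h'
  have hc1 : Continuous (𝓕 f1) :=
    VectorFourier.fourierIntegral_continuous Real.continuous_fourierChar
      (by exact continuous_inner) hi1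
  have hch := mul_meas_ge_le_lintegral (μ := (volume : Measure V))
    (f := fun x => ‖𝓕 f1 x‖ₑ ^ (2 : ℝ))
    (hc1.enorm.measurable.pow_const _) (ENNReal.ofReal ((t / 2) ^ (2 : ℝ)))
  have hind : ∫⁻ x, ‖f1 x‖ₑ ^ (2 : ℝ) = ∫⁻ x, A.indicator (fun x => ‖f x‖ₑ ^ (2 : ℝ)) x := by
    refine lintegral_congr fun x => ?_
    by_cases hx : x ∈ A <;> simp [hf1, hx]
  rw [hpl, hind] at hch
  have hconst : ENNReal.ofReal (4 * t ^ (-2 : ℝ)) * ENNReal.ofReal ((t / 2) ^ (2 : ℝ)) = 1 := by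
    rw [← ENNReal.ofReal_mul (by positivity), ← ENNReal.ofReal_one]
    congr 1
    rw [Real.rpow_neg ht.le]
    have : t ^ (2 : ℝ) ≠ 0 := by positivity
    rw [Real.div_rpow ht.le (by norm_num)]
    norm_num
    norm_num at this
    field_simp
  calc volume {x | t < ‖𝓕 f x‖}
      ≤ volume {x | ENNReal.ofReal ((t / 2) ^ (2 : ℝ)) ≤ ‖𝓕 f1 x‖ₑ ^ (2 : ℝ)} := measure_mono hsub
    _ = ENNReal.ofReal (4 * t ^ (-2 : ℝ)) * (ENNReal.ofReal ((t / 2) ^ (2 : ℝ)) *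
          volume {x | ENNReal.ofReal ((t / 2) ^ (2 : ℝ)) ≤ ‖𝓕 f1 x‖ₑ ^ (2 : ℝ)}) := by
        rw [← mul_assoc, hconst, one_mul]
    _ ≤ _ := by gcongr

/-- The Hausdorff-Young inequality strictly between `L¹` and `L²`, without the sharp constant: the
weak-type bound is integrated over all heights. -/
theorem lintegral_fourier_rpow_le {p r : ℝ} (hpr : p.HolderConjugate r) (hp2 : p < 2) {f : V → ℂ}
    (hfm : Measurable f) (hf : Integrable f) (hf2 : MemLp f 2)
    (hfp : Integrable fun x => ‖f x‖ ^ p) :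
    ∫⁻ x, ENNReal.ofReal (‖𝓕 f x‖ ^ r) ≤
      ENNReal.ofReal (r * 4 * (2 ^ (r - 2) / (r - 2)) * (∫ x, ‖f x‖ ^ p) ^ (r - 1)) := by
  have hp0 : 0 < p := hpr.pos
  have hp1 : 0 < p - 1 := hpr.sub_one_pos
  have hr0 : 0 < r := hpr.symm.pos
  have hr2 : 2 < r := by
    have h := hpr.sub_one_mul_conj
    nlinarith
  have hrel : (1 - p) * (r - 2) + 2 = p := by
    have h := hpr.sub_one_mul_conj
    linarith
  rcases (integral_nonneg (f := fun x => ‖f x‖ ^ p) fun x => by positivity).eq_or_lt with h0 | ha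
  · have hz : ∀ᵐ x, f x = 0 := by
      have := (integral_eq_zero_iff_of_nonneg (f := fun x => ‖f x‖ ^ p)
        (fun x => by positivity) hfp).1 h0.symm
      filter_upwards [this] with x hx
      simpa [Real.rpow_eq_zero (norm_nonneg _) hp0.ne'] using hx
    have : 𝓕 f = 0 := by
      ext x
      rw [Real.fourier_eq]
      exact integral_eq_zero_of_ae (by filter_upwards [hz] with y hy; simp [hy])
    simp [this, Real.zero_rpow hr0.ne']
  set a := ∫ x, ‖f x‖ ^ p with haa
  have hc : Continuous (𝓕 f) :=
    VectorFourier.fourierIntegral_continuous Real.continuous_fourierChar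
      (by exact continuous_inner) hf
  rw [lintegral_rpow_eq_lintegral_meas_lt_mul _ (Filter.Eventually.of_forall fun x => norm_nonneg _)
    hc.norm.aemeasurable hr0]
  have hstep : ∀ t ∈ Set.Ioi (0 : ℝ), volume {x | t < ‖𝓕 f x‖} * ENNReal.ofReal (t ^ (r - 1)) ≤
      ∫⁻ x, 4 * ‖f x‖ₑ ^ (2 : ℝ) * ({z : ℝ × V | z.1 * ‖f z.2‖ ^ (p - 1) ≤ 2 * a} : Set _).indicator
        (fun z => ENNReal.ofReal (z.1 ^ (r - 3))) (t, x) := by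
    intro t ht
    have ht' : 0 < t := ht
    refine (mul_le_mul_left (measure_lt_norm_fourier_le hpr hfm hf hf2 hfp ha ht') _).trans ?_
    rw [mul_right_comm, ← ENNReal.ofReal_mul (by positivity), ← lintegral_const_mul']
    · refine lintegral_mono fun x => ?_
      by_cases hx : t * ‖f x‖ ^ (p - 1) ≤ 2 * a
      · rw [Set.indicator_of_mem (by exact hx), Set.indicator_of_mem (by exact hx)]
        rw [show (4 : ℝ) * t ^ (-2 : ℝ) * t ^ (r - 1) = 4 * t ^ (r - 3) by
          rw [mul_assoc, ← Real.rpow_add ht']; ring_nf, ENNReal.ofReal_mul (by norm_num)]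
        rw [ENNReal.ofReal_ofNat]
        exact le_of_eq (by ring)
      · rw [Set.indicator_of_notMem (by exact hx)]
        simp
    · exact ENNReal.ofReal_ne_top
  have hmeas : Measurable fun z : ℝ × V => 4 * ‖f z.2‖ₑ ^ (2 : ℝ) *
      ({z : ℝ × V | z.1 * ‖f z.2‖ ^ (p - 1) ≤ 2 * a} : Set _).indicator
        (fun z => ENNReal.ofReal (z.1 ^ (r - 3))) z := by
    refine Measurable.mul (by fun_prop) (Measurable.indicator (by fun_prop) ?_)
    exact measurableSet_le (by fun_prop) measurable_const
  have hinner : ∀ x, ∫⁻ t in Set.Ioi (0 : ℝ), 4 * ‖f x‖ₑ ^ (2 : ℝ) *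
      ({z : ℝ × V | z.1 * ‖f z.2‖ ^ (p - 1) ≤ 2 * a} : Set _).indicator
        (fun z => ENNReal.ofReal (z.1 ^ (r - 3))) (t, x) ≤
      ENNReal.ofReal (4 * (2 ^ (r - 2) / (r - 2)) * a ^ (r - 2)) * ENNReal.ofReal (‖f x‖ ^ p) := by
    intro x
    rw [lintegral_const_mul' _ _ (by finiteness)]
    rcases (norm_nonneg (f x)).eq_or_lt with h0 | h0
    · have : f x = 0 := norm_eq_zero.1 h0.symm
      simp [this]
    have hM : 0 ≤ 2 * a / ‖f x‖ ^ (p - 1) := by positivity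
    have : ∀ t : ℝ, ({z : ℝ × V | z.1 * ‖f z.2‖ ^ (p - 1) ≤ 2 * a} : Set _).indicator
        (fun z => ENNReal.ofReal (z.1 ^ (r - 3))) (t, x) =
        (Set.Iic (2 * a / ‖f x‖ ^ (p - 1))).indicator (fun t => ENNReal.ofReal (t ^ (r - 3))) t := by
      intro t
      have hiff : t * ‖f x‖ ^ (p - 1) ≤ 2 * a ↔ t ≤ 2 * a / ‖f x‖ ^ (p - 1) :=
        (le_div_iff₀ (by positivity)).symm
      by_cases ht : t * ‖f x‖ ^ (p - 1) ≤ 2 * a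
      · rw [Set.indicator_of_mem (by exact ht), Set.indicator_of_mem (by exact hiff.1 ht)]
      · rw [Set.indicator_of_notMem (by exact ht),
          Set.indicator_of_notMem (show t ∉ Set.Iic _ from fun h => ht (hiff.2 h))]
    simp_rw [this]
    rw [lintegral_rpow_indicator_eq hr2 hM, ← ofReal_norm, ENNReal.ofReal_rpow_of_pos h0,
      show (4 : ℝ≥0∞) = ENNReal.ofReal 4 by simp, ← ENNReal.ofReal_mul (by norm_num),
      ← ENNReal.ofReal_mul (by positivity), ← ENNReal.ofReal_mul
        (by have : 0 < r - 2 := by linarith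
            positivity)]
    refine ENNReal.ofReal_le_ofReal (le_of_eq ?_)
    rw [Real.div_rpow (by positivity) (by positivity), Real.mul_rpow (by norm_num) ha.le,
      ← Real.rpow_mul h0.le]
    have : ‖f x‖ ^ p = ‖f x‖ ^ (2 : ℝ) / ‖f x‖ ^ ((p - 1) * (r - 2)) := by
      rw [← Real.rpow_sub h0]
      congr 1
      linarith
    rw [this]
    ring
  calc ENNReal.ofReal r * ∫⁻ t in Set.Ioi (0 : ℝ),
        volume {x | t < ‖𝓕 f x‖} * ENNReal.ofReal (t ^ (r - 1))
      ≤ ENNReal.ofReal r * ∫⁻ t in Set.Ioi (0 : ℝ), ∫⁻ x, 4 * ‖f x‖ₑ ^ (2 : ℝ) *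
        ({z : ℝ × V | z.1 * ‖f z.2‖ ^ (p - 1) ≤ 2 * a} : Set _).indicator
        (fun z => ENNReal.ofReal (z.1 ^ (r - 3))) (t, x) := by
        gcongr 1
        exact setLIntegral_mono' measurableSet_Ioi hstep
    _ = ENNReal.ofReal r * ∫⁻ x, ∫⁻ t in Set.Ioi (0 : ℝ), 4 * ‖f x‖ₑ ^ (2 : ℝ) *
        ({z : ℝ × V | z.1 * ‖f z.2‖ ^ (p - 1) ≤ 2 * a} : Set _).indicator
        (fun z => ENNReal.ofReal (z.1 ^ (r - 3))) (t, x) := by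
        congr 1
        exact lintegral_lintegral_swap hmeas.aemeasurable
    _ ≤ ENNReal.ofReal r * ∫⁻ x, ENNReal.ofReal (4 * (2 ^ (r - 2) / (r - 2)) * a ^ (r - 2)) *
          ENNReal.ofReal (‖f x‖ ^ p) := by
        gcongr 1
        exact lintegral_mono hinner
    _ = _ := by
        rw [lintegral_const_mul' _ _ ENNReal.ofReal_ne_top,
          ← ofReal_integral_eq_lintegral_ofReal hfp
            (Filter.Eventually.of_forall fun x => by positivity), ← haa,
          ← ENNReal.ofReal_mul (by have : 0 < r - 2 := by linarith
                                   positivity), ← ENNReal.ofReal_mul hr0.le]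
        congr 1
        rw [show r - 1 = r - 2 + 1 by ring, Real.rpow_add ha, Real.rpow_one]
        ring

/-- The Hausdorff-Young inequality, with some constant. -/
theorem exists_eLpNorm_fourier_le {p q : ℝ≥0∞} (hp1 : 1 ≤ p) (hp2 : p ≤ 2)
    (hpq : p⁻¹ + q⁻¹ = 1) :
    ∃ C : NNReal, ∀ f : V → ℂ, Measurable f → Integrable f → MemLp f 2 →
      eLpNorm (𝓕 f) q volume ≤ C * eLpNorm f p volume := by
  rcases hp1.eq_or_lt with rfl | hp1'
  · obtain rfl : q = ∞ := by simpa using hpq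
    refine ⟨1, fun f _ _ _ => ?_⟩
    rw [eLpNorm_exponent_top, ENNReal.coe_one, one_mul, eLpNorm_one_eq_lintegral_enorm]
    refine essSup_le_of_ae_le _ (Filter.Eventually.of_forall fun x => ?_)
    change ‖𝓕 f x‖ₑ ≤ ∫⁻ x, ‖f x‖ₑ
    rw [Real.fourier_eq]
    refine (enorm_integral_le_lintegral_enorm _).trans (le_of_eq ?_)
    exact lintegral_congr fun y => by rw [← ofReal_norm, Circle.norm_smul, ofReal_norm]
  rcases hp2.eq_or_lt with rfl | hp2'
  · obtain rfl : q = 2 := by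
      have h : (2 : ℝ≥0∞)⁻¹ + 2⁻¹ = 2⁻¹ + q⁻¹ := by rw [hpq, ENNReal.inv_two_add_inv_two]
      have := (ENNReal.add_right_inj (by simp)).1 h
      simpa using this.symm
    exact ⟨1, fun f _ hf hf2 => by simp [eLpNorm_fourier_two hf hf2]⟩
  have hp : p ≠ ∞ := ne_top_of_le_ne_top ENNReal.ofNat_ne_top hp2
  have hp0 : p ≠ 0 := (one_pos.trans hp1').ne'
  have hq0 : q ≠ 0 := by rintro rfl; simp at hpq
  have hq : q ≠ ∞ := by
    rintro rfl
    simp only [ENNReal.inv_top, add_zero, ENNReal.inv_eq_one] at hpq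
    exact hp1'.ne' hpq
  have hc : p.toReal.HolderConjugate q.toReal := by
    refine ⟨?_, ENNReal.toReal_pos hp0 hp, ENNReal.toReal_pos hq0 hq⟩
    have := congrArg ENNReal.toReal hpq
    rw [ENNReal.toReal_add (by simpa using hp0) (by simpa using hq0)] at this
    simpa using this
  have hp2r : p.toReal < 2 := by
    simpa using (ENNReal.toReal_lt_toReal hp ENNReal.ofNat_ne_top).2 hp2'
  set P := p.toReal
  set r := q.toReal
  have hr2 : 2 < r := by
    have h := hc.sub_one_mul_conj
    nlinarith [hc.sub_one_pos, hc.pos]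
  set K := r * 4 * (2 ^ (r - 2) / (r - 2)) with hK
  have hK0 : 0 ≤ K := by
    have : 0 < r - 2 := by linarith
    positivity
  refine ⟨(ENNReal.ofReal (K ^ (1 / r))).toNNReal, fun f hfm hf hf2 => ?_⟩
  rw [ENNReal.coe_toNNReal ENNReal.ofReal_ne_top]
  have hfp : Integrable fun x => ‖f x‖ ^ P := by
    have : MemLp f p := by
      refine ⟨hf.aestronglyMeasurable, ?_⟩
      rw [eLpNorm_lt_top_iff_lintegral_rpow_enorm_lt_top hp0 hp]
      refine lt_of_le_of_lt (lintegral_mono (g := fun x => ‖f x‖ₑ + ‖f x‖ₑ ^ (2 : ℝ)) fun x => ?_) ?_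
      · rcases le_total ‖f x‖ₑ 1 with h | h
        · refine le_add_right ?_
          simpa using ENNReal.rpow_le_rpow_of_exponent_ge h hc.lt.le
        · refine le_add_left ?_
          exact ENNReal.rpow_le_rpow_of_exponent_le h hp2r.le
      · rw [lintegral_add_left hfm.enorm]
        refine ENNReal.add_lt_top.2 ⟨hf.2, ?_⟩
        have := (eLpNorm_lt_top_iff_lintegral_rpow_enorm_lt_top two_ne_zero ENNReal.ofNat_ne_top).1
          hf2.2
        simpa using this
    exact this.integrable_norm_rpow hp0 hp
  have main := lintegral_fourier_rpow_le hc hp2r hfm hf hf2 hfp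
  have ha : 0 ≤ ∫ x, ‖f x‖ ^ P := integral_nonneg fun x => by positivity
  rw [eLpNorm_eq_lintegral_rpow_enorm_toReal hp0 hp, eLpNorm_eq_lintegral_rpow_enorm_toReal hq0 hq]
  have e1 : ∀ (g : V → ℂ) {s : ℝ}, 0 < s →
      ∫⁻ x, ‖g x‖ₑ ^ s = ∫⁻ x, ENNReal.ofReal (‖g x‖ ^ s) := fun g s hs =>
    lintegral_congr fun x => by
      rw [← ofReal_norm, ENNReal.ofReal_rpow_of_nonneg (norm_nonneg _) hs.le]
  rw [e1 _ hc.symm.pos, e1 _ hc.pos, ← ofReal_integral_eq_lintegral_ofReal hfp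
    (Filter.Eventually.of_forall fun x => by positivity)]
  refine (ENNReal.rpow_le_rpow main (one_div_nonneg.2 hc.symm.pos.le)).trans (le_of_eq ?_)
  have hr0 := hc.symm.pos
  have hP0 := hc.pos
  rw [ENNReal.ofReal_rpow_of_nonneg (by positivity) (by positivity),
    ENNReal.ofReal_rpow_of_nonneg ha (by positivity), ← ENNReal.ofReal_mul (by positivity)]
  congr 1
  rw [Real.mul_rpow hK0 (by positivity), ← Real.rpow_mul ha]
  congr 2
  change (r - 1) * (1 / r) = 1 / P
  have := hc.inv_add_inv_eq_one
  field_simp at this ⊢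
  linarith

end HausdorffYoung

/-! ### Translations, and continuity of the short-time Fourier transform -/

section Translation

open FourierTransform Filter
open scoped Topology

variable {d : ℕ}

/-- Translation `T_x ψ = ψ(· - x)` of a Schwartz function. -/
noncomputable abbrev translate (x : Rd d) (ψ : 𝓢(Rd d, ℂ)) : 𝓢(Rd d, ℂ) := compSubConstCLM ℂ x ψ

theorem seminorm_translate_le (k l : ℕ) (x : Rd d) (ψ : 𝓢(Rd d, ℂ)) :
    SchwartzMap.seminorm ℂ k l (translate x ψ) ≤
      (1 + ‖x‖) ^ k * (2 ^ k * (Finset.Iic (k, l)).sup (schwartzSeminormFamily ℂ (Rd d) ℂ) ψ) := by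
  refine seminorm_le_bound ℂ k l _ (by positivity) fun t => ?_
  have h1 : iteratedFDeriv ℝ l (translate x ψ) t = iteratedFDeriv ℝ l ψ (t - x) :=
    iteratedFDeriv_comp_sub l x t
  rw [h1]
  have h2 : ‖t‖ ≤ (1 + ‖x‖) * (1 + ‖t - x‖) := by
    have := norm_add_le (t - x) x
    rw [sub_add_cancel] at this
    nlinarith [norm_nonneg x, norm_nonneg (t - x), mul_nonneg (norm_nonneg x) (norm_nonneg (t - x))]
  calc ‖t‖ ^ k * ‖iteratedFDeriv ℝ l ψ (t - x)‖
      ≤ ((1 + ‖x‖) * (1 + ‖t - x‖)) ^ k * ‖iteratedFDeriv ℝ l ψ (t - x)‖ := by gcongr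
    _ = (1 + ‖x‖) ^ k * ((1 + ‖t - x‖) ^ k * ‖iteratedFDeriv ℝ l ψ (t - x)‖) := by
        rw [mul_pow]; ring
    _ ≤ _ := by
        gcongr ?_ * ?_
        exact one_add_le_sup_seminorm_apply (𝕜 := ℂ) (m := (k, l)) le_rfl le_rfl ψ (t - x)

/-- Continuity of translation at `0`, quantitatively: by the mean value inequality the difference
costs one more derivative. -/
theorem seminorm_translate_sub_le (k l : ℕ) (h : Rd d) (ψ : 𝓢(Rd d, ℂ)) :
    SchwartzMap.seminorm ℂ k l (translate h ψ - ψ) ≤ ‖h‖ * (1 + ‖h‖) ^ k *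
      (2 ^ k * (Finset.Iic (k, l + 1)).sup (schwartzSeminormFamily ℂ (Rd d) ℂ) ψ) := by
  refine seminorm_le_bound ℂ k l _ (by positivity) fun t => ?_
  have h1 : iteratedFDeriv ℝ l (⇑(translate h ψ - ψ)) t =
      iteratedFDeriv ℝ l ψ (t - h) - iteratedFDeriv ℝ l ψ t := by
    have : (⇑(translate h ψ - ψ) : Rd d → ℂ) = (fun s => ψ (s - h)) - ⇑ψ := by
      ext s; rfl
    rw [this, iteratedFDeriv_sub_apply, iteratedFDeriv_comp_sub]
    · exact ((ψ.smooth l).comp (contDiff_id.sub contDiff_const)).contDiffAt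
    · exact (ψ.smooth l).contDiffAt
  rw [h1]
  set S := (Finset.Iic (k, l + 1)).sup (schwartzSeminormFamily ℂ (Rd d) ℂ) ψ with hS
  have hbound : ∀ s ∈ segment ℝ t (t - h),
      ‖fderiv ℝ (iteratedFDeriv ℝ l ψ) s‖ * ‖t‖ ^ k ≤ (1 + ‖h‖) ^ k * (2 ^ k * S) := by
    intro s hs
    rw [norm_fderiv_iteratedFDeriv]
    have hts : ‖t - s‖ ≤ ‖h‖ := by
      obtain ⟨a, b, ha, hb, hab, rfl⟩ := hs
      have : t - (a • t + b • (t - h)) = b • h := by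
        have : t = (a + b) • t := by rw [hab, one_smul]
        nth_rewrite 1 [this]
        module
      rw [this, norm_smul, Real.norm_of_nonneg hb]
      nlinarith [norm_nonneg h]
    have h2 : ‖t‖ ≤ (1 + ‖h‖) * (1 + ‖s‖) := by
      have := norm_add_le (t - s) s
      rw [sub_add_cancel] at this
      nlinarith [norm_nonneg h, norm_nonneg s, mul_nonneg (norm_nonneg h) (norm_nonneg s)]
    calc ‖iteratedFDeriv ℝ (l + 1) ψ s‖ * ‖t‖ ^ k
        ≤ ‖iteratedFDeriv ℝ (l + 1) ψ s‖ * ((1 + ‖h‖) * (1 + ‖s‖)) ^ k := by gcongr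
      _ = (1 + ‖h‖) ^ k * ((1 + ‖s‖) ^ k * ‖iteratedFDeriv ℝ (l + 1) ψ s‖) := by
          rw [mul_pow]; ring
      _ ≤ _ := by
          gcongr ?_ * ?_
          exact one_add_le_sup_seminorm_apply (𝕜 := ℂ) (m := (k, l + 1)) le_rfl le_rfl ψ s
  rcases (norm_nonneg t).eq_or_lt with h0 | h0
  · rcases Nat.eq_zero_or_pos k with rfl | hk
    · have := (convex_segment t (t - h)).norm_image_sub_le_of_norm_fderiv_le (𝕜 := ℝ)
        (f := iteratedFDeriv ℝ l ψ) (C := (1 + ‖h‖) ^ 0 * (2 ^ 0 * S))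
        (fun s _ => ((ψ.smooth (l + 1)).differentiable_iteratedFDeriv
          (by exact_mod_cast Nat.lt_succ_self l)).differentiableAt)
        (fun s hs => by simpa using hbound s hs) (left_mem_segment ℝ _ _) (right_mem_segment ℝ _ _)
      simp only [pow_zero, one_mul, mul_one, sub_sub_cancel_left, norm_neg] at this ⊢
      linarith
    · rw [← h0, zero_pow hk.ne', zero_mul]
      positivity
  · have := (convex_segment t (t - h)).norm_image_sub_le_of_norm_fderiv_le (𝕜 := ℝ)
        (f := iteratedFDeriv ℝ l ψ) (C := (1 + ‖h‖) ^ k * (2 ^ k * S) / ‖t‖ ^ k)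
        (fun s _ => ((ψ.smooth (l + 1)).differentiable_iteratedFDeriv
          (by exact_mod_cast Nat.lt_succ_self l)).differentiableAt)
        (fun s hs => (le_div_iff₀ (by positivity)).2 (hbound s hs))
        (left_mem_segment ℝ _ _) (right_mem_segment ℝ _ _)
    rw [sub_sub_cancel_left, norm_neg] at this
    calc _ ≤ ‖t‖ ^ k * ((1 + ‖h‖) ^ k * (2 ^ k * S) / ‖t‖ ^ k * ‖h‖) := by gcongr
      _ = _ := by field_simp

/-- Every continuous seminorm of a translate grows at most polynomially in the vector. -/
theorem exists_seminorm_translate_le (q : Seminorm ℂ 𝓢(Rd d, ℂ)) (hq : Continuous q) :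
    ∃ (m : ℕ) (q' : Seminorm ℂ 𝓢(Rd d, ℂ)), Continuous q' ∧
      ∀ x ψ, q (translate x ψ) ≤ (1 + ‖x‖) ^ m * q' ψ := by
  obtain ⟨s, C, -, hC⟩ :=
    Seminorm.bound_of_continuous (schwartz_withSeminorms ℂ (Rd d) ℂ) q hq
  let m := s.sup Prod.fst
  let Q : ℕ × ℕ → Seminorm ℂ 𝓢(Rd d, ℂ) := fun i =>
    ((2 : NNReal) ^ i.1) • (Finset.Iic i).sup (schwartzSeminormFamily ℂ (Rd d) ℂ)
  have hsem : ∀ i, Continuous (schwartzSeminormFamily ℂ (Rd d) ℂ i) :=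
    (schwartz_withSeminorms ℂ (Rd d) ℂ).continuous_seminorm
  have hsup : ∀ t : Finset (ℕ × ℕ),
      Continuous ⇑(t.sup (schwartzSeminormFamily ℂ (Rd d) ℂ)) := fun t => by
    refine Seminorm.continuous_of_le (q := ∑ i ∈ t, schwartzSeminormFamily ℂ (Rd d) ℂ i) ?_
      (Seminorm.finset_sup_le_sum _ _)
    have : ⇑(∑ i ∈ t, schwartzSeminormFamily ℂ (Rd d) ℂ i) =
        fun ψ => ∑ i ∈ t, schwartzSeminormFamily ℂ (Rd d) ℂ i ψ := by
      ext ψ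
      exact sum_apply _ _ _
    rw [this]
    exact continuous_finsetSum _ fun i _ => hsem i
  refine ⟨m, C • ∑ i ∈ s, Q i, ?_, fun x ψ => ?_⟩
  · have : ⇑(C • ∑ i ∈ s, Q i) =
        fun ψ => (C : ℝ) * ∑ i ∈ s, (2 : ℝ) ^ i.1 *
          (Finset.Iic i).sup (schwartzSeminormFamily ℂ (Rd d) ℂ) ψ := by
      ext ψ
      simp [Q, smul_apply, sum_apply, NNReal.smul_def]
    rw [this]
    exact continuous_const.mul (continuous_finsetSum _ fun i _ => continuous_const.mul (hsup _))
  · have h1 : q (translate x ψ) ≤ C * ∑ i ∈ s, schwartzSeminormFamily ℂ (Rd d) ℂ i (translate x ψ) := by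
      refine (hC _).trans ?_
      rw [smul_apply, NNReal.smul_def, smul_eq_mul]
      gcongr
      have := Seminorm.finset_sup_le_sum (schwartzSeminormFamily ℂ (Rd d) ℂ) s (translate x ψ)
      rwa [sum_apply] at this
    refine h1.trans ?_
    rw [smul_apply, NNReal.smul_def, smul_eq_mul, sum_apply, mul_left_comm]
    refine mul_le_mul_of_nonneg_left ?_ C.2
    rw [Finset.mul_sum]
    gcongr with i hi
    refine (seminorm_translate_le i.1 i.2 x ψ).trans ?_
    simp only [Q, smul_apply, NNReal.smul_def, smul_eq_mul, NNReal.coe_pow,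
      NNReal.coe_ofNat]
    gcongr
    · linarith [norm_nonneg x]
    · exact Finset.le_sup (f := Prod.fst) hi

/-- Translation is jointly continuous in the vector and the Schwartz function. -/
theorem continuous_translate :
    Continuous fun z : Rd d × 𝓢(Rd d, ℂ) => translate z.1 z.2 := by
  have hzero : ∀ ψ : 𝓢(Rd d, ℂ), Tendsto (fun h : Rd d => translate h ψ) (𝓝 0) (𝓝 ψ) := by
    intro ψ
    rw [(schwartz_withSeminorms ℂ (Rd d) ℂ).tendsto_nhds]
    rintro ⟨k, l⟩ ε hε
    have hc : Tendsto (fun h : Rd d => ‖h‖ * (1 + ‖h‖) ^ k *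
      (2 ^ k * (Finset.Iic (k, l + 1)).sup (schwartzSeminormFamily ℂ (Rd d) ℂ) ψ)) (𝓝 0) (𝓝 0) := by
      have : Continuous (fun h : Rd d => ‖h‖ * (1 + ‖h‖) ^ k *
        (2 ^ k * (Finset.Iic (k, l + 1)).sup (schwartzSeminormFamily ℂ (Rd d) ℂ) ψ)) := by
        fun_prop
      simpa using this.tendsto 0
    filter_upwards [hc.eventually (gt_mem_nhds hε)] with h hh
    exact (seminorm_translate_sub_le k l h ψ).trans_lt hh
  have hsep : ∀ (ψ : 𝓢(Rd d, ℂ)) (x₀ : Rd d),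
      Tendsto (fun x : Rd d => translate x ψ) (𝓝 x₀) (𝓝 (translate x₀ ψ)) := by
    intro ψ x₀
    have h1 : Tendsto (fun x : Rd d => x - x₀) (𝓝 x₀) (𝓝 0) := by
      have : Continuous (fun x : Rd d => x - x₀) := by fun_prop
      simpa using this.tendsto x₀
    have h2 := ((compSubConstCLM ℂ x₀ : 𝓢(Rd d, ℂ) →L[ℂ] 𝓢(Rd d, ℂ)).continuous.tendsto ψ).comp
      ((hzero ψ).comp h1)
    refine h2.congr fun x => ?_
    simp [translate]
  rw [continuous_iff_continuousAt]
  rintro ⟨x₀, ψ₀⟩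
  have h1 : Tendsto (fun z : Rd d × 𝓢(Rd d, ℂ) => translate z.1 (z.2 - ψ₀)) (𝓝 (x₀, ψ₀)) (𝓝 0) := by
    rw [(schwartz_withSeminorms ℂ (Rd d) ℂ).tendsto_nhds]
    rintro i ε hε
    obtain ⟨m, q', hq', hb⟩ := exists_seminorm_translate_le (schwartzSeminormFamily ℂ (Rd d) ℂ i)
      ((schwartz_withSeminorms ℂ (Rd d) ℂ).continuous_seminorm i)
    have hc : Tendsto (fun z : Rd d × 𝓢(Rd d, ℂ) => (1 + ‖z.1‖) ^ m * q' (z.2 - ψ₀))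
        (𝓝 (x₀, ψ₀)) (𝓝 0) := by
      have : Continuous (fun z : Rd d × 𝓢(Rd d, ℂ) => (1 + ‖z.1‖) ^ m * q' (z.2 - ψ₀)) :=
        (by fun_prop : Continuous fun z : Rd d × 𝓢(Rd d, ℂ) => (1 + ‖z.1‖) ^ m).mul
          (hq'.comp (continuous_snd.sub continuous_const))
      simpa using this.tendsto (x₀, ψ₀)
    filter_upwards [hc.eventually (gt_mem_nhds hε)] with z hz
    rw [sub_zero]
    exact (hb _ _).trans_lt hz
  have h2 : Tendsto (fun z : Rd d × 𝓢(Rd d, ℂ) => translate z.1 ψ₀) (𝓝 (x₀, ψ₀))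
      (𝓝 (translate x₀ ψ₀)) := (hsep ψ₀ x₀).comp (continuous_fst.tendsto (x₀, ψ₀))
  have h3 := h1.add h2
  rw [zero_add] at h3
  refine h3.congr fun z => ?_
  simp [translate]

theorem character_eq_fourierChar (ξ y : Rd d) :
    character ξ y = (Real.fourierChar (-inner ℝ y ξ) : ℂ) := by
  rw [character, Real.fourierChar_apply, real_inner_comm]
  congr 1
  push_cast
  ring

theorem fourier_apply_eq_integral_character (ψ : Rd d → ℂ) (ξ : Rd d) :
    𝓕 ψ ξ = ∫ y, character ξ y * ψ y := by
  rw [Real.fourier_eq]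
  simp_rw [character_eq_fourierChar, Circle.smul_def, smul_eq_mul]

theorem character_add (ξ η y : Rd d) : character (ξ + η) y = character ξ y * character η y := by
  rw [character, character, character, ← Complex.exp_add]
  congr 1
  rw [inner_add_left]
  push_cast
  ring

theorem character_neg (ξ y : Rd d) : character (-ξ) y = (starRingEnd ℂ) (character ξ y) := by
  rw [character, character, ← Complex.exp_conj]
  congr 1
  simp [Complex.conj_ofNat]

theorem norm_character (ξ y : Rd d) : ‖character ξ y‖ = 1 := by
  rw [character, Complex.norm_exp_ofReal_mul_I]

theorem enorm_character (ξ y : Rd d) : ‖character ξ y‖ₑ = 1 := by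
  rw [← ofReal_norm, norm_character, ENNReal.ofReal_one]

theorem character_comm (ξ y : Rd d) : character ξ y = character y ξ := by
  rw [character, character, real_inner_comm]

theorem continuous_character : Continuous fun z : Rd d × Rd d => character z.1 z.2 := by
  unfold character
  fun_prop

theorem fourier_inversion_apply (m : 𝓢(Rd d, ℂ)) (t : Rd d) :
    m t = ∫ η, character (-t) η * 𝓕 m η := by
  have h : 𝓕⁻ (𝓕 m) = m := FourierTransform.fourierInv_fourier_eq m
  have h2 : (𝓕⁻ (𝓕 m)) t = 𝓕 (⇑(𝓕 m : 𝓢(Rd d, ℂ))) (-t) := by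
    rw [SchwartzMap.fourierInv_coe, Real.fourierInv_eq_fourier_neg]
  rw [h] at h2
  rw [h2, fourier_apply_eq_integral_character]

/-- Modulation is translation conjugated by the Fourier transform, so that what is known of
translations carries over to the time-frequency shifts of the window. -/
theorem shiftedWindow_eq_fourierInv (g : 𝓢(Rd d, ℂ)) (x ξ : Rd d) :
    shiftedWindow g x ξ = 𝓕⁻ (translate (-ξ) (𝓕 (translate x g))) := by
  have h : 𝓕 (shiftedWindow g x ξ) = translate (-ξ) (𝓕 (translate x g)) := by
    ext η
    rw [SchwartzMap.fourier_coe, compSubConstCLM_apply, SchwartzMap.fourier_coe,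
      fourier_apply_eq_integral_character, fourier_apply_eq_integral_character]
    refine integral_congr_ae (Eventually.of_forall fun y => ?_)
    simp only [shiftedWindow_apply, sub_neg_eq_add, character_add, compSubConstCLM_apply]
    ring
  rw [← h, FourierTransform.fourierInv_fourier_eq]

theorem continuous_shiftedWindow (g : 𝓢(Rd d, ℂ)) :
    Continuous fun z : Rd d × Rd d => shiftedWindow g z.1 z.2 := by
  simp_rw [shiftedWindow_eq_fourierInv]
  have h1 : Continuous fun z : Rd d × Rd d => translate z.1 g :=
    continuous_translate.comp (continuous_fst.prodMk continuous_const)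
  have h2 : Continuous fun z : Rd d × Rd d => 𝓕 (translate z.1 g) :=
    (FourierTransform.fourierCLM ℂ 𝓢(Rd d, ℂ)).continuous.comp h1
  have h3 : Continuous fun z : Rd d × Rd d => translate (-z.2) (𝓕 (translate z.1 g)) :=
    continuous_translate.comp (continuous_snd.neg.prodMk h2)
  exact (FourierTransform.fourierInvCLM ℂ 𝓢(Rd d, ℂ)).continuous.comp h3

/-- Every continuous seminorm of a time-frequency shift grows at most polynomially in the shift. -/
theorem exists_seminorm_shiftedWindow_le (q : Seminorm ℂ 𝓢(Rd d, ℂ)) (hq : Continuous q)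
    (g : 𝓢(Rd d, ℂ)) :
    ∃ (m : ℕ) (C : ℝ), 0 ≤ C ∧
      ∀ x ξ, q (shiftedWindow g x ξ) ≤ C * (1 + ‖x‖) ^ m * (1 + ‖ξ‖) ^ m := by
  obtain ⟨m₁, q₁, hq₁, h₁⟩ := exists_seminorm_translate_le
    (q.comp (FourierTransform.fourierInvCLM ℂ 𝓢(Rd d, ℂ)).toLinearMap)
    (hq.comp (FourierTransform.fourierInvCLM ℂ 𝓢(Rd d, ℂ)).continuous)
  obtain ⟨m₂, q₂, hq₂, h₂⟩ := exists_seminorm_translate_le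
    (q₁.comp (FourierTransform.fourierCLM ℂ 𝓢(Rd d, ℂ)).toLinearMap)
    (hq₁.comp (FourierTransform.fourierCLM ℂ 𝓢(Rd d, ℂ)).continuous)
  refine ⟨max m₁ m₂, q₂ g, apply_nonneg _ _, fun x ξ => ?_⟩
  rw [shiftedWindow_eq_fourierInv]
  have a := h₁ (-ξ) (𝓕 (translate x g))
  have b := h₂ x g
  rw [norm_neg] at a
  calc q (𝓕⁻ (translate (-ξ) (𝓕 (translate x g))))
      ≤ (1 + ‖ξ‖) ^ m₁ * q₁ (𝓕 (translate x g)) := a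
    _ ≤ (1 + ‖ξ‖) ^ m₁ * ((1 + ‖x‖) ^ m₂ * q₂ g) := by
        gcongr
        exact b
    _ ≤ (1 + ‖ξ‖) ^ (max m₁ m₂) * ((1 + ‖x‖) ^ (max m₁ m₂) * q₂ g) := by
        gcongr
        · linarith [norm_nonneg ξ]
        · exact le_max_left _ _
        · linarith [norm_nonneg x]
        · exact le_max_right _ _
    _ = _ := by ring

theorem continuous_stft (g : 𝓢(Rd d, ℂ)) (f : 𝓢'(Rd d, ℂ)) :
    Continuous fun z : Rd d × Rd d => stft g f z.1 z.2 :=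
  (map_continuous f).comp (continuous_shiftedWindow g)

/-- The absolute value of a tempered distribution, a continuous seminorm. -/
noncomputable def absSeminorm (f : 𝓢'(Rd d, ℂ)) : Seminorm ℂ 𝓢(Rd d, ℂ) :=
  (normSeminorm ℂ ℂ).comp (f : 𝓢(Rd d, ℂ) →ₗ[ℂ] ℂ)

theorem continuous_absSeminorm (f : 𝓢'(Rd d, ℂ)) : Continuous (absSeminorm f) :=
  continuous_norm.comp (map_continuous f)

/-- The short-time Fourier transform of a tempered distribution grows at most polynomially. This is
what makes its products with Schwartz functions integrable. -/
theorem exists_norm_stft_le (g : 𝓢(Rd d, ℂ)) (f : 𝓢'(Rd d, ℂ)) :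
    ∃ (m : ℕ) (C : ℝ), 0 ≤ C ∧
      ∀ x ξ, ‖stft g f x ξ‖ ≤ C * (1 + ‖x‖) ^ m * (1 + ‖ξ‖) ^ m :=
  exists_seminorm_shiftedWindow_le (absSeminorm f) (continuous_absSeminorm f) g

end Translation

/-! ### Tempered distributions commute with integrals of Schwartz functions -/

section Superposition

open FourierTransform Filter BoundedContinuousFunction
open scoped Topology

variable {d : ℕ}

/-- The Banach space of bounded continuous functions on `ℝᵈ` with values in the `l`-linear forms,
in which the weighted `l`-th derivatives of Schwartz functions live. -/
def BoundedMultilinear (d l : ℕ) : Type :=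
  Rd d →ᵇ ContinuousMultilinearMap ℝ (fun _ : Fin l => Rd d) ℂ

namespace BoundedMultilinear

noncomputable instance (l : ℕ) : NormedAddCommGroup (BoundedMultilinear d l) :=
  inferInstanceAs
    (NormedAddCommGroup (Rd d →ᵇ ContinuousMultilinearMap ℝ (fun _ : Fin l => Rd d) ℂ))

noncomputable instance (l : ℕ) : NormedSpace ℂ (BoundedMultilinear d l) :=
  inferInstanceAs
    (NormedSpace ℂ (Rd d →ᵇ ContinuousMultilinearMap ℝ (fun _ : Fin l => Rd d) ℂ))

instance (l : ℕ) : CompleteSpace (BoundedMultilinear d l) :=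
  inferInstanceAs
    (CompleteSpace (Rd d →ᵇ ContinuousMultilinearMap ℝ (fun _ : Fin l => Rd d) ℂ))

/-- The value at a point, a multilinear form. -/
noncomputable def val {l : ℕ} (φ : BoundedMultilinear d l) (t : Rd d) :
    ContinuousMultilinearMap ℝ (fun _ : Fin l => Rd d) ℂ :=
  (show Rd d →ᵇ ContinuousMultilinearMap ℝ (fun _ : Fin l => Rd d) ℂ from φ) t

theorem norm_val_le {l : ℕ} (φ : BoundedMultilinear d l) (t : Rd d) : ‖φ.val t‖ ≤ ‖φ‖ :=
  BoundedContinuousFunction.norm_coe_le_norm (α := Rd d)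
    (β := ContinuousMultilinearMap ℝ (fun _ : Fin l => Rd d) ℂ) φ t

theorem norm_le {l : ℕ} {φ : BoundedMultilinear d l} {C : ℝ} (hC : 0 ≤ C)
    (h : ∀ t, ‖φ.val t‖ ≤ C) : ‖φ‖ ≤ C :=
  (BoundedContinuousFunction.norm_le (α := Rd d)
    (β := ContinuousMultilinearMap ℝ (fun _ : Fin l => Rd d) ℂ) hC).2 h

theorem ext {l : ℕ} {φ ψ : BoundedMultilinear d l} (h : ∀ t, φ.val t = ψ.val t) : φ = ψ :=
  BoundedContinuousFunction.ext h

/-- Evaluation at a point and a family of vectors, a continuous functional. -/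
noncomputable def eval {l : ℕ} (t : Rd d) (m : Fin l → Rd d) : BoundedMultilinear d l →L[ℂ] ℂ :=
  LinearMap.mkContinuous
    { toFun := fun φ => φ.val t m
      map_add' := fun _ _ => rfl
      map_smul' := fun _ _ => rfl } (∏ i, ‖m i‖) fun φ => by
    rw [mul_comm]
    exact ((φ.val t).le_opNorm m).trans (by gcongr; exact φ.norm_val_le t)

theorem eval_apply {l : ℕ} (t : Rd d) (m : Fin l → Rd d) (φ : BoundedMultilinear d l) :
    eval t m φ = φ.val t m := rfl

end BoundedMultilinear

/-- The weighted derivative `t ↦ ‖t‖ᵏ Dˡψ(t)`, as a continuous map from Schwartz functions to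
bounded continuous functions. -/
noncomputable def weightedDeriv (d k l : ℕ) : 𝓢(Rd d, ℂ) →L[ℂ] BoundedMultilinear d l :=
  mkCLMtoNormedSpace
    (fun ψ => (BoundedContinuousFunction.ofNormedAddCommGroup
      (fun t => (‖t‖ ^ k : ℝ) • iteratedFDeriv ℝ l ψ t)
      ((continuous_norm.pow k).smul ((ψ.smooth l).continuous_iteratedFDeriv le_rfl))
      (SchwartzMap.seminorm ℂ k l ψ)
      (fun t => by
        rw [norm_smul, Real.norm_of_nonneg (by positivity)]
        exact le_seminorm ℂ k l ψ t) :
        Rd d →ᵇ ContinuousMultilinearMap ℝ (fun _ : Fin l => Rd d) ℂ))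
    (fun φ ψ => by
      refine BoundedMultilinear.ext fun t => ?_
      change (‖t‖ ^ k : ℝ) • iteratedFDeriv ℝ l (⇑φ + ⇑ψ) t =
        (‖t‖ ^ k : ℝ) • iteratedFDeriv ℝ l φ t + (‖t‖ ^ k : ℝ) • iteratedFDeriv ℝ l ψ t
      rw [iteratedFDeriv_add_apply (φ.smooth l).contDiffAt (ψ.smooth l).contDiffAt, smul_add])
    (fun c ψ => by
      refine BoundedMultilinear.ext fun t => ?_
      change (‖t‖ ^ k : ℝ) • iteratedFDeriv ℝ l (c • ⇑ψ) t =
        c • ((‖t‖ ^ k : ℝ) • iteratedFDeriv ℝ l ψ t)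
      rw [iteratedFDeriv_const_smul_apply (ψ.smooth l).contDiffAt, smul_comm])
    ⟨{(k, l)}, 1, zero_le_one, fun ψ => by
      rw [one_mul, Finset.sup_singleton]
      exact BoundedContinuousFunction.norm_ofNormedAddCommGroup_le _ (apply_nonneg _ _) _⟩

theorem weightedDeriv_val (k l : ℕ) (ψ : 𝓢(Rd d, ℂ)) (t : Rd d) :
    (weightedDeriv d k l ψ).val t = (‖t‖ ^ k : ℝ) • iteratedFDeriv ℝ l ψ t := rfl

theorem norm_weightedDeriv_le (k l : ℕ) (ψ : 𝓢(Rd d, ℂ)) :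
    ‖weightedDeriv d k l ψ‖ ≤ SchwartzMap.seminorm ℂ k l ψ := by
  refine BoundedMultilinear.norm_le (apply_nonneg _ _) fun t => ?_
  rw [weightedDeriv_val, norm_smul, Real.norm_of_nonneg (by positivity)]
  exact le_seminorm ℂ k l ψ t

theorem seminorm_le_norm_weightedDeriv (k l : ℕ) (ψ : 𝓢(Rd d, ℂ)) :
    SchwartzMap.seminorm ℂ k l ψ ≤ ‖weightedDeriv d k l ψ‖ := by
  refine seminorm_le_bound ℂ k l ψ (by positivity) fun t => ?_
  have := (weightedDeriv d k l ψ).norm_val_le t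
  rwa [weightedDeriv_val, norm_smul, Real.norm_of_nonneg (by positivity)] at this

variable {Φ : Rd d → 𝓢(Rd d, ℂ)}

/-- Integrable bounds for the standard seminorms of a family give one for every continuous
seminorm. -/
theorem exists_integrable_bound (hb : ∀ k l : ℕ, ∃ b : Rd d → ℝ, Integrable b ∧
      ∀ x, SchwartzMap.seminorm ℂ k l (Φ x) ≤ b x)
    (q : Seminorm ℂ 𝓢(Rd d, ℂ)) (hq : Continuous q) :
    ∃ b : Rd d → ℝ, Integrable b ∧ ∀ x, q (Φ x) ≤ b x := by
  obtain ⟨s, C, -, hC⟩ :=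
    Seminorm.bound_of_continuous (schwartz_withSeminorms ℂ (Rd d) ℂ) q hq
  choose b hbi hbb using hb
  refine ⟨fun x => C * ∑ i ∈ s, b i.1 i.2 x,
    (integrable_finsetSum _ fun i _ => hbi i.1 i.2).const_mul _, fun x => (hC (Φ x)).trans ?_⟩
  change (C : ℝ) * (s.sup (schwartzSeminormFamily ℂ (Rd d) ℂ)) (Φ x) ≤ _
  refine mul_le_mul_of_nonneg_left ?_ C.2
  have := Seminorm.finset_sup_le_sum (schwartzSeminormFamily ℂ (Rd d) ℂ) s (Φ x)
  rw [_root_.sum_apply] at this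
  exact this.trans (Finset.sum_le_sum fun i _ => hbb i.1 i.2 x)

theorem continuous_family_apply (hΦ : Continuous Φ) (t : Rd d) : Continuous fun x => Φ x t :=
  (BoundedContinuousFunction.evalCLM ℂ t).continuous.comp
    ((toBoundedContinuousFunctionCLM ℂ (Rd d) ℂ).continuous.comp hΦ)

open LineDeriv in
/-- Differentiation under the integral sign for a family of Schwartz functions with integrable
seminorms. -/
theorem iteratedLineDerivOp_apply_eq_integral {l : ℕ} (m : Fin l → Rd d) :
    ∀ {Φ : Rd d → 𝓢(Rd d, ℂ)}, Continuous Φ →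
    (∀ k l : ℕ, ∃ b : Rd d → ℝ, Integrable b ∧ ∀ x, SchwartzMap.seminorm ℂ k l (Φ x) ≤ b x) →
    ∀ {Ψ : 𝓢(Rd d, ℂ)}, (∀ t, Ψ t = ∫ x, Φ x t) →
    ∀ t, (∂^{m} Ψ : 𝓢(Rd d, ℂ)) t = ∫ x, (∂^{m} (Φ x) : 𝓢(Rd d, ℂ)) t := by
  induction l with
  | zero =>
    intro Φ _ _ Ψ hΨ t
    simpa using hΨ t
  | succ l ih =>
    intro Φ hΦ hb Ψ hΨ t
    simp_rw [iteratedLineDerivOp_succ_right]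
    have hc : Continuous fun x => (∂_{m (Fin.last l)} (Φ x) : 𝓢(Rd d, ℂ)) :=
      (lineDerivOpCLM ℂ 𝓢(Rd d, ℂ) (m (Fin.last l))).continuous.comp hΦ
    refine ih (Fin.init m) hc (fun k n => ?_) (fun t => ?_) t
    · exact exists_integrable_bound hb ((schwartzSeminormFamily ℂ (Rd d) ℂ (k, n)).comp
        (lineDerivOpCLM ℂ 𝓢(Rd d, ℂ) (m (Fin.last l))).toLinearMap)
        (((schwartz_withSeminorms ℂ (Rd d) ℂ).continuous_seminorm (k, n)).comp
          (lineDerivOpCLM ℂ 𝓢(Rd d, ℂ) (m (Fin.last l))).continuous)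
    · obtain ⟨b₀, hbi₀, hbb₀⟩ := hb 0 0
      obtain ⟨b, hbi, hbb⟩ := hb 0 1
      have hint : ∀ t, Integrable fun x => Φ x t := fun t =>
        hbi₀.mono' (continuous_family_apply hΦ t).aestronglyMeasurable
          (Eventually.of_forall fun x => (norm_le_seminorm ℂ _ t).trans (hbb₀ x))
      have hbd : ∀ x s, ‖fderiv ℝ (Φ x) s‖ ≤ b x := fun x s => by
        rw [← norm_iteratedFDeriv_one]
        exact (norm_iteratedFDeriv_le_seminorm ℂ _ 1 s).trans (hbb x)
      have hm : Continuous fun x => fderiv ℝ (Φ x) t :=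
        (BoundedContinuousFunction.evalCLM ℂ t).continuous.comp
          ((toBoundedContinuousFunctionCLM ℂ (Rd d) (Rd d →L[ℝ] ℂ)).continuous.comp
            ((fderivCLM ℂ (Rd d) ℂ).continuous.comp hΦ))
      have hd := hasFDerivAt_integral_of_dominated_of_fderiv_le (𝕜 := ℝ) (μ := volume)
        (F := fun s x => Φ x s) (F' := fun s x => fderiv ℝ (Φ x) s) (x₀ := t) (bound := b)
        (s := Set.univ) univ_mem
        (Eventually.of_forall fun s => (hint s).aestronglyMeasurable) (hint t)
        hm.aestronglyMeasurable (Eventually.of_forall fun x s _ => hbd x s) hbi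
        (Eventually.of_forall fun x s _ => (Φ x).differentiableAt.hasFDerivAt)
      have hΨ' : (Ψ : Rd d → ℂ) = fun t => ∫ x, Φ x t := funext hΨ
      have hi : Integrable fun x => fderiv ℝ (Φ x) t :=
        hbi.mono' hm.aestronglyMeasurable (Eventually.of_forall fun x => hbd x t)
      simp_rw [lineDerivOp_apply_eq_fderiv]
      rw [hΨ', hd.fderiv, ContinuousLinearMap.integral_apply hi]

/-- A tempered distribution bounded by `‖J ·‖`, for an operator `J` into a normed space, factors
through `J`, by the Hahn-Banach theorem. -/
theorem exists_clm_comp_eq {Y : Type*} [NormedAddCommGroup Y] [NormedSpace ℂ Y]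
    (f : 𝓢'(Rd d, ℂ)) (J : 𝓢(Rd d, ℂ) →L[ℂ] Y) {C : ℝ} (hJ : ∀ ψ, ‖f ψ‖ ≤ C * ‖J ψ‖) :
    ∃ F : Y →L[ℂ] ℂ, ∀ ψ, F (J ψ) = f ψ := by
  let J' : 𝓢(Rd d, ℂ) →ₗ[ℂ] Y := J.toLinearMap
  let f' : 𝓢(Rd d, ℂ) →ₗ[ℂ] ℂ := (f : 𝓢(Rd d, ℂ) →ₗ[ℂ] ℂ)
  have hker : J'.ker ≤ f'.ker := fun ψ hψ => by
    have h0 : J ψ = 0 := hψ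
    have := hJ ψ
    rw [h0, norm_zero, mul_zero] at this
    exact norm_le_zero_iff.1 this
  let f₀ : J'.range →ₗ[ℂ] ℂ := (J'.ker.liftQ f' hker) ∘ₗ J'.quotKerEquivRange.symm.toLinearMap
  have hf₀ : ∀ ψ (h : J' ψ ∈ J'.range), f₀ ⟨J' ψ, h⟩ = f ψ := fun ψ h => by
    have : J'.quotKerEquivRange.symm ⟨J' ψ, h⟩ = J'.ker.mkQ ψ := by
      rw [LinearEquiv.symm_apply_eq]
      rfl
    simp only [f₀, LinearMap.comp_apply, LinearEquiv.coe_coe, this]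
    rfl
  let f₁ : StrongDual ℂ J'.range := f₀.mkContinuous C (by
    rintro ⟨y, hy⟩
    obtain ⟨ψ, rfl⟩ := LinearMap.mem_range.1 hy
    exact (congrArg norm (hf₀ ψ hy)).le.trans (hJ ψ))
  obtain ⟨F, hF, -⟩ := exists_extension_norm_eq J'.range f₁
  exact ⟨F, fun ψ => (hF ⟨J' ψ, ψ, rfl⟩).trans (hf₀ ψ ⟨ψ, rfl⟩)⟩

theorem integrable_weightedDeriv {k l : ℕ} (hΦ : Continuous Φ) {b : Rd d → ℝ}
    (hb : Integrable b) (hbb : ∀ x, SchwartzMap.seminorm ℂ k l (Φ x) ≤ b x) :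
    Integrable fun x => weightedDeriv d k l (Φ x) :=
  hb.mono' ((weightedDeriv d k l).continuous.comp hΦ).aestronglyMeasurable
    (Eventually.of_forall fun x => (norm_weightedDeriv_le _ _ _).trans (hbb x))

theorem weightedDeriv_eq_integral {k l : ℕ} (hΦ : Continuous Φ)
    (hb : ∀ k l : ℕ, ∃ b : Rd d → ℝ, Integrable b ∧
      ∀ x, SchwartzMap.seminorm ℂ k l (Φ x) ≤ b x)
    {Ψ : 𝓢(Rd d, ℂ)} (hΨ : ∀ t, Ψ t = ∫ x, Φ x t) :
    weightedDeriv d k l Ψ = ∫ x, weightedDeriv d k l (Φ x) := by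
  obtain ⟨b, hbi, hbb⟩ := hb k l
  have hi := integrable_weightedDeriv hΦ hbi hbb
  refine BoundedMultilinear.ext fun t => ContinuousMultilinearMap.ext fun m => ?_
  rw [← BoundedMultilinear.eval_apply t m (∫ x, _), ← ContinuousLinearMap.integral_comp_comm _ hi]
  change ((‖t‖ ^ k : ℝ) • iteratedFDeriv ℝ l Ψ t) m =
    ∫ x, ((‖t‖ ^ k : ℝ) • iteratedFDeriv ℝ l (Φ x) t) m
  have := iteratedLineDerivOp_apply_eq_integral m hΦ hb hΨ t
  simp_rw [iteratedLineDerivOp_eq_iteratedFDeriv] at this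
  simp only [_root_.smul_apply]
  rw [this, integral_smul]

/-- If finitely many operators into Banach spaces control a tempered distribution and commute with
an integral of Schwartz functions, so does the distribution. -/
theorem apply_eq_integral_of_norm_le {ι : Type*} [Fintype ι] {E : ι → Type*}
    [∀ i, NormedAddCommGroup (E i)] [∀ i, NormedSpace ℂ (E i)] [∀ i, CompleteSpace (E i)]
    (f : 𝓢'(Rd d, ℂ)) (J : ∀ i, 𝓢(Rd d, ℂ) →L[ℂ] E i) {C : ℝ}
    (hJ : ∀ ψ, ‖f ψ‖ ≤ C * ‖ContinuousLinearMap.pi J ψ‖) {Ψ : 𝓢(Rd d, ℂ)}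
    (hi : ∀ i, Integrable fun x => J i (Φ x)) (hΨ : ∀ i, J i Ψ = ∫ x, J i (Φ x)) :
    f Ψ = ∫ x, f (Φ x) := by
  obtain ⟨F, hFJ⟩ := exists_clm_comp_eq f (ContinuousLinearMap.pi J) hJ
  have hi' : Integrable fun x => ContinuousLinearMap.pi J (Φ x) := Integrable.of_eval hi
  have hJΨ : ContinuousLinearMap.pi J Ψ = ∫ x, ContinuousLinearMap.pi J (Φ x) := by
    ext1 i
    exact (hΨ i).trans (eval_integral hi i).symm
  rw [← hFJ Ψ, hJΨ, ← F.integral_comp_comm hi']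
  simp_rw [hFJ]

/-- A tempered distribution commutes with superpositions of Schwartz functions. The distribution
factors through finitely many weighted derivatives, hence by the Hahn-Banach theorem through a
continuous functional on a Banach space, which commutes with the Bochner integral. -/
theorem apply_eq_integral (f : 𝓢'(Rd d, ℂ)) (hΦ : Continuous Φ)
    (hb : ∀ k l : ℕ, ∃ b : Rd d → ℝ, Integrable b ∧
      ∀ x, SchwartzMap.seminorm ℂ k l (Φ x) ≤ b x)
    {Ψ : 𝓢(Rd d, ℂ)} (hΨ : ∀ t, Ψ t = ∫ x, Φ x t) : f Ψ = ∫ x, f (Φ x) := by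
  obtain ⟨s, C, -, hC⟩ := Seminorm.bound_of_continuous (schwartz_withSeminorms ℂ (Rd d) ℂ)
    (absSeminorm f) (continuous_absSeminorm f)
  refine apply_eq_integral_of_norm_le
    (E := fun i : s => BoundedMultilinear d i.1.2)
    f (fun i : s => weightedDeriv d i.1.1 i.1.2) (C := C)
    (fun ψ => ?_) (fun i => ?_) fun i => ?_
  · refine (hC ψ).trans ?_
    change (C : ℝ) * (s.sup (schwartzSeminormFamily ℂ (Rd d) ℂ)) ψ ≤ _
    refine mul_le_mul_of_nonneg_left ?_ C.2
    refine Seminorm.finset_sup_apply_le (norm_nonneg _) fun i hi => ?_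
    exact (seminorm_le_norm_weightedDeriv i.1 i.2 ψ).trans (norm_le_pi_norm
      (ContinuousLinearMap.pi (fun i : s => weightedDeriv d i.1.1 i.1.2) ψ) ⟨i, hi⟩)
  · obtain ⟨b, hbi, hbb⟩ := hb i.1.1 i.1.2
    exact integrable_weightedDeriv hΦ hbi hbb
  · exact weightedDeriv_eq_integral hΦ hb hΨ

end Superposition

/-! ### Localization of tempered distributions -/

section Localization

open FourierTransform Filter
open scoped Topology

variable {d : ℕ}

theorem character_neg_comm (ξ y : Rd d) : character (-ξ) y = character (-y) ξ := by
  rw [character_neg, character_neg, character_comm]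

theorem one_add_norm_le_mul (x y : Rd d) : 1 + ‖x‖ ≤ (1 + ‖x - y‖) * (1 + ‖y‖) := by
  have := norm_add_le (x - y) y
  rw [sub_add_cancel] at this
  nlinarith [norm_nonneg y, norm_nonneg (x - y), mul_nonneg (norm_nonneg y) (norm_nonneg (x - y))]

theorem integrable_one_add_norm_pow_mul (φ : 𝓢(Rd d, ℂ)) (n : ℕ) :
    Integrable fun t : Rd d => (1 + ‖t‖) ^ n * ‖φ t‖ := by
  have h := ((φ.integrable_pow_mul volume 0).add (φ.integrable_pow_mul volume n)).const_mul (2 ^ n)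
  refine h.mono' ?_ (Eventually.of_forall fun t => ?_)
  · exact (((continuous_const.add continuous_norm).pow n).mul
      φ.continuous.norm).aestronglyMeasurable
  · rw [Real.norm_of_nonneg (by positivity)]
    have h1 : (1 + ‖t‖) ^ n ≤ 2 ^ n * (1 ^ n + ‖t‖ ^ n) := by
      refine (add_pow_le zero_le_one (norm_nonneg t) n).trans ?_
      gcongr
      · norm_num
      · omega
    calc _ ≤ 2 ^ n * (1 ^ n + ‖t‖ ^ n) * ‖φ t‖ := by gcongr
      _ = _ := by simp only [one_pow, Pi.add_apply, pow_zero]; ring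

/-- Multiplying the window by a Schwartz function `m` amounts to convolving the short-time Fourier
transform, in the frequency variable, with the Fourier transform of `m`. -/
theorem apply_mul_eq_integral_stft (f : 𝓢'(Rd d, ℂ)) {m φ Ψ : 𝓢(Rd d, ℂ)} {x ξ : Rd d}
    (h : ∀ t, Ψ t = m t * shiftedWindow φ x ξ t) :
    f Ψ = ∫ η, 𝓕 m η * stft φ f x (ξ - η) := by
  have hs : Continuous fun η : Rd d => shiftedWindow φ x (ξ - η) :=
    Continuous.comp (g := fun z : Rd d × Rd d => shiftedWindow φ z.1 z.2)
      (f := fun η => (x, ξ - η)) (continuous_shiftedWindow φ) (by fun_prop)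
  have h0 : ∀ m' : 𝓢(Rd d, ℂ), Continuous fun η : Rd d => m' η • shiftedWindow φ x (ξ - η) :=
    fun m' => m'.continuous.smul hs
  have h1 := h0 (𝓕 m)
  have hb : ∀ k l : ℕ, ∃ b : Rd d → ℝ, Integrable b ∧
      ∀ η, SchwartzMap.seminorm ℂ k l (𝓕 m η • shiftedWindow φ x (ξ - η)) ≤ b η := by
    intro k l
    obtain ⟨M, C, hC, hMC⟩ := exists_seminorm_shiftedWindow_le
      (schwartzSeminormFamily ℂ (Rd d) ℂ (k, l))
      ((schwartz_withSeminorms ℂ (Rd d) ℂ).continuous_seminorm (k, l)) φ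
    refine ⟨fun η => C * (1 + ‖x‖) ^ M * (1 + ‖ξ‖) ^ M * ((1 + ‖η‖) ^ M * ‖𝓕 m η‖),
      (integrable_one_add_norm_pow_mul _ M).const_mul _, fun η => ?_⟩
    rw [map_smul_eq_mul]
    have h2 : (1 + ‖ξ - η‖) ^ M ≤ (1 + ‖ξ‖) ^ M * (1 + ‖η‖) ^ M := by
      rw [← mul_pow]
      gcongr
      nlinarith [norm_sub_le ξ η, mul_nonneg (norm_nonneg ξ) (norm_nonneg η)]
    calc ‖𝓕 m η‖ * SchwartzMap.seminorm ℂ k l (shiftedWindow φ x (ξ - η))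
        ≤ ‖𝓕 m η‖ * (C * (1 + ‖x‖) ^ M * (1 + ‖ξ - η‖) ^ M) := by
          gcongr
          exact hMC x (ξ - η)
      _ ≤ ‖𝓕 m η‖ * (C * (1 + ‖x‖) ^ M * ((1 + ‖ξ‖) ^ M * (1 + ‖η‖) ^ M)) := by gcongr
      _ = _ := by ring
  rw [apply_eq_integral f h1 hb (Ψ := Ψ) fun t => ?_]
  · simp_rw [map_smul, smul_eq_mul]
    rfl
  · rw [h t, fourier_inversion_apply m t, ← integral_mul_const]
    refine integral_congr_ae (Eventually.of_forall fun η => ?_)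
    simp only [_root_.smul_apply, smul_eq_mul, shiftedWindow_apply, sub_eq_add_neg ξ,
      character_add, character_neg_comm t]
    ring

/-- The product of a Schwartz function with a translate of another one decays rapidly in the
translation vector. -/
theorem one_add_norm_pow_mul_norm_iteratedFDeriv_le (N k l : ℕ) (φ Ψ : 𝓢(Rd d, ℂ)) (y t : Rd d) :
    (1 + ‖y‖) ^ N * (‖t‖ ^ k * ‖iteratedFDeriv ℝ l (fun s => Ψ s * φ (s - y)) t‖) ≤
      ∑ i ∈ Finset.range (l + 1), (l.choose i : ℝ) *
        (2 ^ (N + k) * (Finset.Iic (N + k, i)).sup (schwartzSeminormFamily ℂ (Rd d) ℂ) Ψ) *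
        (2 ^ N * (Finset.Iic (N, l - i)).sup (schwartzSeminormFamily ℂ (Rd d) ℂ) φ) := by
  have h1 := norm_iteratedFDeriv_mul_le (𝕜 := ℝ) (N := l) (n := l) (f := Ψ)
    (g := fun s => φ (s - y)) (Ψ.smooth l) ((φ.smooth l).comp (contDiff_id.sub contDiff_const))
    t le_rfl
  calc _ ≤ (1 + ‖y‖) ^ N * (‖t‖ ^ k * ∑ i ∈ Finset.range (l + 1), (l.choose i : ℝ) *
        ‖iteratedFDeriv ℝ i Ψ t‖ * ‖iteratedFDeriv ℝ (l - i) (fun s => φ (s - y)) t‖) := by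
          gcongr
    _ = ∑ i ∈ Finset.range (l + 1), (1 + ‖y‖) ^ N * (‖t‖ ^ k * ((l.choose i : ℝ) *
        ‖iteratedFDeriv ℝ i Ψ t‖ * ‖iteratedFDeriv ℝ (l - i) (fun s => φ (s - y)) t‖)) := by
          rw [Finset.mul_sum, Finset.mul_sum]
    _ ≤ _ := by
      refine Finset.sum_le_sum fun i _ => ?_
      rw [iteratedFDeriv_comp_sub]
      have h2 := one_add_le_sup_seminorm_apply (𝕜 := ℂ) (m := (N + k, i)) le_rfl le_rfl Ψ t
      have h3 := one_add_le_sup_seminorm_apply (𝕜 := ℂ) (m := (N, l - i)) le_rfl le_rfl φ (t - y)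
      have h4 : (1 + ‖y‖) ^ N ≤ (1 + ‖t - y‖) ^ N * (1 + ‖t‖) ^ N := by
        rw [← mul_pow]
        gcongr
        rw [norm_sub_rev]
        have := one_add_norm_le_mul y t
        linarith
      have h5 : ‖t‖ ^ k ≤ (1 + ‖t‖) ^ k := by gcongr; linarith
      calc _ ≤ (1 + ‖t - y‖) ^ N * (1 + ‖t‖) ^ N * ((1 + ‖t‖) ^ k * ((l.choose i : ℝ) *
          ‖iteratedFDeriv ℝ i Ψ t‖ * ‖iteratedFDeriv ℝ (l - i) φ (t - y)‖)) := by gcongr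
        _ = (l.choose i : ℝ) * ((1 + ‖t‖) ^ (N + k) * ‖iteratedFDeriv ℝ i Ψ t‖) *
            ((1 + ‖t - y‖) ^ N * ‖iteratedFDeriv ℝ (l - i) φ (t - y)‖) := by ring
        _ ≤ _ := by
          refine mul_le_mul (mul_le_mul_of_nonneg_left ?_ (Nat.cast_nonneg _)) ?_
            (by positivity) (by positivity)
          · exact h2
          · exact h3

/-- Resolution of a tempered distribution into its localizations by the translates of `φ`. -/
theorem apply_mul_integral_eq (f : 𝓢'(Rd d, ℂ)) (φ Ψ : 𝓢(Rd d, ℂ)) :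
    f Ψ * ∫ t, φ t = ∫ y, f (smulLeftCLM ℂ Ψ (translate y φ)) := by
  have happ : ∀ y t, smulLeftCLM ℂ Ψ (translate y φ) t = Ψ t * φ (t - y) := fun y t => by
    rw [smulLeftCLM_apply_apply Ψ.hasTemperateGrowth]
    rfl
  have h1 : Continuous fun y : Rd d => smulLeftCLM ℂ Ψ (translate y φ) :=
    (smulLeftCLM ℂ Ψ).continuous.comp
      (continuous_translate.comp (continuous_id.prodMk continuous_const))
  have hb : ∀ k l : ℕ, ∃ b : Rd d → ℝ, Integrable b ∧
      ∀ y, SchwartzMap.seminorm ℂ k l (smulLeftCLM ℂ Ψ (translate y φ)) ≤ b y := by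
    intro k l
    set N := d + 1
    set K := ∑ i ∈ Finset.range (l + 1), (l.choose i : ℝ) *
        (2 ^ (N + k) * (Finset.Iic (N + k, i)).sup (schwartzSeminormFamily ℂ (Rd d) ℂ) Ψ) *
        (2 ^ N * (Finset.Iic (N, l - i)).sup (schwartzSeminormFamily ℂ (Rd d) ℂ) φ)
    have hK : 0 ≤ K := Finset.sum_nonneg fun i _ => by positivity
    refine ⟨fun y => K * (1 + ‖y‖) ^ (-(N : ℝ)), ?_, fun y => ?_⟩
    · refine (integrable_one_add_norm ?_).const_mul K
      simp [N]
    · refine seminorm_le_bound ℂ k l _ (by positivity) fun t => ?_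
      have h2 := one_add_norm_pow_mul_norm_iteratedFDeriv_le N k l φ Ψ y t
      have h3 : (⇑(smulLeftCLM ℂ Ψ (translate y φ)) : Rd d → ℂ) = fun s => Ψ s * φ (s - y) :=
        funext (happ y)
      change _ ≤ K * (1 + ‖y‖) ^ (-(N : ℝ))
      rw [h3, Real.rpow_neg (by positivity), Real.rpow_natCast, ← div_eq_mul_inv,
        le_div_iff₀ (by positivity), mul_comm]
      exact h2
  have h2 := apply_eq_integral f h1 hb (Ψ := (∫ t, φ t) • Ψ) fun t => ?_
  · rw [← h2, map_smul, smul_eq_mul, mul_comm]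
  · simp_rw [happ]
    rw [integral_const_mul, integral_sub_left_eq_self (fun s => φ s), _root_.smul_apply,
      smul_eq_mul, mul_comm]

end Localization

/-! ### Change of window, and the Fourier transform on amalgam spaces -/

section Windows

open FourierTransform Filter
open scoped Topology

variable {d : ℕ}

/-- The composition `f ∘ S` of a tempered distribution with an operator on Schwartz functions. -/
noncomputable def precompose (f : 𝓢'(Rd d, ℂ)) (S : 𝓢(Rd d, ℂ) →L[ℂ] 𝓢(Rd d, ℂ)) : 𝓢'(Rd d, ℂ) :=
  PointwiseConvergenceCLM.precomp ℂ S f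

theorem precompose_apply (f : 𝓢'(Rd d, ℂ)) (S : 𝓢(Rd d, ℂ) →L[ℂ] 𝓢(Rd d, ℂ)) (ψ : 𝓢(Rd d, ℂ)) :
    precompose f S ψ = f (S ψ) := rfl

theorem measurable_enorm_stft (g : 𝓢(Rd d, ℂ)) (f : 𝓢'(Rd d, ℂ)) :
    Measurable (Function.uncurry fun x ξ : Rd d => ‖stft g f x ξ‖ₑ) :=
  (continuous_stft g f).measurable.enorm

theorem continuous_stft_right (g : 𝓢(Rd d, ℂ)) (f : 𝓢'(Rd d, ℂ)) (x : Rd d) :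
    Continuous fun ξ : Rd d => stft g f x ξ :=
  Continuous.comp (g := fun z : Rd d × Rd d => stft g f z.1 z.2) (f := fun ξ => (x, ξ))
    (continuous_stft g f) (by fun_prop)

theorem measurable_eLpNorm_stft (g : 𝓢(Rd d, ℂ)) (f : 𝓢'(Rd d, ℂ)) (p : ℝ≥0∞) :
    Measurable fun x : Rd d => eLpNorm (fun ξ : Rd d => stft g f x ξ) p volume := by
  have h := measurable_eLpNorm_right (ν := (volume : Measure (Rd d))) (measurable_enorm_stft g f) p
  simpa only [eLpNorm_enorm] using h

theorem measurePreserving_const_sub (x : Rd d) :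
    MeasurePreserving (fun y : Rd d => x - y) volume volume :=
  Measure.measurePreserving_sub_left volume x

theorem eLpNorm_comp_sub_const {u : Rd d → ℝ≥0∞} (hu : Measurable u) (x : Rd d) (p : ℝ≥0∞) :
    eLpNorm (fun y => u (y - x)) p volume = eLpNorm u p volume :=
  eLpNorm_comp_measurePreserving hu.aestronglyMeasurable (measurePreserving_sub_right volume x)

theorem eLpNorm_comp_add_const {u : Rd d → ℝ≥0∞} (hu : Measurable u) (x : Rd d) (p : ℝ≥0∞) :
    eLpNorm (fun y => u (y + x)) p volume = eLpNorm u p volume :=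
  eLpNorm_comp_measurePreserving hu.aestronglyMeasurable (measurePreserving_add_right volume x)

theorem eLpNorm_comp_neg {u : Rd d → ℝ≥0∞} (hu : Measurable u) (p : ℝ≥0∞) :
    eLpNorm (fun y => u (-y)) p volume = eLpNorm u p volume :=
  eLpNorm_comp_measurePreserving hu.aestronglyMeasurable (Measure.measurePreserving_neg volume)

/-- Young's inequality `‖a * u‖_p ≤ ‖a‖_1 ‖u‖_p`. -/
theorem eLpNorm_convolution_le {a u : Rd d → ℝ≥0∞} (ha : Measurable a) (hu : Measurable u)
    {p : ℝ≥0∞} (hp : 1 ≤ p) :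
    eLpNorm (fun ξ => ∫⁻ η, a η * u (ξ - η)) p volume ≤ (∫⁻ η, a η) * eLpNorm u p volume := by
  have hm : Measurable (Function.uncurry fun η ξ : Rd d => a η * u (ξ - η)) :=
    (ha.comp measurable_fst).mul (hu.comp (measurable_snd.sub measurable_fst))
  refine (eLpNorm_lintegral_le hm hp).trans ?_
  rw [← lintegral_mul_const _ ha]
  refine lintegral_mono fun η => ?_
  rw [eLpNorm_const_mul_ennreal (f := fun ξ => u (ξ - η))
    (hu.comp (measurable_sub_const η)).aemeasurable, eLpNorm_comp_sub_const hu]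

/-- A factor `m` multiplied into the window costs at most the `L¹` norm of its Fourier transform, by
Young's inequality. -/
theorem eLpNorm_apply_le_of_mul (f : 𝓢'(Rd d, ℂ)) (m φ : 𝓢(Rd d, ℂ)) (y : Rd d)
    {Ψ : Rd d → 𝓢(Rd d, ℂ)} (h : ∀ ξ t, Ψ ξ t = m t * shiftedWindow φ y ξ t)
    {p : ℝ≥0∞} (hp : 1 ≤ p) :
    eLpNorm (fun ξ => f (Ψ ξ)) p volume ≤
      (∫⁻ η, ‖𝓕 m η‖ₑ) * eLpNorm (fun ξ => stft φ f y ξ) p volume := by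
  have h1 : ∀ ξ, ‖f (Ψ ξ)‖ₑ ≤ ∫⁻ η, ‖𝓕 m η‖ₑ * ‖stft φ f y (ξ - η)‖ₑ := fun ξ => by
    rw [apply_mul_eq_integral_stft f (h ξ)]
    refine (enorm_integral_le_lintegral_enorm _).trans_eq ?_
    simp_rw [enorm_mul]
  calc eLpNorm (fun ξ => f (Ψ ξ)) p volume
      ≤ eLpNorm (fun ξ => ∫⁻ η, ‖𝓕 m η‖ₑ * ‖stft φ f y (ξ - η)‖ₑ) p volume :=
        eLpNorm_mono_enorm fun ξ => by simpa using h1 ξ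
    _ ≤ _ := by
        refine (eLpNorm_convolution_le (𝓕 m).continuous.measurable.enorm
          (continuous_stft_right φ f y).measurable.enorm hp).trans_eq ?_
        rw [eLpNorm_enorm]

theorem fourier_translate_apply (m : 𝓢(Rd d, ℂ)) (x η : Rd d) :
    𝓕 (translate x m) η = character η x * 𝓕 m η := by
  rw [SchwartzMap.fourier_coe, SchwartzMap.fourier_coe, fourier_apply_eq_integral_character,
    fourier_apply_eq_integral_character, ← integral_const_mul]
  rw [← integral_add_right_eq_self _ x]
  refine integral_congr_ae (Eventually.of_forall fun y => ?_)
  simp only [compSubConstCLM_apply, add_sub_cancel_right]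
  rw [character_comm, character_add, character_comm y, character_comm x]
  ring

theorem enorm_fourier_translate (m : 𝓢(Rd d, ℂ)) (x η : Rd d) :
    ‖𝓕 (translate x m) η‖ₑ = ‖𝓕 m η‖ₑ := by
  rw [fourier_translate_apply, enorm_mul, enorm_character, one_mul]

theorem lintegral_enorm_fourier_ne_top (m : 𝓢(Rd d, ℂ)) : ∫⁻ η, ‖𝓕 m η‖ₑ ≠ ∞ :=
  ((𝓕 m).integrable (μ := volume)).2.ne

/-- A smooth compactly supported function is a combination of translates of a fixed nonzero
function `g`, with smooth compactly supported coefficients. -/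
theorem exists_eq_sum_mul_translate {g φ : 𝓢(Rd d, ℂ)} (hg : g ≠ 0) (hφ : HasCompactSupport φ) :
    ∃ (s : Finset (Rd d)) (χ : Rd d → 𝓢(Rd d, ℂ)), ∀ t, φ t = ∑ z ∈ s, χ z t * g (t - z) := by
  obtain ⟨a, ha⟩ : ∃ a, g a ≠ 0 := by
    by_contra! h
    exact hg (SchwartzMap.ext h)
  obtain ⟨s, -, hs⟩ := hφ.isCompact.elim_nhds_subcover
    (fun z => {t | g (t - (z - a)) ≠ 0}) fun z _ => by
      refine IsOpen.mem_nhds ?_ (by simpa using ha)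
      exact isOpen_ne_fun (g.continuous.comp (continuous_id.sub continuous_const))
        continuous_const
  set s' : Finset (Rd d) := s.image fun z => z - a
  -- The coefficients are `conj g(· - z) φ / G`; the denominator `G` is positive on the support of `φ`.
  set G : Rd d → ℂ := fun t => ∑ z ∈ s', (starRingEnd ℂ) (g (t - z)) * g (t - z) with hG
  have hconj : ∀ z, ContDiff ℝ ((⊤ : ℕ∞) : WithTop ℕ∞) fun t : Rd d =>
      (starRingEnd ℂ) (g (t - z)) := fun z =>
    Complex.conjCLE.contDiff.comp (g.smooth'.comp (contDiff_id.sub contDiff_const))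
  have hGs : ContDiff ℝ ((⊤ : ℕ∞) : WithTop ℕ∞) G :=
    ContDiff.sum fun z _ => (hconj z).mul (g.smooth'.comp (contDiff_id.sub contDiff_const))
  have hG0 : ∀ t ∈ tsupport φ, G t ≠ 0 := fun t ht => by
    have h1 : G t = ((∑ z ∈ s', Complex.normSq (g (t - z)) : ℝ) : ℂ) := by
      rw [hG]
      push_cast
      exact Finset.sum_congr rfl fun z _ => Complex.normSq_eq_conj_mul_self.symm
    rw [h1, Complex.ofReal_ne_zero]
    obtain ⟨z, hz, hzt⟩ := Set.mem_iUnion₂.1 (hs ht)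
    refine (Finset.sum_pos' (f := fun z => Complex.normSq (g (t - z)))
      (fun z _ => Complex.normSq_nonneg _)
      ⟨z - a, Finset.mem_image_of_mem (fun z => z - a) hz, Complex.normSq_pos.2 hzt⟩).ne'
  have hχs : ∀ z, ContDiff ℝ ((⊤ : ℕ∞) : WithTop ℕ∞) fun t : Rd d =>
      (starRingEnd ℂ) (g (t - z)) * φ t / G t := fun z => by
    rw [contDiff_iff_contDiffAt]
    intro t
    by_cases ht : t ∈ tsupport φ
    · simp_rw [div_eq_mul_inv]
      exact (((hconj z).mul φ.smooth').contDiffAt).mul (hGs.contDiffAt.inv (hG0 t ht))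
    · have h0 : ∀ᶠ t' in 𝓝 t, φ t' = 0 := notMem_tsupport_iff_eventuallyEq.1 ht
      refine contDiffAt_const (c := (0 : ℂ)) |>.congr_of_eventuallyEq ?_
      filter_upwards [h0] with t' ht'
      simp [ht']
  have hχc : ∀ z, HasCompactSupport fun t : Rd d =>
      (starRingEnd ℂ) (g (t - z)) * φ t / G t := fun z =>
    hφ.mono fun t ht h0 => ht (by simp [h0])
  refine ⟨s', fun z => (hχc z).toSchwartzMap (hχs z), fun t => ?_⟩
  change φ t = ∑ z ∈ s', (starRingEnd ℂ) (g (t - z)) * φ t / G t * g (t - z)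
  by_cases ht : t ∈ tsupport φ
  · have h1 : ∑ z ∈ s', (starRingEnd ℂ) (g (t - z)) * φ t / G t * g (t - z) =
        G t * (φ t / G t) := by
      rw [hG, Finset.sum_mul]
      exact Finset.sum_congr rfl fun z _ => by ring
    rw [h1, mul_div_cancel₀ _ (hG0 t ht)]
  · simp [image_eq_zero_of_notMem_tsupport ht]

/-- The amalgam norm with a smooth compactly supported window is controlled by the one with any
other window. -/
theorem exists_amalgamNorm_le {g φ : 𝓢(Rd d, ℂ)} (hg : g ≠ 0) (hφ : HasCompactSupport φ) :
    ∃ C : NNReal, ∀ {p q : ℝ≥0∞}, 1 ≤ p → 1 ≤ q → ∀ f : 𝓢'(Rd d, ℂ),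
      amalgamNorm φ p q f ≤ C * amalgamNorm g p q f := by
  obtain ⟨s, χ, h⟩ := exists_eq_sum_mul_translate hg hφ
  refine ⟨∑ z ∈ s, (∫⁻ η, ‖𝓕 (χ z) η‖ₑ).toNNReal, fun {p q} hp hq f => ?_⟩
  have hpt : ∀ x, eLpNorm (fun ξ => stft φ f x ξ) p volume ≤ ∑ z ∈ s,
      (∫⁻ η, ‖𝓕 (χ z) η‖ₑ) * eLpNorm (fun ξ => stft g f (x + z) ξ) p volume := fun x => by
    set Ψ : Rd d → Rd d → 𝓢(Rd d, ℂ) := fun z ξ =>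
      smulLeftCLM ℂ (translate x (χ z)) (shiftedWindow g (x + z) ξ) with hΨ
    have hΨt : ∀ z ξ t, Ψ z ξ t = translate x (χ z) t * shiftedWindow g (x + z) ξ t :=
      fun z ξ t => by
        rw [hΨ, smulLeftCLM_apply_apply (translate x (χ z)).hasTemperateGrowth, smul_eq_mul]
    have h1 : ∀ ξ, stft φ f x ξ = ∑ z ∈ s, f (Ψ z ξ) := fun ξ => by
      rw [stft, ← map_sum]
      congr 1
      ext t
      rw [_root_.sum_apply, shiftedWindow_apply, h, Finset.mul_sum]
      refine Finset.sum_congr rfl fun z _ => ?_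
      rw [hΨt, shiftedWindow_apply, compSubConstCLM_apply, sub_sub]
      ring
    have h2 : (fun ξ => stft φ f x ξ) = ∑ z ∈ s, fun ξ => f (Ψ z ξ) := by
      ext ξ
      rw [h1, Finset.sum_apply]
    have h3 : ∀ z, Continuous fun ξ => f (Ψ z ξ) := fun z =>
      (map_continuous f).comp ((smulLeftCLM ℂ (translate x (χ z))).continuous.comp
        (Continuous.comp (g := fun z : Rd d × Rd d => shiftedWindow g z.1 z.2)
          (f := fun ξ => (x + z, ξ)) (continuous_shiftedWindow g) (by fun_prop)))
    rw [h2]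
    refine (eLpNorm_sum_le (fun z _ => (h3 z).aestronglyMeasurable) hp).trans ?_
    refine Finset.sum_le_sum fun z _ => ?_
    refine (eLpNorm_apply_le_of_mul f (translate x (χ z)) g (x + z) (hΨt z) hp).trans_eq ?_
    simp_rw [enorm_fourier_translate]
  have hm := measurable_eLpNorm_stft g f p
  calc amalgamNorm φ p q f
      ≤ eLpNorm (∑ z ∈ s, fun x => (∫⁻ η, ‖𝓕 (χ z) η‖ₑ) *
          eLpNorm (fun ξ => stft g f (x + z) ξ) p volume) q volume := by
        refine eLpNorm_mono_enorm fun x => ?_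
        simp only [enorm_eq_self, Finset.sum_apply]
        exact hpt x
    _ ≤ ∑ z ∈ s, eLpNorm (fun x => (∫⁻ η, ‖𝓕 (χ z) η‖ₑ) *
          eLpNorm (fun ξ => stft g f (x + z) ξ) p volume) q volume :=
        eLpNorm_sum_le (fun z _ =>
          ((hm.comp (measurable_add_const z)).const_mul _).aestronglyMeasurable) hq
    _ = ∑ z ∈ s, (∫⁻ η, ‖𝓕 (χ z) η‖ₑ) * amalgamNorm g p q f := by
        refine Finset.sum_congr rfl fun z _ => ?_
        rw [eLpNorm_const_mul_ennreal (f := fun x => eLpNorm (fun ξ => stft g f (x + z) ξ) p volume)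
          (hm.comp (measurable_add_const z)).aemeasurable, eLpNorm_comp_add_const hm]
        rfl
    _ = _ := by
        rw [← Finset.sum_mul, ENNReal.ofNNReal_finsetSum]
        congr 1
        exact Finset.sum_congr rfl fun z _ =>
          (ENNReal.coe_toNNReal (lintegral_enorm_fourier_ne_top _)).symm

/-- The Fourier transform turns a time-frequency shift by a right angle. -/
theorem fourier_shiftedWindow_apply (g : 𝓢(Rd d, ℂ)) (x ξ : Rd d) :
    𝓕 (shiftedWindow g x ξ) = character ξ x • shiftedWindow (𝓕 g) (-ξ) x := by
  ext η
  rw [_root_.smul_apply, shiftedWindow_apply, SchwartzMap.fourier_coe, SchwartzMap.fourier_coe,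
    fourier_apply_eq_integral_character, fourier_apply_eq_integral_character, smul_eq_mul,
    ← integral_const_mul, ← integral_const_mul, ← integral_add_right_eq_self _ x]
  refine integral_congr_ae (Eventually.of_forall fun y => ?_)
  simp only [shiftedWindow_apply, add_sub_cancel_right, sub_neg_eq_add, character_add]
  rw [character_comm _ (y + x), character_comm _ (y + x), character_add, character_add,
    character_comm ξ x, character_comm ξ y, character_comm η y]
  ring

/-- The Fourier transform exchanges the two exponents of the amalgam norm: it exchanges the two
variables of the short-time Fourier transform, and Minkowski's inequality the order of the norms. -/
theorem exists_amalgamNorm_precompose_fourier_le {g : 𝓢(Rd d, ℂ)} (hgc : HasCompactSupport g)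
    (hg : g ≠ 0) {p q : ℝ≥0∞} (hp : 1 ≤ p) (hpq : p ≤ q) :
    ∃ C : NNReal, ∀ f : 𝓢'(Rd d, ℂ),
      amalgamNorm g p q (precompose f (fourierCLM ℂ 𝓢(Rd d, ℂ))) ≤ C * amalgamNorm g q p f := by
  obtain ⟨g₀, hgg⟩ : ∃ g₀ : 𝓢(Rd d, ℂ), 𝓕 g₀ = g := ⟨𝓕⁻ g, FourierTransform.fourier_fourierInv_eq g⟩
  have hg0 : g₀ ≠ 0 := fun h => hg (by
    rw [← hgg, h]
    exact (fourierCLM ℂ 𝓢(Rd d, ℂ)).map_zero)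
  obtain ⟨C, hC⟩ := exists_amalgamNorm_le hg0 hgc
  refine ⟨C, fun f => (hC hp (hp.trans hpq) _).trans ?_⟩
  gcongr
  have h1 : ∀ x ξ, ‖stft g₀ (precompose f (fourierCLM ℂ 𝓢(Rd d, ℂ))) x ξ‖ₑ =
      ‖stft g f (-ξ) x‖ₑ := fun x ξ => by
    rw [stft, precompose_apply]
    change ‖f (𝓕 (shiftedWindow g₀ x ξ))‖ₑ = _
    rw [fourier_shiftedWindow_apply, hgg, map_smul, smul_eq_mul,
      enorm_mul, enorm_character, one_mul]
    rfl
  have h2 : amalgamNorm g₀ p q (precompose f (fourierCLM ℂ 𝓢(Rd d, ℂ))) =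
      eLpNorm (fun x => eLpNorm (fun ξ => ‖stft g f (-ξ) x‖ₑ) p volume) q volume := by
    rw [amalgamNorm]
    refine congrArg (fun u : Rd d → ℝ≥0∞ => eLpNorm u q volume) (funext fun x => ?_)
    rw [← eLpNorm_enorm]
    exact congrArg (fun u : Rd d → ℝ≥0∞ => eLpNorm u p volume) (funext fun ξ => h1 x ξ)
  rw [h2]
  have hm : Measurable (Function.uncurry fun ξ x : Rd d => ‖stft g f (-ξ) x‖ₑ) :=
    Measurable.comp (g := Function.uncurry fun x ξ : Rd d => ‖stft g f x ξ‖ₑ)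
      (f := fun z : Rd d × Rd d => (-z.1, z.2)) (measurable_enorm_stft g f) (by fun_prop)
  refine (eLpNorm_eLpNorm_swap_le hm (zero_lt_one.trans_le hp).ne' hpq).trans_eq ?_
  simp_rw [eLpNorm_enorm]
  exact eLpNorm_comp_neg (u := fun ξ => eLpNorm (fun x => stft g f ξ x) q volume)
    (measurable_eLpNorm_stft g f q) p

end Windows

/-! ### Dilations and mixed-norm Hausdorff-Young inequality -/

section Dilation

open FourierTransform Filter
open scoped Topology

variable {d : ℕ}

theorem measurable_enorm_fourier_left {v : Rd d → Rd d → ℂ} (hv : Continuous (Function.uncurry v)) :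
    Measurable (Function.uncurry fun ξ x : Rd d => ‖𝓕 (fun η => v η ξ) x‖ₑ) := by
  have h1 : StronglyMeasurable fun z : (Rd d × Rd d) × Rd d =>
      character z.1.2 z.2 * v z.2 z.1.1 := by
    refine Continuous.stronglyMeasurable (Continuous.mul ?_ ?_)
    · exact Continuous.comp (g := fun z : Rd d × Rd d => character z.1 z.2)
        (f := fun z : (Rd d × Rd d) × Rd d => (z.1.2, z.2)) continuous_character (by fun_prop)
    · exact Continuous.comp (g := Function.uncurry v)
        (f := fun z : (Rd d × Rd d) × Rd d => (z.2, z.1.1)) hv (by fun_prop)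
  have h3 := (h1.integral_prod_right' (ν := (volume : Measure (Rd d)))).measurable.enorm
  convert! h3 using 2 with z
  simp only [Function.uncurry, fourier_apply_eq_integral_character]

/-- Mixed-norm Hausdorff-Young inequality, for the partial Fourier transform of a function of two
variables. -/
theorem exists_eLpNorm_eLpNorm_fourier_le {p r s : ℝ≥0∞} (hs1 : 1 ≤ s) (hs2 : s ≤ 2)
    (hsr : s⁻¹ + r⁻¹ = 1) (hsp : s ≤ p) (hpr : p ≤ r) :
    ∃ C : NNReal, ∀ v : Rd d → Rd d → ℂ, Continuous (Function.uncurry v) →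
      (∀ ξ, Integrable fun η => v η ξ) → (∀ ξ, MemLp (fun η => v η ξ) 2) →
      eLpNorm (fun x => eLpNorm (fun ξ => 𝓕 (fun η => v η ξ) x) p volume) r volume ≤
        C * eLpNorm (fun η => eLpNorm (fun ξ => v η ξ) p volume) s volume := by
  obtain ⟨C, hC⟩ := exists_eLpNorm_fourier_le (V := Rd d) hs1 hs2 hsr
  refine ⟨C, fun v hv hi h2 => ?_⟩
  have hp0 : p ≠ 0 := (zero_lt_one.trans_le (hs1.trans hsp)).ne'
  have hs0 : s ≠ 0 := (zero_lt_one.trans_le hs1).ne'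
  have hF := measurable_enorm_fourier_left hv
  have hv' : Measurable (Function.uncurry fun η ξ : Rd d => ‖v η ξ‖ₑ) := hv.measurable.enorm
  have hvs : Measurable (Function.uncurry fun ξ η : Rd d => ‖v η ξ‖ₑ) :=
    hv'.comp measurable_swap
  calc eLpNorm (fun x => eLpNorm (fun ξ => 𝓕 (fun η => v η ξ) x) p volume) r volume
      = eLpNorm (fun x => eLpNorm (fun ξ => ‖𝓕 (fun η => v η ξ) x‖ₑ) p volume) r volume := by
        simp_rw [eLpNorm_enorm]
    _ ≤ eLpNorm (fun ξ => eLpNorm (fun x => ‖𝓕 (fun η => v η ξ) x‖ₑ) r volume) p volume :=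
        eLpNorm_eLpNorm_swap_le hF hp0 hpr
    _ ≤ eLpNorm (fun ξ => C * eLpNorm (fun η => ‖v η ξ‖ₑ) s volume) p volume := by
        refine eLpNorm_mono_enorm fun ξ => ?_
        simp only [enorm_eq_self, eLpNorm_enorm]
        exact hC _ (hv.comp (continuous_id.prodMk continuous_const)).measurable (hi ξ) (h2 ξ)
    _ = C * eLpNorm (fun ξ => eLpNorm (fun η => ‖v η ξ‖ₑ) s volume) p volume :=
        eLpNorm_const_mul_ennreal (measurable_eLpNorm_right hvs s).aemeasurable _ _
    _ ≤ C * eLpNorm (fun η => eLpNorm (fun ξ => ‖v η ξ‖ₑ) p volume) s volume := by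
        gcongr
        exact eLpNorm_eLpNorm_swap_le hv' hs0 hsp
    _ = _ := by simp_rw [eLpNorm_enorm]

theorem eLpNorm_comp_const_sub {u : Rd d → ℝ≥0∞} (hu : Measurable u) (x : Rd d) (p : ℝ≥0∞) :
    eLpNorm (fun y => u (x - y)) p volume = eLpNorm u p volume :=
  eLpNorm_comp_measurePreserving (f := fun y => x - y) hu.aestronglyMeasurable
    (measurePreserving_const_sub x)

/-- Integrating the `L^q` norms localized by the translates of `w` recovers the global `L^q`
norm. -/
theorem eLpNorm_eLpNorm_mul_translate {w N : Rd d → ℝ≥0∞} (hw : Measurable w)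
    (hN : Measurable N) {q : ℝ≥0∞} (hq : q ≠ 0) :
    eLpNorm (fun x => eLpNorm (fun y => w (y - x) * N y) q volume) q volume =
      eLpNorm w q volume * eLpNorm N q volume := by
  have hm : Measurable (Function.uncurry fun y x : Rd d => w (y - x) * N y) :=
    Measurable.mul
      (Measurable.comp (f := fun z : Rd d × Rd d => z.1 - z.2) hw (by fun_prop))
      (Measurable.comp (f := fun z : Rd d × Rd d => z.1) hN (by fun_prop))
  rw [eLpNorm_eLpNorm_swap hm hq, ← eLpNorm_const_mul_ennreal hN.aemeasurable]
  refine congrArg (fun v : Rd d → ℝ≥0∞ => eLpNorm v q volume) (funext fun y => ?_)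
  simp_rw [mul_comm _ (N y)]
  rw [eLpNorm_const_mul_ennreal (f := fun x => w (y - x))
    (Measurable.comp (f := fun x : Rd d => y - x) hw (by fun_prop)).aemeasurable,
    eLpNorm_comp_const_sub hw, mul_comm]

/-- The absolute value of the determinant of a linear automorphism, in `[0, ∞]`. -/
noncomputable def absDet (L : Rd d ≃L[ℝ] Rd d) : ℝ≥0∞ :=
  ENNReal.ofReal |LinearMap.det (L.toLinearEquiv : Rd d →ₗ[ℝ] Rd d)|

theorem absDet_ne_zero (L : Rd d ≃L[ℝ] Rd d) : absDet L ≠ 0 := by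
  rw [absDet, Ne, ENNReal.ofReal_eq_zero, not_le, abs_pos]
  exact L.toLinearEquiv.isUnit_det'.ne_zero

theorem absDet_ne_top (L : Rd d ≃L[ℝ] Rd d) : absDet L ≠ ∞ := ENNReal.ofReal_ne_top

theorem map_volume_equiv (L : Rd d ≃L[ℝ] Rd d) :
    Measure.map L volume = (absDet L)⁻¹ • (volume : Measure (Rd d)) := by
  have hdet : LinearMap.det (L.toLinearEquiv : Rd d →ₗ[ℝ] Rd d) ≠ 0 :=
    L.toLinearEquiv.isUnit_det'.ne_zero
  have h := Measure.map_linearMap_addHaar_eq_smul_addHaar (volume : Measure (Rd d)) hdet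
  rw [absDet, ← ENNReal.ofReal_inv_of_pos (abs_pos.2 hdet), ← abs_inv]
  exact h

theorem eLpNorm_comp_equiv {ε : Type*} [TopologicalSpace ε] [ContinuousENorm ε]
    (L : Rd d ≃L[ℝ] Rd d) (u : Rd d → ε) (p : ℝ≥0∞) :
    eLpNorm (fun t => u (L t)) p volume = absDet L ^ (-recip p) * eLpNorm u p volume := by
  have h := L.toHomeomorph.measurableEmbedding.eLpNorm_map_measure (μ := volume) (g := u) (p := p)
  have h1 : eLpNorm (fun t => u (L t)) p volume = eLpNorm u p (Measure.map L volume) := h.symm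
  rw [h1, map_volume_equiv, eLpNorm_smul_measure_of_ne_zero
    (ENNReal.inv_ne_zero.2 (absDet_ne_top L)), ENNReal.inv_rpow, ← ENNReal.rpow_neg, smul_eq_mul,
    recip, one_div]

/-- The dilation `ψ ↦ ψ(L ·)` of Schwartz functions. -/
noncomputable abbrev dilate (L : Rd d ≃L[ℝ] Rd d) : 𝓢(Rd d, ℂ) →L[ℂ] 𝓢(Rd d, ℂ) :=
  compCLMOfContinuousLinearEquiv ℂ L

theorem dilate_apply (L : Rd d ≃L[ℝ] Rd d) (ψ : 𝓢(Rd d, ℂ)) (t : Rd d) :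
    dilate L ψ t = ψ (L t) := rfl

theorem fourier_dilate_apply {L : Rd d ≃L[ℝ] Rd d} (hL : ∀ s t, inner ℝ (L s) t = inner ℝ s (L t))
    (ψ : 𝓢(Rd d, ℂ)) (ξ : Rd d) :
    ‖𝓕 (dilate L ψ) (L ξ)‖ₑ = (absDet L)⁻¹ * ‖𝓕 ψ ξ‖ₑ := by
  have h1 : 𝓕 (dilate L ψ) (L ξ) = ∫ t, character ξ (L t) * ψ (L t) := by
    rw [SchwartzMap.fourier_coe, fourier_apply_eq_integral_character]
    simp only [character, hL, dilate_apply]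
  have h2 : ∫ t, character ξ (L t) * ψ (L t) =
      ∫ t, character ξ t * ψ t ∂(Measure.map L volume) :=
    (L.toHomeomorph.measurableEmbedding.integral_map (μ := volume)
      (fun t => character ξ t * ψ t)).symm
  rw [h1, h2, map_volume_equiv, integral_smul_measure, ← fourier_apply_eq_integral_character,
    enorm_smul, SchwartzMap.fourier_coe]
  congr 1
  rw [Real.enorm_eq_ofReal ENNReal.toReal_nonneg, ENNReal.ofReal_toReal]
  exact ENNReal.inv_ne_top.2 (absDet_ne_zero L)

theorem eLpNorm_fourier_dilate {L : Rd d ≃L[ℝ] Rd d}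
    (hL : ∀ s t, inner ℝ (L s) t = inner ℝ s (L t)) (ψ : 𝓢(Rd d, ℂ)) (s : ℝ≥0∞) :
    eLpNorm (fun ξ => 𝓕 (dilate L ψ) ξ) s volume =
      absDet L ^ (recip s - 1) * eLpNorm (fun ξ => 𝓕 ψ ξ) s volume := by
  have h1 := eLpNorm_comp_equiv L (fun ξ => ‖𝓕 (dilate L ψ) ξ‖ₑ) s
  simp_rw [fourier_dilate_apply hL] at h1
  rw [eLpNorm_const_mul_ennreal (𝓕 ψ).continuous.measurable.enorm.aemeasurable, eLpNorm_enorm,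
    eLpNorm_enorm] at h1
  have h2 : eLpNorm (fun ξ => 𝓕 (dilate L ψ) ξ) s volume = absDet L ^ (recip s) *
      (absDet L ^ (-recip s) * eLpNorm (fun ξ => 𝓕 (dilate L ψ) ξ) s volume) := by
    rw [← mul_assoc, ← ENNReal.rpow_add _ _ (absDet_ne_zero L) (absDet_ne_top L), add_neg_cancel,
      ENNReal.rpow_zero, one_mul]
  rw [h2, ← h1, ← mul_assoc, sub_eq_add_neg,
    ENNReal.rpow_add _ _ (absDet_ne_zero L) (absDet_ne_top L), ENNReal.rpow_neg_one]

/-- Dilating the distribution amounts to dilating the window and the variables. -/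
theorem stft_precompose_dilate {L : Rd d ≃L[ℝ] Rd d}
    (hL : ∀ s t, inner ℝ (L s) t = inner ℝ s (L t)) (g : 𝓢(Rd d, ℂ)) (f : 𝓢'(Rd d, ℂ))
    (x ξ : Rd d) : stft g (precompose f (dilate L)) (L x) ξ = stft (dilate L g) f x (L ξ) := by
  rw [stft, precompose_apply, stft]
  congr 1
  ext t
  rw [dilate_apply, shiftedWindow_apply, shiftedWindow_apply, dilate_apply, map_sub L, character,
    character, hL]

/-- The norm of a dilated distribution is a norm with respect to the dilated window. -/
theorem amalgamNorm_precompose_dilate {L : Rd d ≃L[ℝ] Rd d}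
    (hL : ∀ s t, inner ℝ (L s) t = inner ℝ s (L t)) (g : 𝓢(Rd d, ℂ)) (f : 𝓢'(Rd d, ℂ))
    (p q : ℝ≥0∞) :
    amalgamNorm g p q (precompose f (dilate L)) =
      absDet L ^ (recip q - recip p) * amalgamNorm (dilate L g) p q f := by
  have h1 := eLpNorm_comp_equiv L (fun x => eLpNorm (fun ξ =>
    stft g (precompose f (dilate L)) x ξ) p volume) q
  have h0 : ∀ x, eLpNorm (fun ξ => stft g (precompose f (dilate L)) (L x) ξ) p volume =
      absDet L ^ (-recip p) * eLpNorm (fun ξ => stft (dilate L g) f x ξ) p volume := fun x => by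
    simp_rw [stft_precompose_dilate hL]
    exact eLpNorm_comp_equiv L (fun ξ => stft (dilate L g) f x ξ) p
  simp_rw [h0] at h1
  rw [eLpNorm_const_mul_ennreal (measurable_eLpNorm_stft _ _ _).aemeasurable] at h1
  have h2 : amalgamNorm g p q (precompose f (dilate L)) = absDet L ^ (recip q) *
      (absDet L ^ (-recip q) * amalgamNorm g p q (precompose f (dilate L))) := by
    rw [← mul_assoc, ← ENNReal.rpow_add _ _ (absDet_ne_zero L) (absDet_ne_top L), add_neg_cancel,
      ENNReal.rpow_zero, one_mul]
  rw [h2, amalgamNorm, ← h1, ← mul_assoc, sub_eq_add_neg,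
    ENNReal.rpow_add _ _ (absDet_ne_zero L) (absDet_ne_top L)]
  rfl

end Dilation

/-! ### Narrow windows -/

section DilatedWindow

open FourierTransform Filter
open scoped Topology

variable {d : ℕ}

theorem exists_cutoff (R : ℝ) :
    ∃ φ : 𝓢(Rd d, ℂ), HasCompactSupport φ ∧ ∀ t, ‖t‖ ≤ R → φ t = 1 := by
  let b : ContDiffBump (0 : Rd d) := ⟨|R| + 1, |R| + 2, by positivity, by linarith⟩
  have h1 : HasCompactSupport fun t : Rd d => ((b t : ℝ) : ℂ) :=
    b.hasCompactSupport.comp_left (g := fun x : ℝ => (x : ℂ)) Complex.ofReal_zero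
  have h2 : ContDiff ℝ ((⊤ : ℕ∞) : WithTop ℕ∞) fun t : Rd d => ((b t : ℝ) : ℂ) :=
    Complex.ofRealCLM.contDiff.comp b.contDiff
  refine ⟨h1.toSchwartzMap h2, h1, fun t ht => ?_⟩
  have h3 : b t = 1 := b.one_of_mem_closedBall (by
    rw [mem_closedBall_zero_iff]
    have := le_abs_self R
    change ‖t‖ ≤ |R| + 1
    linarith)
  change ((b t : ℝ) : ℂ) = 1
  rw [h3, Complex.ofReal_one]

theorem memLp_mul_of_norm_le (m : 𝓢(Rd d, ℂ)) {u : Rd d → ℂ} (hu : Continuous u) {C : ℝ} {n : ℕ}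
    (hC : ∀ t, ‖u t‖ ≤ C * (1 + ‖t‖) ^ n) (p : ℝ≥0∞) : MemLp (fun t => m t * u t) p := by
  have hG : (fun t : Rd d => (1 + ‖t‖ ^ 2) ^ n).HasTemperateGrowth := by fun_prop
  have h1 := ((smulLeftCLM ℂ (fun t : Rd d => (1 + ‖t‖ ^ 2) ^ n) m).memLp p volume).const_mul
    ((2 ^ n * C : ℝ) : ℂ)
  refine h1.mono (m.continuous.mul hu).aestronglyMeasurable (Eventually.of_forall fun t => ?_)
  have h2 : (0 : ℝ) ≤ C := by
    have := (norm_nonneg _).trans (hC 0)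
    simpa using this
  rw [smulLeftCLM_apply_apply hG, norm_mul, norm_mul, norm_smul, Complex.norm_real,
    Real.norm_of_nonneg (by positivity), Real.norm_of_nonneg (by positivity)]
  have h3 : 1 + ‖t‖ ≤ 2 * (1 + ‖t‖ ^ 2) := by nlinarith [sq_nonneg (‖t‖ - 1), norm_nonneg t]
  calc ‖m t‖ * ‖u t‖ ≤ ‖m t‖ * (C * (2 * (1 + ‖t‖ ^ 2)) ^ n) := by
        gcongr
        refine (hC t).trans ?_
        gcongr
    _ = _ := by rw [mul_pow]; ring

theorem eLpNorm_le_of_support_subset {u : Rd d → ℝ≥0∞} (hu : Measurable u) {S : Set (Rd d)}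
    (hS : Function.support u ⊆ S) {q r : ℝ≥0∞} (hqr : q ≤ r) :
    eLpNorm u q volume ≤ eLpNorm u r volume * volume S ^ (recip q - recip r) := by
  rw [← eLpNorm_restrict_eq_of_support_subset (p := q) hS,
    ← eLpNorm_restrict_eq_of_support_subset (p := r) hS]
  have h := eLpNorm_le_eLpNorm_mul_rpow_measure_univ (μ := volume.restrict S) hqr
    hu.aestronglyMeasurable
  simpa [recip, ENNReal.toReal_inv] using h

theorem exists_norm_le_of_hasCompactSupport {g : 𝓢(Rd d, ℂ)} (hgc : HasCompactSupport g) :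
    ∃ R : ℝ, ∀ t, g t ≠ 0 → ‖t‖ ≤ R := by
  obtain ⟨R, hR⟩ := hgc.isCompact.isBounded.subset_closedBall 0
  exact ⟨R, fun t ht => mem_closedBall_zero_iff.1 (hR (subset_tsupport _ ht))⟩

theorem continuous_stft_sub (g : 𝓢(Rd d, ℂ)) (f : 𝓢'(Rd d, ℂ)) (y : Rd d) :
    Continuous fun z : Rd d × Rd d => stft g f y (z.2 - z.1) :=
  Continuous.comp (g := fun z : Rd d × Rd d => stft g f z.1 z.2)
    (f := fun z : Rd d × Rd d => (y, z.2 - z.1)) (continuous_stft g f) (by fun_prop)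

theorem memLp_mul_stft (m g : 𝓢(Rd d, ℂ)) (f : 𝓢'(Rd d, ℂ)) (y ξ : Rd d) (p : ℝ≥0∞) :
    MemLp (fun η => m η * stft g f y (ξ - η)) p := by
  obtain ⟨M, C, hC, hMC⟩ := exists_norm_stft_le g f
  refine memLp_mul_of_norm_le m (u := fun η => stft g f y (ξ - η))
    (C := C * (1 + ‖y‖) ^ M * (1 + ‖ξ‖) ^ M) (n := M) ?_ (fun η => ?_) p
  · exact Continuous.comp (g := fun z : Rd d × Rd d => stft g f y (z.2 - z.1))
      (f := fun η => (η, ξ)) (continuous_stft_sub g f y) (by fun_prop)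
  · refine (hMC y (ξ - η)).trans ?_
    rw [mul_assoc _ ((1 + ‖ξ‖) ^ M), ← mul_pow]
    gcongr
    nlinarith [norm_sub_le ξ η, mul_nonneg (norm_nonneg ξ) (norm_nonneg η)]

/-- Effect on the amalgam norm of shrinking the window. The narrow window is cut out of translates
of a fixed one, whose position `y` matters only up to bounded distance; for fixed `y` the
short-time Fourier transform is a Fourier transform in `x`, to which the Hausdorff-Young inequality
applies. -/
theorem exists_amalgamNorm_dilate_le_of_expanding {g : 𝓢(Rd d, ℂ)} (hgc : HasCompactSupport g)
    (hg : g ≠ 0) {p q r s : ℝ≥0∞} (hs1 : 1 ≤ s) (hs2 : s ≤ 2) (hsr : s⁻¹ + r⁻¹ = 1)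
    (hsp : s ≤ p) (hpq : p ≤ q) (hqr : q ≤ r) :
    ∃ C : ℝ≥0∞, C ≠ ∞ ∧ ∀ L : Rd d ≃L[ℝ] Rd d, (∀ s t, inner ℝ (L s) t = inner ℝ s (L t)) →
      (∀ t, ‖t‖ ≤ ‖L t‖) → ∀ h : 𝓢'(Rd d, ℂ),
        amalgamNorm (dilate L g) p q h ≤
          C * absDet L ^ (recip s - 1) * amalgamNorm g p q h := by
  obtain ⟨R, hR⟩ := exists_norm_le_of_hasCompactSupport hgc
  -- `φ(· - y)` is `1` on the support of the narrow window at `x` whenever `‖x - y‖ ≤ 1`.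
  obtain ⟨φ, hφc, hφ⟩ := exists_cutoff (d := d) (R + 1)
  obtain ⟨C₁, hC₁⟩ := exists_eLpNorm_eLpNorm_fourier_le (d := d) hs1 hs2 hsr hsp (hpq.trans hqr)
  obtain ⟨C₂, hC₂⟩ := exists_amalgamNorm_le hg hφc
  have hp1 : 1 ≤ p := hs1.trans hsp
  have hq1 : 1 ≤ q := hp1.trans hpq
  have hq0 : q ≠ 0 := (zero_lt_one.trans_le hq1).ne'
  -- Localization of `x` to unit balls, on which the `L^q` norm is at most `κ` times the `L^r` norm.
  set w : Rd d → ℝ≥0∞ := (Metric.closedBall (0 : Rd d) 1).indicator 1 with hw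
  have hwm : Measurable w := measurable_one.indicator Metric.isClosed_closedBall.measurableSet
  set κ := volume (Metric.closedBall (0 : Rd d) 1) ^ (recip q - recip r) with hκ
  have hvol0 : volume (Metric.closedBall (0 : Rd d) 1) ≠ 0 :=
    (Metric.measure_closedBall_pos volume 0 one_pos).ne'
  have hvolt : volume (Metric.closedBall (0 : Rd d) 1) ≠ ∞ := measure_closedBall_lt_top.ne
  have hκt : κ ≠ ∞ := ENNReal.rpow_ne_top_of_ne_zero hvol0 hvolt
  have hw0 : eLpNorm w q volume ≠ 0 := by
    rw [Ne, eLpNorm_eq_zero_iff hwm.aestronglyMeasurable hq0]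
    intro h0
    rw [Filter.EventuallyEq, ae_iff] at h0
    refine hvol0 (measure_mono_null (fun t ht => ?_) h0)
    change ¬w t = 0
    rw [hw, Set.indicator_of_mem ht]
    exact one_ne_zero
  have hwt : eLpNorm w q volume ≠ ∞ := by
    refine ne_top_of_le_ne_top ?_
      (eLpNorm_indicator_const_le (s := Metric.closedBall (0 : Rd d) 1) (1 : ℝ≥0∞) q)
    exact ENNReal.mul_ne_top (by simp) (ENNReal.rpow_ne_top_of_nonneg (by positivity) hvolt)
  refine ⟨(eLpNorm w q volume)⁻¹ * (κ * C₁ * eLpNorm (fun ξ => 𝓕 g ξ) s volume * C₂), ?_,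
    fun L hL hLe h => ?_⟩
  · refine ENNReal.mul_ne_top (ENNReal.inv_ne_top.2 hw0) (ENNReal.mul_ne_top (ENNReal.mul_ne_top
      (ENNReal.mul_ne_top hκt ENNReal.coe_ne_top) ?_) ENNReal.coe_ne_top)
    exact ((𝓕 g).memLp s volume).2.ne
  set m : 𝓢(Rd d, ℂ) := 𝓕 (dilate L g) with hm
  set N : Rd d → ℝ≥0∞ := fun x => eLpNorm (fun ξ => stft (dilate L g) h x ξ) p volume with hN
  have hNm : Measurable N := measurable_eLpNorm_stft _ _ _
  have key : ∀ x y, ‖x - y‖ ≤ 1 → ∀ ξ, stft (dilate L g) h x ξ =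
      𝓕 (fun η => m η * stft φ h y (ξ - η)) x := fun x y hxy ξ => by
    have h1 := apply_mul_eq_integral_stft h (m := translate x (dilate L g)) (φ := φ)
      (Ψ := shiftedWindow (dilate L g) x ξ) (x := y) (ξ := ξ) fun t => by
        rw [shiftedWindow_apply, shiftedWindow_apply, compSubConstCLM_apply]
        by_cases h0 : dilate L g (t - x) = 0
        · rw [h0]; ring
        · have h3 : ‖t - x‖ ≤ R := (hLe _).trans (hR _ h0)
          rw [hφ]
          · ring
          · have : t - y = (t - x) + (x - y) := by abel
            rw [this]
            exact (norm_add_le _ _).trans (add_le_add h3 hxy)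
    rw [stft, h1, fourier_apply_eq_integral_character]
    refine integral_congr_ae (Eventually.of_forall fun η => ?_)
    simp only [fourier_translate_apply, character_comm x, hm]
    ring
  have hloc : ∀ y, eLpNorm (fun x => w (x - y) * N x) q volume ≤
      κ * C₁ * eLpNorm m s volume * eLpNorm (fun ξ => stft φ h y ξ) p volume := fun y => by
    have hsupp : Function.support (fun x => w (x - y) * N x) ⊆ Metric.closedBall y 1 := by
      intro x hx
      by_contra hxy
      refine hx ?_
      have : x - y ∉ Metric.closedBall (0 : Rd d) 1 := by
        rwa [mem_closedBall_zero_iff, ← dist_eq_norm]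
      simp [hw, Set.indicator_of_notMem this]
    have hmeas : Measurable fun x => w (x - y) * N x :=
      Measurable.mul (Measurable.comp (f := fun x : Rd d => x - y) hwm (by fun_prop)) hNm
    have h1 := eLpNorm_le_of_support_subset hmeas hsupp hqr
    rw [Measure.addHaar_closedBall_center, ← hκ] at h1
    refine h1.trans ?_
    have h2 : eLpNorm (fun x => w (x - y) * N x) r volume ≤ eLpNorm (fun x =>
        eLpNorm (fun ξ => 𝓕 (fun η => m η * stft φ h y (ξ - η)) x) p volume) r volume := by
      refine eLpNorm_mono_enorm fun x => ?_
      simp only [enorm_eq_self]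
      by_cases hxy : ‖x - y‖ ≤ 1
      · rw [hw, Set.indicator_of_mem (mem_closedBall_zero_iff.2 hxy), Pi.one_apply, one_mul, hN]
        simp only [key x y hxy, le_refl]
      · rw [hw, Set.indicator_of_notMem (fun h => hxy (mem_closedBall_zero_iff.1 h)), zero_mul]
        exact zero_le
    have h3 := hC₁ (fun η ξ => m η * stft φ h y (ξ - η)) (Continuous.mul
      (Continuous.comp (g := m) (f := fun z : Rd d × Rd d => z.1) m.continuous continuous_fst)
      (continuous_stft_sub φ h y))
      (fun ξ => memLp_one_iff_integrable.1 (memLp_mul_stft m φ h y ξ 1))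
      (fun ξ => memLp_mul_stft m φ h y ξ 2)
    have h4 : eLpNorm (fun η => eLpNorm (fun ξ => m η * stft φ h y (ξ - η)) p volume) s volume =
        eLpNorm m s volume * eLpNorm (fun ξ => stft φ h y ξ) p volume := by
      have h5 : ∀ η, eLpNorm (fun ξ => m η * stft φ h y (ξ - η)) p volume =
          eLpNorm (fun ξ => stft φ h y ξ) p volume * ‖m η‖ₑ := fun η => by
        rw [← eLpNorm_enorm]
        simp_rw [enorm_mul]
        have hsm : Measurable fun ξ => ‖stft φ h y ξ‖ₑ :=
          (continuous_stft_right φ h y).measurable.enorm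
        rw [eLpNorm_const_mul_ennreal (f := fun ξ => ‖stft φ h y (ξ - η)‖ₑ)
          (Measurable.comp (f := fun ξ : Rd d => ξ - η) hsm (by fun_prop)).aemeasurable,
          eLpNorm_comp_sub_const hsm, eLpNorm_enorm, mul_comm]
      simp_rw [h5]
      rw [eLpNorm_const_mul_ennreal m.continuous.measurable.enorm.aemeasurable, eLpNorm_enorm,
        mul_comm]
    calc _ ≤ (C₁ * (eLpNorm m s volume * eLpNorm (fun ξ => stft φ h y ξ) p volume)) * κ := by
          gcongr
          exact h2.trans (h3.trans_eq (by rw [h4]))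
      _ = _ := by ring
  have hglue : eLpNorm w q volume * amalgamNorm (dilate L g) p q h ≤
      κ * C₁ * eLpNorm m s volume * amalgamNorm φ p q h := by
    calc eLpNorm w q volume * amalgamNorm (dilate L g) p q h
        = eLpNorm (fun y => eLpNorm (fun x => w (x - y) * N x) q volume) q volume :=
          (eLpNorm_eLpNorm_mul_translate hwm hNm hq0).symm
      _ ≤ eLpNorm (fun y => κ * C₁ * eLpNorm m s volume *
            eLpNorm (fun ξ => stft φ h y ξ) p volume) q volume := by
          refine eLpNorm_mono_enorm fun y => ?_
          simpa only [enorm_eq_self] using hloc y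
      _ = _ := eLpNorm_const_mul_ennreal (measurable_eLpNorm_stft _ _ _).aemeasurable _ _
  have hmn : eLpNorm m s volume = absDet L ^ (recip s - 1) * eLpNorm (fun ξ => 𝓕 g ξ) s volume :=
    eLpNorm_fourier_dilate hL g s
  calc amalgamNorm (dilate L g) p q h
      = (eLpNorm w q volume)⁻¹ * (eLpNorm w q volume * amalgamNorm (dilate L g) p q h) := by
        rw [← mul_assoc, ENNReal.inv_mul_cancel hw0 hwt, one_mul]
    _ ≤ (eLpNorm w q volume)⁻¹ * (κ * C₁ * (absDet L ^ (recip s - 1) *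
          eLpNorm (fun ξ => 𝓕 g ξ) s volume) * (C₂ * amalgamNorm g p q h)) := by
        rw [← hmn]
        refine mul_le_mul' le_rfl (hglue.trans ?_)
        gcongr
        exact hC₂ hp1 hq1 h
    _ = _ := by ring

end DilatedWindow

/-! ### Wide windows -/

section WideWindow

open FourierTransform Filter
open scoped Topology

variable {d : ℕ}

/-- Multiplied by `g`, the function `ψ` becomes a function with integral `1`, with which
`apply_mul_integral_eq` resolves a distribution into localizations. -/
theorem exists_dual_window {g : 𝓢(Rd d, ℂ)} (hgc : HasCompactSupport g) (hg : g ≠ 0) :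
    ∃ ψ : 𝓢(Rd d, ℂ), (∀ t, g t = 0 → ψ t = 0) ∧ ∫ t, ψ t * g t = 1 := by
  have h1 : HasCompactSupport fun t : Rd d => (starRingEnd ℂ) (g t) :=
    hgc.comp_left (g := fun z => (starRingEnd ℂ) z) (map_zero _)
  have h2 : ContDiff ℝ ((⊤ : ℕ∞) : WithTop ℕ∞) fun t : Rd d => (starRingEnd ℂ) (g t) :=
    Complex.conjCLE.contDiff.comp g.smooth'
  set c : ℝ := ∫ t, Complex.normSq (g t) with hc
  have hc0 : c ≠ 0 := by
    obtain ⟨a, ha⟩ : ∃ a, g a ≠ 0 := by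
      by_contra! h
      exact hg (SchwartzMap.ext h)
    refine (Continuous.integral_pos_of_hasCompactSupport_nonneg_nonzero (μ := volume)
      (f := fun t => Complex.normSq (g t)) (x := a)
      (Complex.continuous_normSq.comp g.continuous) (hgc.comp_left (map_zero _))
      (fun t => Complex.normSq_nonneg _) ?_).ne'
    exact (Complex.normSq_pos.2 ha).ne'
  refine ⟨(c : ℂ)⁻¹ • h1.toSchwartzMap h2, fun t ht => ?_, ?_⟩
  · change (c : ℂ)⁻¹ • (starRingEnd ℂ) (g t) = 0
    rw [ht, map_zero, smul_zero]
  · have h3 : ∀ t, ((c : ℂ)⁻¹ • h1.toSchwartzMap h2) t * g t =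
        (c : ℂ)⁻¹ * ((Complex.normSq (g t) : ℝ) : ℂ) := fun t => by
      change (c : ℂ)⁻¹ • (starRingEnd ℂ) (g t) * g t = _
      rw [smul_eq_mul, mul_assoc, Complex.normSq_eq_conj_mul_self]
    simp_rw [h3]
    rw [integral_const_mul, integral_complex_ofReal, ← hc,
      inv_mul_cancel₀ (Complex.ofReal_ne_zero.2 hc0)]

/-- Bound for the Fourier transform `V` of a distribution `f` with compact support, where `V` is given
by the inversion formula with the dual window `ψ` from the short-time Fourier transform of `f`, which
vanishes for `y` outside a compact set `K`. The constant depends on neither `f` nor `K`. In the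
formula for `V` the integral over `y` is a Fourier transform, so the Hausdorff-Young inequality gains
over the sum of the norms of the localized pieces. -/
theorem exists_eLpNorm_apply_le {g ψ : 𝓢(Rd d, ℂ)} {p r r' : ℝ≥0∞} (hr1 : 1 ≤ r) (hr2 : r ≤ 2)
    (hrr : r⁻¹ + r'⁻¹ = 1) (hrp : r ≤ p) (hpr : p ≤ r') :
    ∃ C : ℝ≥0∞, C ≠ ∞ ∧ ∀ (f : 𝓢'(Rd d, ℂ)) (K : Set (Rd d)), IsCompact K →
      (∀ y, y ∉ K → ∀ ξ, stft g f y ξ = 0) → ∀ V : Rd d → ℂ,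
      (∀ ξ, V ξ = ∫ y, ∫ η, 𝓕 (translate y ψ) η * stft g f y (ξ - η)) →
      eLpNorm V p volume ≤
        C * eLpNorm (fun y => eLpNorm (fun ξ => stft g f y ξ) p volume) r volume := by
  obtain ⟨C₁, hC₁⟩ := exists_eLpNorm_eLpNorm_fourier_le (d := d) hr1 hr2 hrr hrp hpr
  refine ⟨eLpNorm (fun η => 𝓕 ψ η) r volume * C₁,
    ENNReal.mul_ne_top ((𝓕 ψ).memLp r volume).2.ne ENNReal.coe_ne_top,
    fun f K hK hf0 V hV => ?_⟩
  obtain ⟨M, C, hC, hMC⟩ := exists_norm_stft_le g f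
  have hp1 : 1 ≤ p := hr1.trans hrp
  have hbK : ∀ ξ y, ‖stft g f y ξ‖ ≤
      C * (1 + ‖ξ‖) ^ M * K.indicator (fun y => (1 + ‖y‖) ^ M) y := fun ξ y => by
    by_cases hy : y ∈ K
    · rw [Set.indicator_of_mem hy]
      exact (hMC y ξ).trans_eq (by ring)
    · rw [Set.indicator_of_notMem hy, mul_zero, hf0 y hy ξ, norm_zero]
  have hKi : Integrable (K.indicator fun y : Rd d => (1 + ‖y‖) ^ M) := by
    rw [integrable_indicator_iff hK.measurableSet]
    exact ContinuousOn.integrableOn_compact hK (by fun_prop)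
  have hcy : ∀ ξ, Continuous fun y => stft g f y ξ := fun ξ =>
    Continuous.comp (g := fun z : Rd d × Rd d => stft g f z.1 z.2) (f := fun y => (y, ξ))
      (continuous_stft g f) (by fun_prop)
  have hint : ∀ ξ, Integrable fun y => stft g f y ξ := fun ξ =>
    (hKi.const_mul (C * (1 + ‖ξ‖) ^ M)).mono' (hcy ξ).aestronglyMeasurable
      (Eventually.of_forall fun y => hbK ξ y)
  have hcs : ∀ ξ, HasCompactSupport fun y => stft g f y ξ := fun ξ =>
    HasCompactSupport.intro hK fun y hy => hf0 y hy ξ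
  have hL2 : ∀ ξ, MemLp (fun y => stft g f y ξ) 2 := fun ξ =>
    (hcy ξ).memLp_of_hasCompactSupport (hcs ξ)
  have hVeq : ∀ ξ, V ξ = ∫ η, 𝓕 ψ η * 𝓕 (fun y => stft g f y (ξ - η)) η := fun ξ => by
    have hi : Integrable (Function.uncurry fun y η : Rd d =>
        𝓕 (translate y ψ) η * stft g f y (ξ - η)) (volume.prod volume) := by
      have h1 := Integrable.mul_prod hKi
        ((integrable_one_add_norm_pow_mul (𝓕 ψ) M).const_mul (C * (1 + ‖ξ‖) ^ M))
      refine h1.mono' ?_ (Eventually.of_forall ?_)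
      · simp_rw [fourier_translate_apply]
        refine Continuous.aestronglyMeasurable (((Continuous.comp
          (g := fun z : Rd d × Rd d => character z.1 z.2)
          (f := fun z : Rd d × Rd d => (z.2, z.1)) continuous_character (by fun_prop)).mul
          (Continuous.comp (g := fun η => 𝓕 ψ η) (f := fun z : Rd d × Rd d => z.2)
            (𝓕 ψ).continuous (by fun_prop))).mul ?_)
        exact Continuous.comp (g := fun z : Rd d × Rd d => stft g f z.1 z.2)
          (f := fun z : Rd d × Rd d => (z.1, ξ - z.2)) (continuous_stft g f) (by fun_prop)
      · rintro ⟨y, η⟩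
        simp only [Function.uncurry, fourier_translate_apply, norm_mul, norm_character, one_mul]
        have h2 := hbK (ξ - η) y
        have h3 : (1 + ‖ξ - η‖) ^ M ≤ (1 + ‖ξ‖) ^ M * (1 + ‖η‖) ^ M := by
          rw [← mul_pow]
          gcongr
          nlinarith [norm_sub_le ξ η, mul_nonneg (norm_nonneg ξ) (norm_nonneg η)]
        have h4 : 0 ≤ K.indicator (fun y : Rd d => (1 + ‖y‖) ^ M) y :=
          Set.indicator_nonneg (fun y _ => by positivity) y
        calc ‖𝓕 ψ η‖ * ‖stft g f y (ξ - η)‖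
            ≤ ‖𝓕 ψ η‖ * (C * ((1 + ‖ξ‖) ^ M * (1 + ‖η‖) ^ M) *
                K.indicator (fun y => (1 + ‖y‖) ^ M) y) := by
              gcongr
              refine h2.trans ?_
              gcongr
          _ = _ := by ring
    rw [hV, integral_integral_swap hi]
    refine integral_congr_ae (Eventually.of_forall fun η => ?_)
    simp only [fourier_apply_eq_integral_character (fun y => stft g f y (ξ - η))]
    rw [← integral_const_mul]
    refine integral_congr_ae (Eventually.of_forall fun y => ?_)
    simp only [fourier_translate_apply]
    ring
  set G : Rd d → Rd d → ℝ≥0∞ := fun ξ η => ‖𝓕 (fun y => stft g f y ξ) η‖ₑ with hG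
  have hGm : Measurable (Function.uncurry G) :=
    measurable_enorm_fourier_left (v := fun y ξ => stft g f y ξ) (continuous_stft g f)
  have hGr : Measurable fun η => eLpNorm (fun ξ => G ξ η) p volume :=
    measurable_eLpNorm_right (F := fun η ξ => G ξ η) (Measurable.comp (g := Function.uncurry G)
      (f := fun z : Rd d × Rd d => (z.2, z.1)) hGm (by fun_prop)) p
  have hψm : Measurable fun η => ‖𝓕 ψ η‖ₑ := (𝓕 ψ).continuous.measurable.enorm
  have hm : Measurable (Function.uncurry fun η ξ : Rd d => ‖𝓕 ψ η‖ₑ * G (ξ - η) η) :=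
    Measurable.mul (Measurable.comp (f := fun z : Rd d × Rd d => z.1) hψm (by fun_prop))
      (Measurable.comp (g := Function.uncurry G) (f := fun z : Rd d × Rd d => (z.2 - z.1, z.1))
        hGm (by fun_prop))
  calc eLpNorm V p volume
      ≤ eLpNorm (fun ξ => ∫⁻ η, ‖𝓕 ψ η‖ₑ * G (ξ - η) η) p volume := by
        refine eLpNorm_mono_enorm fun ξ => ?_
        rw [hVeq, enorm_eq_self]
        refine (enorm_integral_le_lintegral_enorm _).trans_eq ?_
        simp_rw [enorm_mul, hG]
    _ ≤ ∫⁻ η, eLpNorm (fun ξ => ‖𝓕 ψ η‖ₑ * G (ξ - η) η) p volume :=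
        eLpNorm_lintegral_le hm hp1
    _ = ∫⁻ η, ‖𝓕 ψ η‖ₑ * eLpNorm (fun ξ => G ξ η) p volume := by
        refine lintegral_congr fun η => ?_
        have hGη : Measurable fun ξ => G ξ η :=
          Measurable.comp (g := Function.uncurry G) (f := fun ξ => (ξ, η)) hGm (by fun_prop)
        rw [eLpNorm_const_mul_ennreal (f := fun ξ => G (ξ - η) η)
          (Measurable.comp (f := fun ξ : Rd d => ξ - η) hGη (by fun_prop)).aemeasurable,
          eLpNorm_comp_sub_const hGη]
    _ ≤ eLpNorm (fun η => ‖𝓕 ψ η‖ₑ) r volume *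
          eLpNorm (fun η => eLpNorm (fun ξ => G ξ η) p volume) r' volume :=
        lintegral_mul_le_eLpNorm_mul_eLpNorm hrr hψm.aemeasurable hGr.aemeasurable
    _ ≤ eLpNorm (fun η => 𝓕 ψ η) r volume *
          (C₁ * eLpNorm (fun y => eLpNorm (fun ξ => stft g f y ξ) p volume) r volume) := by
        rw [eLpNorm_enorm]
        refine mul_le_mul' le_rfl ?_
        simp_rw [hG, eLpNorm_enorm]
        exact hC₁ (fun y ξ => stft g f y ξ) (continuous_stft g f) hint hL2
    _ = _ := by rw [mul_assoc]

/-- Effect on the amalgam norm of widening the window: the wide window is resolved into translates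
of a fixed one, and the pieces are summed by means of the Hausdorff-Young inequality. -/
theorem exists_amalgamNorm_dilate_le_of_contracting {g : 𝓢(Rd d, ℂ)} (hgc : HasCompactSupport g)
    (hg : g ≠ 0) {p q r r' : ℝ≥0∞} (hr1 : 1 ≤ r) (hr2 : r ≤ 2) (hrr : r⁻¹ + r'⁻¹ = 1)
    (hrp : r ≤ p) (hpr : p ≤ r') (hpq : p ≤ q) :
    ∃ C : ℝ≥0∞, C ≠ ∞ ∧ ∀ L : Rd d ≃L[ℝ] Rd d, (∀ s t, inner ℝ (L s) t = inner ℝ s (L t)) →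
      (∀ t, ‖L t‖ ≤ ‖t‖) → ∀ h : 𝓢'(Rd d, ℂ),
        amalgamNorm (dilate L g) p q h ≤
          C * absDet L ^ (-recip r) * amalgamNorm g p q h := by
  obtain ⟨R, hR⟩ := exists_norm_le_of_hasCompactSupport hgc
  obtain ⟨ψ, hψ0, hψ1⟩ := exists_dual_window hgc hg
  obtain ⟨C, hCt, hC⟩ := exists_eLpNorm_apply_le (g := g) (ψ := ψ) hr1 hr2 hrr hrp hpr
  have hp1 : 1 ≤ p := hr1.trans hrp
  have hq1 : 1 ≤ q := hp1.trans hpq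
  have hq0 : q ≠ 0 := (zero_lt_one.trans_le hq1).ne'
  -- The windows at `x` (wide) and at `y` meet only if `L (y - x)` lies in the ball of radius `2R`; the
  -- maximum with `1` only ensures that the ball has positive volume.
  set B := Metric.closedBall (0 : Rd d) (max 1 (2 * R)) with hB
  have hB0 : volume B ≠ 0 := (Metric.measure_closedBall_pos volume 0 (by positivity)).ne'
  have hBt : volume B ≠ ∞ := measure_closedBall_lt_top.ne
  have hBm : MeasurableSet B := Metric.isClosed_closedBall.measurableSet
  set w : Rd d → ℝ≥0∞ := B.indicator 1 with hw
  have hwm : Measurable w := measurable_one.indicator hBm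
  have hwt : eLpNorm w q volume ≠ ∞ := by
    refine ne_top_of_le_ne_top ?_ (eLpNorm_indicator_const_le (s := B) (1 : ℝ≥0∞) q)
    exact ENNReal.mul_ne_top (by simp) (ENNReal.rpow_ne_top_of_nonneg (by positivity) hBt)
  set c := ∫⁻ η, ‖𝓕 g η‖ₑ with hc
  refine ⟨C * c * volume B ^ (recip r - recip q) * eLpNorm w q volume,
    ENNReal.mul_ne_top (ENNReal.mul_ne_top (ENNReal.mul_ne_top hCt
      (lintegral_enorm_fourier_ne_top g)) (ENNReal.rpow_ne_top_of_ne_zero hB0 hBt)) hwt,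
    fun L hL hLe h => ?_⟩
  set N : Rd d → ℝ≥0∞ := fun y => eLpNorm (fun ξ => stft g h y ξ) p volume with hN
  have hNm : Measurable N := measurable_eLpNorm_stft _ _ _
  have hwL : Measurable fun y => w (L y) :=
    Measurable.comp (f := fun y => L y) hwm L.continuous.measurable
  set ω := absDet L with hω
  have hvolK : ∀ x, volume {y | L (y - x) ∈ B} = ω⁻¹ * volume B := fun x => by
    have h1 : {y | L (y - x) ∈ B} = (fun y => y - x) ⁻¹' (L ⁻¹' B) := rfl
    rw [h1, (measurePreserving_sub_right volume x).measure_preimage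
      (L.continuous.measurable hBm).nullMeasurableSet]
    have h2 := congrArg (fun μ : Measure (Rd d) => μ B) (map_volume_equiv L)
    rw [Measure.map_apply L.continuous.measurable hBm] at h2
    exact h2
  have hmn : ∫⁻ η, ‖𝓕 (dilate L g) η‖ₑ = c := by
    have h1 := eLpNorm_fourier_dilate hL g 1
    simpa [eLpNorm_one_eq_lintegral_enorm, recip, hc] using h1
  have hpt : ∀ x, eLpNorm (fun ξ => stft (dilate L g) h x ξ) p volume ≤
      C * c * (ω⁻¹ * volume B) ^ (recip r - recip q) *
        eLpNorm (fun y => w (L (y - x)) * N y) q volume := fun x => by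
    set m : 𝓢(Rd d, ℂ) := translate x (dilate L g) with hm
    have hmt : ∀ t, m t = g (L (t - x)) := fun t => rfl
    have hmul : ∀ (φ : 𝓢(Rd d, ℂ)) t, smulLeftCLM ℂ m φ t = m t * φ t := fun φ t => by
      rw [smulLeftCLM_apply_apply m.hasTemperateGrowth, smul_eq_mul]
    -- `h` times the wide window at `x`, a distribution with compact support.
    set f : 𝓢'(Rd d, ℂ) := precompose h (smulLeftCLM ℂ m) with hf
    set K : Set (Rd d) := {y | L (y - x) ∈ B} with hK
    have hKc : IsCompact K := by
      have : K = (L.toHomeomorph.trans (Homeomorph.subRight (L x))) ⁻¹' B := by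
        ext y
        simp [hK, map_sub]
      rw [this, Homeomorph.isCompact_preimage]
      exact isCompact_closedBall 0 _
    have hf0 : ∀ y, y ∉ K → ∀ ξ, stft g f y ξ = 0 := fun y hy ξ => by
      have h1 : smulLeftCLM ℂ m (shiftedWindow g y ξ) = 0 := by
        ext t
        rw [hmul, shiftedWindow_apply, hmt]
        change _ = (0 : ℂ)
        by_contra h0
        have h2 : g (L (t - x)) ≠ 0 := fun h => h0 (by rw [h, zero_mul])
        have h3 : g (t - y) ≠ 0 := fun h => h0 (by rw [h, mul_zero, mul_zero])
        refine hy ?_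
        rw [hK, Set.mem_ofPred_eq, hB, mem_closedBall_zero_iff]
        have h4 : L (y - x) = L (t - x) - L (t - y) := by
          rw [← map_sub]
          congr 1
          abel
        rw [h4]
        refine (norm_sub_le _ _).trans (le_max_of_le_right ?_)
        linarith [hR _ h2, (hLe (t - y)).trans (hR _ h3)]
      rw [stft, hf, precompose_apply, h1, map_zero]
    have hV : ∀ ξ, stft (dilate L g) h x ξ =
        ∫ y, ∫ η, 𝓕 (translate y ψ) η * stft g f y (ξ - η) := fun ξ => by
      have h1 := apply_mul_integral_eq h (smulLeftCLM ℂ ψ g) (shiftedWindow (dilate L g) x ξ)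
      have h2 : ∫ t, smulLeftCLM ℂ ψ g t = 1 := by
        simp_rw [smulLeftCLM_apply_apply ψ.hasTemperateGrowth, smul_eq_mul]
        exact hψ1
      rw [h2, mul_one] at h1
      rw [stft, h1]
      refine integral_congr_ae (Eventually.of_forall fun y => ?_)
      have h3 := apply_mul_eq_integral_stft f (m := translate y ψ) (φ := g)
        (Ψ := smulLeftCLM ℂ (translate y ψ) (shiftedWindow g y ξ)) (x := y) (ξ := ξ) fun t => by
          rw [smulLeftCLM_apply_apply (translate y ψ).hasTemperateGrowth, smul_eq_mul]
      simp only
      rw [← h3, hf, precompose_apply]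
      congr 1
      ext t
      rw [hmul, smulLeftCLM_apply_apply (translate y ψ).hasTemperateGrowth,
        smulLeftCLM_apply_apply (shiftedWindow (dilate L g) x ξ).hasTemperateGrowth,
        shiftedWindow_apply, shiftedWindow_apply, compSubConstCLM_apply,
        smulLeftCLM_apply_apply ψ.hasTemperateGrowth]
      simp only [smul_eq_mul, hmt, dilate_apply, compSubConstCLM_apply]
      ring
    refine (hC f K hKc hf0 _ hV).trans ?_
    have h1 : ∀ y, eLpNorm (fun ξ => stft g f y ξ) p volume ≤ c * (w (L (y - x)) * N y) := by
      intro y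
      by_cases hy : y ∈ K
      · have h2 := eLpNorm_apply_le_of_mul h m g y
          (Ψ := fun ξ => smulLeftCLM ℂ m (shiftedWindow g y ξ)) (fun ξ t => hmul _ t) hp1
        simp_rw [hm, enorm_fourier_translate, hmn] at h2
        rw [hw, Set.indicator_of_mem (show L (y - x) ∈ B from hy), Pi.one_apply, one_mul]
        exact h2
      · simp_rw [hf0 y hy]
        simp
    have hmeas : Measurable fun y => w (L (y - x)) * N y :=
      Measurable.mul (Measurable.comp (f := fun y : Rd d => y - x) hwL (by fun_prop)) hNm
    have h2 : eLpNorm (fun y => eLpNorm (fun ξ => stft g f y ξ) p volume) r volume ≤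
        c * eLpNorm (fun y => w (L (y - x)) * N y) r volume := by
      rw [← eLpNorm_const_mul_ennreal hmeas.aemeasurable]
      exact eLpNorm_mono_enorm fun y => by simpa only [enorm_eq_self] using h1 y
    have h3 := eLpNorm_le_of_support_subset hmeas (S := K) (fun y hy => by
      by_contra h0
      refine hy ?_
      simp only [hw, Set.indicator_of_notMem (show L (y - x) ∉ B from h0), zero_mul]) (hrp.trans hpq)
    rw [hK, hvolK] at h3
    calc _ ≤ C * (c * (eLpNorm (fun y => w (L (y - x)) * N y) q volume *
          (ω⁻¹ * volume B) ^ (recip r - recip q))) := by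
          refine mul_le_mul' le_rfl (h2.trans (mul_le_mul' le_rfl h3))
      _ = _ := by ring
  have hglue := eLpNorm_eLpNorm_mul_translate hwL hNm hq0
  have hwq : eLpNorm (fun y => w (L y)) q volume = ω ^ (-recip q) * eLpNorm w q volume :=
    eLpNorm_comp_equiv L w q
  have hmeas : Measurable fun x => eLpNorm (fun y => w (L (y - x)) * N y) q volume := by
    refine measurable_eLpNorm_right (F := fun x y => w (L (y - x)) * N y) ?_ q
    exact Measurable.mul
      (Measurable.comp (f := fun z : Rd d × Rd d => z.2 - z.1) hwL (by fun_prop))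
      (Measurable.comp (f := fun z : Rd d × Rd d => z.2) hNm (by fun_prop))
  have hpow : (ω⁻¹ * volume B) ^ (recip r - recip q) * ω ^ (-recip q) =
      ω ^ (-recip r) * volume B ^ (recip r - recip q) := by
    rw [ENNReal.mul_rpow_of_ne_top (ENNReal.inv_ne_top.2 (absDet_ne_zero L)) hBt, ENNReal.inv_rpow,
      ← ENNReal.rpow_neg, mul_right_comm,
      ← ENNReal.rpow_add _ _ (absDet_ne_zero L) (absDet_ne_top L)]
    congr 2
    ring
  calc amalgamNorm (dilate L g) p q h
      ≤ eLpNorm (fun x => C * c * (ω⁻¹ * volume B) ^ (recip r - recip q) *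
          eLpNorm (fun y => w (L (y - x)) * N y) q volume) q volume := by
        refine eLpNorm_mono_enorm fun x => ?_
        simpa only [enorm_eq_self] using hpt x
    _ = C * c * (ω⁻¹ * volume B) ^ (recip r - recip q) *
          (ω ^ (-recip q) * eLpNorm w q volume * amalgamNorm g p q h) := by
        rw [eLpNorm_const_mul_ennreal hmeas.aemeasurable, hglue, hwq]
        rfl
    _ = C * c * ((ω⁻¹ * volume B) ^ (recip r - recip q) * ω ^ (-recip q)) *
          eLpNorm w q volume * amalgamNorm g p q h := by ring
    _ = _ := by rw [hpow]; ring

end WideWindow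

/-! ### Multiplication by chirps -/

section Gaussian

open FourierTransform Filter
open scoped Topology

variable {d : ℕ}

/-- The Gaussian decays faster than every power. -/
theorem one_add_pow_mul_exp_le (n : ℕ) {x : ℝ} (hx : 0 ≤ x) :
    (1 + x) ^ n * Real.exp (-(Real.pi * x ^ 2)) ≤ n.factorial * Real.exp 2 := by
  have h1 : -(Real.pi * x ^ 2) ≤ 2 - (1 + x) := by
    nlinarith [Real.pi_gt_three, sq_nonneg (x - 1), sq_nonneg x]
  have h2 := Real.pow_div_factorial_le_exp (1 + x) (by positivity) n
  rw [div_le_iff₀ (by positivity)] at h2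
  calc (1 + x) ^ n * Real.exp (-(Real.pi * x ^ 2))
      ≤ (Real.exp (1 + x) * n.factorial) * Real.exp (2 - (1 + x)) := by
        gcongr
    _ = n.factorial * (Real.exp (1 + x) * Real.exp (2 - (1 + x))) := by ring
    _ = _ := by rw [← Real.exp_add]; congr 2; ring

theorem contDiff_gaussian :
    ContDiff ℝ ((⊤ : ℕ∞) : WithTop ℕ∞) fun t : Rd d => Complex.exp ((-(Real.pi * ‖t‖ ^ 2) : ℝ)) :=
  (Complex.ofRealCLM.contDiff.comp ((contDiff_const.mul (contDiff_norm_sq ℝ)).neg)).cexp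

/-- The Gaussian `t ↦ e^{-π|t|²}` as a Schwartz function. -/
noncomputable def gaussian (d : ℕ) : 𝓢(Rd d, ℂ) where
  toFun t := Complex.exp ((-(Real.pi * ‖t‖ ^ 2) : ℝ))
  smooth' := contDiff_gaussian
  decay' k n := by
    have hq : (fun t : Rd d => -(Real.pi * ‖t‖ ^ 2)).HasTemperateGrowth := by fun_prop
    obtain ⟨l, C, hC, hgrowth⟩ := hq.norm_iteratedFDeriv_le_uniform n
    have hexp : ContDiff ℝ ((⊤ : ℕ∞) : WithTop ℕ∞) fun s : ℝ => Complex.exp (s : ℂ) :=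
      Complex.ofRealCLM.contDiff.cexp
    have hder : ∀ (i : ℕ) (s : ℝ), ‖iteratedFDeriv ℝ i (fun s : ℝ => Complex.exp (s : ℂ)) s‖ =
        Real.exp s := fun i s => by
      have hd : ∀ n : ℕ, iteratedDeriv n (fun t : ℝ => Complex.exp (t : ℂ)) =
          fun t : ℝ => Complex.exp (t : ℂ) := by
        intro n
        induction n with
        | zero => simp
        | succ n ih =>
          rw [iteratedDeriv_succ, ih]
          funext t
          have h : HasDerivAt (fun t : ℝ => (t : ℂ)) 1 t := Complex.ofRealCLM.hasDerivAt (x := t)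
          rw [h.cexp.deriv, mul_one]
      rw [norm_iteratedFDeriv_eq_norm_iteratedDeriv, hd, Complex.norm_exp, Complex.ofReal_re]
    refine ⟨(n.factorial * (C + 1) ^ n) * ((k + l * n).factorial * Real.exp 2), fun t => ?_⟩
    have h1 := norm_iteratedFDeriv_comp_le (n := n) hexp hq.1 (mod_cast le_top) t
      (C := Real.exp (-(Real.pi * ‖t‖ ^ 2))) (D := (C + 1) * (1 + ‖t‖) ^ l)
      (fun i _ => (hder i _).le) (fun i hi₁ hi₂ => by
        refine (hgrowth i hi₂ t).trans ?_
        rw [mul_pow]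
        have hi₁' := (lt_of_lt_of_le zero_lt_one hi₁).ne'
        gcongr
        · exact le_trans (by simp) (le_self_pow₀ (by simp [hC]) hi₁')
        · refine le_self_pow₀ (one_le_pow₀ ?_) hi₁'
          simp only [le_add_iff_nonneg_right, norm_nonneg])
    calc _ ≤ (1 + ‖t‖) ^ k * (n.factorial * Real.exp (-(Real.pi * ‖t‖ ^ 2)) *
          ((C + 1) * (1 + ‖t‖) ^ l) ^ n) := by
          refine mul_le_mul ?_ h1 (norm_nonneg _) (by positivity)
          gcongr
          linarith
      _ = (n.factorial * (C + 1) ^ n) *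
          ((1 + ‖t‖) ^ (k + l * n) * Real.exp (-(Real.pi * ‖t‖ ^ 2))) := by
          rw [mul_pow, pow_add, pow_mul]; ring
      _ ≤ _ := by
          refine mul_le_mul_of_nonneg_left ?_ (by positivity)
          exact one_add_pow_mul_exp_le _ (norm_nonneg t)

theorem gaussian_apply (t : Rd d) :
    gaussian d t = Complex.exp ((-(Real.pi * ‖t‖ ^ 2) : ℝ)) := rfl

theorem gaussian_ne_zero (t : Rd d) : gaussian d t ≠ 0 := Complex.exp_ne_zero _

/-- The chirp `t ↦ e^{πi t·Pt}`. -/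
noncomputable def chirp (P : Matrix (Fin d) (Fin d) ℝ) (t : Rd d) : ℂ :=
  Complex.exp (((Real.pi * inner ℝ t (P.toEuclideanLin t) : ℝ) : ℂ) * Complex.I)

theorem chirp_hasTemperateGrowth (P : Matrix (Fin d) (Fin d) ℝ) :
    (chirp P).HasTemperateGrowth := by
  have h : (fun t : Rd d => Real.pi * inner ℝ t
      (LinearMap.toContinuousLinearMap (P.toEuclideanLin) t)).HasTemperateGrowth := by
    have h1 := (innerSL ℝ (E := Rd d)).bilinear_hasTemperateGrowth (f := fun t : Rd d => t)
      (g := fun t => LinearMap.toContinuousLinearMap (P.toEuclideanLin) t)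
      (by fun_prop) (by fun_prop)
    exact (Function.HasTemperateGrowth.const Real.pi).mul h1
  exact expI_hasTemperateGrowth.comp h

theorem norm_chirp (P : Matrix (Fin d) (Fin d) ℝ) (t : Rd d) : ‖chirp P t‖ = 1 := by
  rw [chirp, Complex.norm_exp_ofReal_mul_I]

/-- Multiplication of Schwartz functions by a chirp. -/
noncomputable def chirpMul (P : Matrix (Fin d) (Fin d) ℝ) : 𝓢(Rd d, ℂ) →L[ℂ] 𝓢(Rd d, ℂ) :=
  smulLeftCLM ℂ (chirp P)

theorem chirpMul_apply (P : Matrix (Fin d) (Fin d) ℝ) (ψ : 𝓢(Rd d, ℂ)) (t : Rd d) :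
    chirpMul P ψ t = chirp P t * ψ t := by
  rw [chirpMul, smulLeftCLM_apply_apply (chirp_hasTemperateGrowth P), smul_eq_mul]

theorem integral_comp_repr {E : Type*} [NormedAddCommGroup E] [NormedSpace ℝ E]
    (b : OrthonormalBasis (Fin d) ℝ (Rd d)) (F : (Fin d → ℝ) → E) :
    ∫ t, F (fun i => b.repr t i) = ∫ v, F v := by
  have h1 := b.repr.measurePreserving.integral_comp b.repr.toHomeomorph.measurableEmbedding
    (fun τ : Rd d => F (fun i => τ i))
  rw [h1, ← (PiLp.volume_preserving_toLp (Fin d)).integral_comp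
    (MeasurableEquiv.toLp 2 _).measurableEmbedding]

theorem inner_eq_sum_repr (b : OrthonormalBasis (Fin d) ℝ (Rd d)) (s t : Rd d) :
    inner ℝ s t = ∑ i, b.repr s i * b.repr t i := by
  rw [← b.repr.inner_map_map, PiLp.inner_apply]
  simp [mul_comm]

theorem repr_toEuclideanLin {P : Matrix (Fin d) (Fin d) ℝ} (hP : P.IsHermitian) (t : Rd d)
    (i : Fin d) : hP.eigenvectorBasis.repr (P.toEuclideanLin t) i =
      hP.eigenvalues i * hP.eigenvectorBasis.repr t i := by
  have hs := (Matrix.isSymmetric_toEuclideanLin_iff.2 hP) (hP.eigenvectorBasis i) t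
  have he : P.toEuclideanLin (hP.eigenvectorBasis i) =
      hP.eigenvalues i • hP.eigenvectorBasis i := by
    ext j
    have := congrFun (hP.mulVec_eigenvectorBasis i) j
    simpa [Matrix.toLpLin_apply] using this
  rw [OrthonormalBasis.repr_apply_apply, OrthonormalBasis.repr_apply_apply, ← hs, he,
    real_inner_smul_left]

theorem inner_toEuclideanLin_eq_sum {P : Matrix (Fin d) (Fin d) ℝ} (hP : P.IsHermitian)
    (t : Rd d) : inner ℝ t (P.toEuclideanLin t) =
      ∑ i, hP.eigenvalues i * hP.eigenvectorBasis.repr t i ^ 2 := by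
  rw [inner_eq_sum_repr hP.eigenvectorBasis]
  refine Finset.sum_congr rfl fun i _ => ?_
  rw [repr_toEuclideanLin]
  ring

/-- The one-dimensional factor of the Fourier transform of a chirp times a translated Gaussian: the
real part of the exponent is, after completion of the square, a Gaussian in `ξ` centred at `lx`. -/
theorem norm_fourier_chirp_gaussian_factor (l x ξ : ℝ) :
    ‖(Real.pi / (Real.pi * (1 - l * Complex.I)) : ℂ) ^ (1 / 2 : ℂ) *
      Complex.exp ((2 * Real.pi * (x - ξ * Complex.I)) ^ 2 /
        (4 * (Real.pi * (1 - l * Complex.I))))‖ * Real.exp (-(Real.pi * x ^ 2)) =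
    (1 + l ^ 2) ^ (-(1 / 4) : ℝ) * Real.exp (-(Real.pi / (1 + l ^ 2)) * (ξ - l * x) ^ 2) := by
  have hπ : (Real.pi : ℂ) ≠ 0 := Complex.ofReal_ne_zero.2 Real.pi_ne_zero
  have hl : (1 - l * Complex.I : ℂ) ≠ 0 := fun h => by
    have := congrArg Complex.re h
    simp at this
  have hl' : (1 + (l : ℂ) ^ 2) ≠ 0 := by
    have : (1 + l ^ 2 : ℝ) ≠ 0 := by positivity
    exact_mod_cast this
  have hnorm : ‖(1 - l * Complex.I : ℂ)‖ = (1 + l ^ 2) ^ (1 / 2 : ℝ) := by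
    rw [← Real.sqrt_eq_rpow, Complex.norm_def, Complex.normSq_apply]
    congr 1
    simp
    ring
  have h1 : (Real.pi / (Real.pi * (1 - l * Complex.I)) : ℂ) = (1 - l * Complex.I)⁻¹ := by
    field_simp
  have h2 : (2 * Real.pi * (x - ξ * Complex.I)) ^ 2 / (4 * (Real.pi * (1 - l * Complex.I))) =
      ((Real.pi / (1 + l ^ 2) * (x ^ 2 - ξ ^ 2 + 2 * x * ξ * l) : ℝ) : ℂ) +
      ((Real.pi / (1 + l ^ 2) * ((x ^ 2 - ξ ^ 2) * l - 2 * x * ξ) : ℝ) : ℂ) * Complex.I := by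
    have h3 : (1 + (l : ℂ) ^ 2) = (1 - l * Complex.I) * (1 + l * Complex.I) := by
      ring_nf
      rw [Complex.I_sq]
      ring
    push_cast
    rw [div_eq_iff (by simp [hπ, hl])]
    field_simp
    rw [h3]
    ring_nf
    simp only [Complex.I_sq, Complex.I_pow_three, Complex.I_pow_four]
    ring_nf
  have hc : (1 / 2 : ℂ) = ((1 / 2 : ℝ) : ℂ) := by push_cast; ring
  rw [norm_mul, h1, hc, Complex.norm_cpow_real, norm_inv, hnorm, h2, Complex.norm_exp,
    ← Real.rpow_neg (by positivity), ← Real.rpow_mul (by positivity), mul_assoc]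
  congr 1
  · norm_num
  · rw [← Real.exp_add]
    congr 1
    simp only [Complex.add_re, Complex.ofReal_re, Complex.mul_re, Complex.I_re, mul_zero,
      Complex.ofReal_im, Complex.I_im, mul_one, sub_self, add_zero]
    have : (1 + l ^ 2 : ℝ) ≠ 0 := by positivity
    field_simp
    ring

/-- In an eigenbasis of `P`, the Fourier transform of the chirp times a translate of the Gaussian is
a product of one-dimensional Gaussian integrals. -/
theorem norm_fourier_chirp_gaussian {P : Matrix (Fin d) (Fin d) ℝ} (hP : P.IsHermitian)
    (x ξ : Rd d) : ‖𝓕 (chirpMul P (translate x (gaussian d))) ξ‖ =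
      ∏ i, (1 + hP.eigenvalues i ^ 2) ^ (-(1 / 4) : ℝ) *
        Real.exp (-(Real.pi / (1 + hP.eigenvalues i ^ 2)) *
          (hP.eigenvectorBasis.repr ξ i - hP.eigenvalues i * hP.eigenvectorBasis.repr x i) ^ 2) := by
  set b := hP.eigenvectorBasis with hb
  set l := hP.eigenvalues with hl
  have h1 : ∀ t, character ξ t * chirpMul P (translate x (gaussian d)) t =
      Complex.exp ((-(Real.pi * ∑ i, b.repr x i ^ 2) : ℝ)) *
        Complex.exp (-∑ i, (Real.pi * (1 - l i * Complex.I)) * ((b.repr t i : ℝ) : ℂ) ^ 2 +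
          ∑ i, (2 * Real.pi * (b.repr x i - b.repr ξ i * Complex.I)) * ((b.repr t i : ℝ) : ℂ)) :=
    fun t => by
      rw [chirpMul_apply, compSubConstCLM_apply, gaussian_apply, chirp, character,
        inner_toEuclideanLin_eq_sum hP, inner_eq_sum_repr b ξ t, ← real_inner_self_eq_norm_sq,
        inner_eq_sum_repr b (t - x), ← Complex.exp_add, ← Complex.exp_add, ← Complex.exp_add]
      congr 1
      simp only [map_sub, PiLp.sub_apply]
      push_cast
      simp only [Finset.mul_sum, Finset.sum_mul, ← Finset.sum_neg_distrib, ← Finset.sum_add_distrib]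
      refine Finset.sum_congr rfl fun i _ => ?_
      ring
  have h2 := GaussianFourier.integral_cexp_neg_sum_mul_add
    (b := fun i => Real.pi * (1 - l i * Complex.I))
    (fun i => by simp [Real.pi_pos]) (fun i => 2 * Real.pi * (b.repr x i - b.repr ξ i * Complex.I))
  have h3 := integral_comp_repr b (fun v : Fin d → ℝ =>
    Complex.exp (-∑ i, (Real.pi * (1 - l i * Complex.I)) * ((v i : ℝ) : ℂ) ^ 2 +
          ∑ i, (2 * Real.pi * (b.repr x i - b.repr ξ i * Complex.I)) * ((v i : ℝ) : ℂ)))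
  rw [SchwartzMap.fourier_coe, fourier_apply_eq_integral_character]
  simp_rw [h1]
  rw [integral_const_mul, h3, h2, norm_mul, norm_prod, mul_comm, Complex.norm_exp,
    Complex.ofReal_re, Finset.mul_sum, ← Finset.sum_neg_distrib, Real.exp_sum,
    ← Finset.prod_mul_distrib]
  exact Finset.prod_congr rfl fun i _ => norm_fourier_chirp_gaussian_factor _ _ _

/-- The constant `∏ⱼ (1 + λⱼ²)^{1/4} = |det(1 + iP)|^{1/2}` of a symmetric matrix `P` with
eigenvalues `λⱼ`. -/
noncomputable def chirpConst {P : Matrix (Fin d) (Fin d) ℝ} (hP : P.IsHermitian) : ℝ :=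
  ∏ i, (1 + hP.eigenvalues i ^ 2) ^ (1 / 4 : ℝ)

theorem lintegral_fourier_chirp_gaussian {P : Matrix (Fin d) (Fin d) ℝ} (hP : P.IsHermitian)
    (x : Rd d) : ∫⁻ ξ, ‖𝓕 (chirpMul P (translate x (gaussian d))) ξ‖ₑ =
      ENNReal.ofReal (chirpConst hP) := by
  set b := hP.eigenvectorBasis with hb
  set l := hP.eigenvalues with hl
  have hi := (𝓕 (chirpMul P (translate x (gaussian d)))).integrable (μ := volume)
  rw [← ofReal_integral_norm_eq_lintegral_enorm hi]
  congr 1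
  simp_rw [norm_fourier_chirp_gaussian hP]
  rw [integral_comp_repr b (fun v : Fin d → ℝ => ∏ i, (1 + l i ^ 2) ^ (-(1 / 4) : ℝ) *
        Real.exp (-(Real.pi / (1 + l i ^ 2)) * (v i - l i * b.repr x i) ^ 2)),
    integral_fintype_prod_volume_eq_prod (fun i s => (1 + l i ^ 2) ^ (-(1 / 4) : ℝ) *
        Real.exp (-(Real.pi / (1 + l i ^ 2)) * (s - l i * b.repr x i) ^ 2)), chirpConst]
  refine Finset.prod_congr rfl fun i _ => ?_
  rw [integral_const_mul, integral_sub_right_eq_self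
    (fun s => Real.exp (-(Real.pi / (1 + l i ^ 2)) * s ^ 2)), integral_gaussian]
  have h0 : (0 : ℝ) < 1 + l i ^ 2 := by positivity
  have h1 : Real.pi / (Real.pi / (1 + l i ^ 2)) = 1 + l i ^ 2 := by
    field_simp
  rw [h1, Real.sqrt_eq_rpow, ← Real.rpow_add h0]
  norm_num [hl]

/-- A chirp acts on the amalgam spaces with norm at most a multiple of `|det(1 + iP)|^{1/2}`, the
`L¹` norm of the Fourier transform of the chirp times a Gaussian. -/
theorem exists_amalgamNorm_precompose_chirpMul_le {g : 𝓢(Rd d, ℂ)} (hgc : HasCompactSupport g)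
    (hg : g ≠ 0) : ∃ C : NNReal, ∀ (P : Matrix (Fin d) (Fin d) ℝ) (hP : P.IsHermitian)
      {p q : ℝ≥0∞}, 1 ≤ p → 1 ≤ q → ∀ f : 𝓢'(Rd d, ℂ),
      amalgamNorm g p q (precompose f (chirpMul P)) ≤
        C * ENNReal.ofReal (chirpConst hP) * amalgamNorm g p q f := by
  -- The Gaussian has no zeros, so `g = γ φ` with a smooth `φ` supported where `g` is.
  have hc : HasCompactSupport fun t : Rd d => (gaussian d t)⁻¹ * g t := hgc.mul_left
  have hs : ContDiff ℝ ((⊤ : ℕ∞) : WithTop ℕ∞) fun t : Rd d => (gaussian d t)⁻¹ * g t :=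
    ((gaussian d).smooth'.inv gaussian_ne_zero).mul g.smooth'
  set φ : 𝓢(Rd d, ℂ) := hc.toSchwartzMap hs
  have hφ : ∀ t, φ t = (gaussian d t)⁻¹ * g t := fun t => rfl
  obtain ⟨C, hC⟩ := exists_amalgamNorm_le hg (show HasCompactSupport φ from hc)
  refine ⟨C, fun P hP {p q} hp hq f => ?_⟩
  have h1 : ∀ x, eLpNorm (fun ξ => stft g (precompose f (chirpMul P)) x ξ) p volume ≤
      ENNReal.ofReal (chirpConst hP) * eLpNorm (fun ξ => stft φ f x ξ) p volume := fun x => by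
    rw [← lintegral_fourier_chirp_gaussian hP x]
    refine eLpNorm_apply_le_of_mul f _ φ x
      (Ψ := fun ξ => chirpMul P (shiftedWindow g x ξ)) (fun ξ t => ?_) hp
    rw [chirpMul_apply, chirpMul_apply, shiftedWindow_apply, shiftedWindow_apply,
      compSubConstCLM_apply, hφ]
    field_simp [gaussian_ne_zero]
  calc amalgamNorm g p q (precompose f (chirpMul P))
      ≤ eLpNorm (fun x => ENNReal.ofReal (chirpConst hP) *
          eLpNorm (fun ξ => stft φ f x ξ) p volume) q volume :=
        eLpNorm_mono_enorm fun x => by simpa only [enorm_eq_self] using h1 x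
    _ = ENNReal.ofReal (chirpConst hP) * amalgamNorm φ p q f :=
        eLpNorm_const_mul_ennreal (measurable_eLpNorm_stft _ _ _).aemeasurable _ _
    _ ≤ ENNReal.ofReal (chirpConst hP) * (C * amalgamNorm g p q f) :=
        mul_le_mul' le_rfl (hC hp hq f)
    _ = _ := by ring

end Gaussian

/-! ### Symmetric dilations on amalgam spaces -/

section DiagonalDilation

variable {d : ℕ}

/-- The linear automorphism with nonzero eigenvalues `μ` in an orthonormal basis `b`. -/
noncomputable def diagEquiv (b : OrthonormalBasis (Fin d) ℝ (Rd d)) {μ : Fin d → ℝ}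
    (hμ : ∀ i, μ i ≠ 0) : Rd d ≃L[ℝ] Rd d :=
  (Matrix.toLinearEquiv b.toBasis (Matrix.diagonal μ) (by
    rw [Matrix.det_diagonal, isUnit_iff_ne_zero]
    exact Finset.prod_ne_zero_iff.2 fun i _ => hμ i)).toContinuousLinearEquiv

theorem repr_diagEquiv (b : OrthonormalBasis (Fin d) ℝ (Rd d)) {μ : Fin d → ℝ}
    (hμ : ∀ i, μ i ≠ 0) (t : Rd d) (i : Fin d) :
    b.repr (diagEquiv b hμ t) i = μ i * b.repr t i := by
  have h1 : diagEquiv b hμ t = Matrix.toLin b.toBasis b.toBasis (Matrix.diagonal μ) t := rfl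
  rw [h1, ← b.coe_toBasis_repr_apply, Matrix.repr_toLin, Matrix.mulVec_diagonal,
    b.coe_toBasis_repr_apply]

theorem absDet_diagEquiv (b : OrthonormalBasis (Fin d) ℝ (Rd d)) {μ : Fin d → ℝ}
    (hμ : ∀ i, μ i ≠ 0) : absDet (diagEquiv b hμ) = ENNReal.ofReal (∏ i, |μ i|) := by
  have h1 : ((diagEquiv b hμ).toLinearEquiv : Rd d →ₗ[ℝ] Rd d) =
      Matrix.toLin b.toBasis b.toBasis (Matrix.diagonal μ) := rfl
  rw [absDet, h1, LinearMap.det_toLin, Matrix.det_diagonal, Finset.abs_prod]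

theorem inner_diagEquiv (b : OrthonormalBasis (Fin d) ℝ (Rd d)) {μ : Fin d → ℝ}
    (hμ : ∀ i, μ i ≠ 0) (s t : Rd d) :
    inner ℝ (diagEquiv b hμ s) t = inner ℝ s (diagEquiv b hμ t) := by
  rw [inner_eq_sum_repr b, inner_eq_sum_repr b]
  refine Finset.sum_congr rfl fun i _ => ?_
  rw [repr_diagEquiv, repr_diagEquiv]
  ring

theorem norm_sq_eq_sum_repr (b : OrthonormalBasis (Fin d) ℝ (Rd d)) (t : Rd d) :
    ‖t‖ ^ 2 = ∑ i, b.repr t i ^ 2 := by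
  rw [← real_inner_self_eq_norm_sq, inner_eq_sum_repr b]
  exact Finset.sum_congr rfl fun i _ => by ring

theorem norm_le_norm_diagEquiv (b : OrthonormalBasis (Fin d) ℝ (Rd d)) {μ : Fin d → ℝ}
    (hμ : ∀ i, μ i ≠ 0) (h1 : ∀ i, 1 ≤ |μ i|) (t : Rd d) : ‖t‖ ≤ ‖diagEquiv b hμ t‖ := by
  refine le_of_sq_le_sq ?_ (norm_nonneg _)
  rw [norm_sq_eq_sum_repr b, norm_sq_eq_sum_repr b]
  refine Finset.sum_le_sum fun i _ => ?_
  rw [repr_diagEquiv, mul_pow]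
  exact le_mul_of_one_le_left (sq_nonneg _) ((one_le_sq_iff_one_le_abs _).2 (h1 i))

theorem norm_diagEquiv_le_norm (b : OrthonormalBasis (Fin d) ℝ (Rd d)) {μ : Fin d → ℝ}
    (hμ : ∀ i, μ i ≠ 0) (h1 : ∀ i, |μ i| ≤ 1) (t : Rd d) : ‖diagEquiv b hμ t‖ ≤ ‖t‖ := by
  refine le_of_sq_le_sq ?_ (norm_nonneg _)
  rw [norm_sq_eq_sum_repr b, norm_sq_eq_sum_repr b]
  refine Finset.sum_le_sum fun i _ => ?_
  rw [repr_diagEquiv, mul_pow]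
  exact mul_le_of_le_one_left (sq_nonneg _) ((sq_le_one_iff_abs_le_one _).2 (h1 i))

theorem recip_le_recip {p q : ℝ≥0∞} (hp : 1 ≤ p) (hpq : p ≤ q) : recip q ≤ recip p :=
  ENNReal.toReal_mono (ENNReal.inv_ne_top.2 (zero_lt_one.trans_le hp).ne')
    (ENNReal.inv_le_inv.2 hpq)

/-- Narrow windows, with the exponents chosen best: `absDet L ≥ 1`, so that `1 / r` is to be as large
as `q ≤ r` and `s ≤ p` permit, which is `min (1 / q) (1 - 1 / p)`. Since `p ≤ q`, it is at most
`1 / 2`. -/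
theorem exists_amalgamNorm_dilate_le_expanding {g : 𝓢(Rd d, ℂ)} (hgc : HasCompactSupport g)
    (hg : g ≠ 0) {p q : ℝ≥0∞} (hp : 1 ≤ p) (hpq : p ≤ q) :
    ∃ C : ℝ≥0∞, C ≠ ∞ ∧ ∀ L : Rd d ≃L[ℝ] Rd d, (∀ s t, inner ℝ (L s) t = inner ℝ s (L t)) →
      (∀ t, ‖t‖ ≤ ‖L t‖) → ∀ h : 𝓢'(Rd d, ℂ),
        amalgamNorm (dilate L g) p q h ≤
          C * absDet L ^ (-min (recip q) (1 - recip p)) * amalgamNorm g p q h := by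
  have hu : p⁻¹ ≤ 1 := ENNReal.inv_le_one.2 hp
  have hvu : q⁻¹ ≤ p⁻¹ := ENNReal.inv_le_inv.2 hpq
  set m := min q⁻¹ (1 - p⁻¹) with hm
  have hm1 : m ≤ 1 := (min_le_left _ _).trans (hvu.trans hu)
  have hm2 : m ≤ 2⁻¹ := by
    rcases le_total p⁻¹ 2⁻¹ with h | h
    · exact (min_le_left _ _).trans (hvu.trans h)
    · refine (min_le_right _ _).trans ?_
      rw [← ENNReal.one_sub_inv_two]
      exact tsub_le_tsub_left h 1
  have hs : recip (1 - m)⁻¹ - 1 = -min (recip q) (1 - recip p) := by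
    rw [recip, inv_inv, ENNReal.toReal_sub_of_le hm1 ENNReal.one_ne_top, hm,
      ENNReal.toReal_min (ne_top_of_le_ne_top ENNReal.one_ne_top (hvu.trans hu))
        (ENNReal.sub_ne_top ENNReal.one_ne_top),
      ENNReal.toReal_sub_of_le hu ENNReal.one_ne_top, ENNReal.toReal_one, recip, recip]
    ring
  rw [← hs]
  refine exists_amalgamNorm_dilate_le_of_expanding hgc hg (r := m⁻¹) (s := (1 - m)⁻¹) ?_ ?_ ?_ ?_
    hpq ?_
  · rw [ENNReal.one_le_inv]
    exact tsub_le_self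
  · rw [ENNReal.inv_le_iff_inv_le, ← ENNReal.one_sub_inv_two]
    exact tsub_le_tsub_left hm2 1
  · rw [inv_inv, inv_inv, tsub_add_cancel_of_le hm1]
  · rw [ENNReal.inv_le_iff_inv_le, ← ENNReal.sub_sub_cancel ENNReal.one_ne_top hu]
    exact tsub_le_tsub_left (min_le_right _ _) 1
  · rw [ENNReal.le_inv_iff_le_inv]
    exact min_le_left _ _

/-- Wide windows, with the exponents chosen best: `absDet L ≤ 1`, so that `1 / r` is to be as small as
`r ≤ p` and `p ≤ r'` permit, which is `max (1 / p) (1 - 1 / p)`. -/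
theorem exists_amalgamNorm_dilate_le_contracting {g : 𝓢(Rd d, ℂ)} (hgc : HasCompactSupport g)
    (hg : g ≠ 0) {p q : ℝ≥0∞} (hp : 1 ≤ p) (hpq : p ≤ q) :
    ∃ C : ℝ≥0∞, C ≠ ∞ ∧ ∀ L : Rd d ≃L[ℝ] Rd d, (∀ s t, inner ℝ (L s) t = inner ℝ s (L t)) →
      (∀ t, ‖L t‖ ≤ ‖t‖) → ∀ h : 𝓢'(Rd d, ℂ),
        amalgamNorm (dilate L g) p q h ≤
          C * absDet L ^ (-max (recip p) (1 - recip p)) * amalgamNorm g p q h := by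
  have hu : p⁻¹ ≤ 1 := ENNReal.inv_le_one.2 hp
  set m := max p⁻¹ (1 - p⁻¹) with hm
  have hm1 : m ≤ 1 := max_le hu tsub_le_self
  have hs : recip m⁻¹ = max (recip p) (1 - recip p) := by
    rw [recip, inv_inv, hm, ENNReal.toReal_max (ne_top_of_le_ne_top ENNReal.one_ne_top hu)
        (ENNReal.sub_ne_top ENNReal.one_ne_top),
      ENNReal.toReal_sub_of_le hu ENNReal.one_ne_top, ENNReal.toReal_one, recip]
  rw [← hs]
  refine exists_amalgamNorm_dilate_le_of_contracting hgc hg (r := m⁻¹) (r' := (1 - m)⁻¹) ?_ ?_ ?_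
    ?_ ?_ hpq
  · rwa [ENNReal.one_le_inv]
  · rw [ENNReal.inv_le_iff_inv_le]
    rcases le_total 2⁻¹ p⁻¹ with h | h
    · exact h.trans (le_max_left _ _)
    · refine le_trans ?_ (le_max_right _ _)
      rw [← ENNReal.one_sub_inv_two]
      exact tsub_le_tsub_left h 1
  · rw [inv_inv, inv_inv, add_tsub_cancel_of_le hm1]
  · rw [ENNReal.inv_le_iff_inv_le]
    exact le_max_left _ _
  · rw [ENNReal.le_inv_iff_le_inv, ← ENNReal.sub_sub_cancel ENNReal.one_ne_top hu]
    exact tsub_le_tsub_left (le_max_right _ _) 1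

theorem absDet_rpow_diagEquiv (b : OrthonormalBasis (Fin d) ℝ (Rd d)) {μ : Fin d → ℝ}
    (hμ : ∀ i, μ i ≠ 0) (c : ℝ) :
    absDet (diagEquiv b hμ) ^ c = ENNReal.ofReal (∏ i, |μ i| ^ c) := by
  rw [absDet_diagEquiv, ENNReal.ofReal_rpow_of_pos (Finset.prod_pos fun i _ => abs_pos.2 (hμ i)),
    Real.finsetProd_rpow _ _ fun i _ => abs_nonneg _]

/-- The norm of a symmetric dilation on the amalgam spaces. The eigenvalues larger than `1` and
those smaller than `1` in absolute value are treated separately. -/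
theorem exists_amalgamNorm_precompose_diagEquiv_le {g : 𝓢(Rd d, ℂ)} (hgc : HasCompactSupport g)
    (hg : g ≠ 0) {p q : ℝ≥0∞} (hp : 1 ≤ p) (hpq : p ≤ q) :
    ∃ C : ℝ≥0∞, C ≠ ∞ ∧ ∀ (b : OrthonormalBasis (Fin d) ℝ (Rd d)) (μ : Fin d → ℝ)
      (hμ : ∀ i, μ i ≠ 0) (f : 𝓢'(Rd d, ℂ)),
      amalgamNorm g p q (precompose f (dilate (diagEquiv b hμ))) ≤ C * ENNReal.ofReal (∏ i,
        max 1 |μ i| ^ (recip q - recip p - min (recip q) (1 - recip p)) *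
        min 1 |μ i| ^ (recip q - recip p - max (recip p) (1 - recip p))) *
        amalgamNorm g p q f := by
  obtain ⟨C₁, hC₁t, hC₁⟩ := exists_amalgamNorm_dilate_le_expanding hgc hg hp hpq
  obtain ⟨C₂, hC₂t, hC₂⟩ := exists_amalgamNorm_dilate_le_contracting hgc hg hp hpq
  refine ⟨C₁ * C₂, ENNReal.mul_ne_top hC₁t hC₂t, fun b μ hμ f => ?_⟩
  have hmax : ∀ i, 0 < max 1 |μ i| := fun i => lt_max_of_lt_left one_pos
  -- The dilation is the product of those by `max 1 |μᵢ|` and by `μᵢ / max 1 |μᵢ|`.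
  have h1 : ∀ i, max 1 |μ i| ≠ 0 := fun i => (hmax i).ne'
  have h2 : ∀ i, μ i / max 1 |μ i| ≠ 0 := fun i => div_ne_zero (hμ i) (h1 i)
  have habs1 : ∀ i, |max 1 (|μ i|)| = max 1 |μ i| := fun i => abs_of_pos (hmax i)
  have habs2 : ∀ i, |μ i / max 1 (|μ i|)| = min 1 |μ i| := fun i => by
    rw [abs_div, habs1, div_eq_iff (h1 i), min_mul_max, one_mul]
  set L₁ := diagEquiv b (μ := fun i => max 1 |μ i|) h1 with hL₁
  set L₂ := diagEquiv b (μ := fun i => μ i / max 1 |μ i|) h2 with hL₂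
  have hcomp : precompose f (dilate (diagEquiv b hμ)) =
      precompose (precompose f (dilate L₂)) (dilate L₁) := by
    ext ψ
    rw [precompose_apply, precompose_apply, precompose_apply]
    congr 1
    ext t
    rw [dilate_apply, dilate_apply, dilate_apply]
    congr 1
    refine b.repr.injective ?_
    ext i
    rw [repr_diagEquiv, hL₁, hL₂, repr_diagEquiv, repr_diagEquiv, ← mul_assoc,
      mul_div_cancel₀ _ (h1 i)]
  rw [hcomp, amalgamNorm_precompose_dilate (inner_diagEquiv b h1)]
  have e1 := hC₁ L₁ (inner_diagEquiv b h1)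
    (norm_le_norm_diagEquiv b h1 fun i => by rw [habs1]; exact le_max_left _ _)
    (precompose f (dilate L₂))
  rw [amalgamNorm_precompose_dilate (inner_diagEquiv b h2) g] at e1
  have e2 := hC₂ L₂ (inner_diagEquiv b h2)
    (norm_diagEquiv_le_norm b h2 fun i => by rw [habs2]; exact min_le_left _ _) f
  have hprod : ENNReal.ofReal (∏ i,
        max 1 |μ i| ^ (recip q - recip p - min (recip q) (1 - recip p)) *
        min 1 |μ i| ^ (recip q - recip p - max (recip p) (1 - recip p))) =
      absDet L₁ ^ (recip q - recip p - min (recip q) (1 - recip p)) *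
        absDet L₂ ^ (recip q - recip p - max (recip p) (1 - recip p)) := by
    rw [hL₁, hL₂, absDet_rpow_diagEquiv, absDet_rpow_diagEquiv, Finset.prod_mul_distrib,
      ENNReal.ofReal_mul (Finset.prod_nonneg fun i _ => Real.rpow_nonneg (hmax i).le _)]
    simp_rw [habs1, habs2]
  rw [hprod, sub_eq_add_neg (recip q - recip p), sub_eq_add_neg (recip q - recip p) (max _ _),
    ENNReal.rpow_add _ _ (absDet_ne_zero L₁) (absDet_ne_top L₁),
    ENNReal.rpow_add _ _ (absDet_ne_zero L₂) (absDet_ne_top L₂)]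
  refine (mul_le_mul' le_rfl (e1.trans (mul_le_mul' le_rfl (mul_le_mul' le_rfl e2)))).trans_eq ?_
  ring

end DiagonalDilation

/-! ### Convolution with a chirp -/

section ChirpConvolution

open FourierTransform Filter
open scoped Topology

variable {d : ℕ}

theorem lintegral_prod_gaussian (b : OrthonormalBasis (Fin d) ℝ (Rd d)) {k a : Fin d → ℝ}
    (hk : ∀ i, 0 ≤ k i) (ha : ∀ i, 0 < a i) (s : Fin d → ℝ) :
    ∫⁻ t, ENNReal.ofReal (∏ i, k i * Real.exp (-(Real.pi / a i) * (b.repr t i - s i) ^ 2)) =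
      ENNReal.ofReal (∏ i, k i * a i ^ (1 / 2 : ℝ)) := by
  have hi : Integrable fun v : Fin d → ℝ =>
      ∏ i, k i * Real.exp (-(Real.pi / a i) * (v i - s i) ^ 2) :=
    Integrable.fintype_prod fun i =>
      ((integrable_exp_neg_mul_sq (div_pos Real.pi_pos (ha i))).comp_sub_right (s i)).const_mul _
  have hi' : Integrable fun t : Rd d =>
      ∏ i, k i * Real.exp (-(Real.pi / a i) * (b.repr t i - s i) ^ 2) := by
    have h1 := (PiLp.volume_preserving_ofLp (Fin d)).integrable_comp_of_integrable hi
    exact b.repr.measurePreserving.integrable_comp_of_integrable h1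
  rw [← ofReal_integral_eq_lintegral_ofReal hi' (ae_of_all _ fun t =>
    Finset.prod_nonneg fun i _ => mul_nonneg (hk i) (Real.exp_nonneg _))]
  congr 1
  rw [integral_comp_repr b (fun v : Fin d → ℝ =>
      ∏ i, k i * Real.exp (-(Real.pi / a i) * (v i - s i) ^ 2)),
    integral_fintype_prod_volume_eq_prod (fun i r =>
      k i * Real.exp (-(Real.pi / a i) * (r - s i) ^ 2))]
  refine Finset.prod_congr rfl fun i _ => ?_
  rw [integral_const_mul, integral_sub_right_eq_self
    (fun r => Real.exp (-(Real.pi / a i) * r ^ 2)), integral_gaussian, Real.sqrt_eq_rpow]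
  congr 2
  have := (ha i).ne'
  field_simp

/-- The one-dimensional factor of the Gaussian matrix coefficient of the convolution with a chirp.
The real part of its exponent is written as a sum of squares, one in `ξ` and one in `η` with a centre
that depends on `ξ`, so that it can be integrated first in `η` and then in `ξ`. -/
theorem norm_matrixCoeff_factor (l x y ξ η : ℝ) :
    ‖(Real.pi / (Real.pi * (1 + l * Complex.I)) : ℂ) ^ (1 / 2 : ℂ) *
      (Real.pi / (Real.pi * (1 + 2 * l * Complex.I) / (1 + l * Complex.I)) : ℂ) ^ (1 / 2 : ℂ) *
      Complex.exp ((Real.pi * (x - ξ * Complex.I) ^ 2 / (1 + l * Complex.I) - Real.pi * x ^ 2 -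
          Real.pi * y ^ 2) +
        (2 * Real.pi * ((x - ξ * Complex.I) * (l * Complex.I) / (1 + l * Complex.I) +
          (y - η * Complex.I))) ^ 2 /
          (4 * (Real.pi * (1 + 2 * l * Complex.I) / (1 + l * Complex.I))))‖ =
    ((1 + 4 * l ^ 2) ^ (-(1 / 4) : ℝ) *
        Real.exp (-(Real.pi / (1 + 2 * l ^ 2)) * (ξ - l * (y - x)) ^ 2)) *
      Real.exp (-(Real.pi / ((1 + 4 * l ^ 2) / (1 + 2 * l ^ 2))) *
        (η - (-(l * (y - x)) - 2 * l ^ 2 / (1 + 2 * l ^ 2) * (ξ - l * (y - x)))) ^ 2) := by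
  have hπ : (Real.pi : ℂ) ≠ 0 := Complex.ofReal_ne_zero.2 Real.pi_ne_zero
  have h1 : (1 + l * Complex.I : ℂ) ≠ 0 := fun h => by
    have := congrArg Complex.re h
    simp at this
  have h2 : (1 + 2 * l * Complex.I : ℂ) ≠ 0 := fun h => by
    have := congrArg Complex.re h
    simp at this
  have hnorm : ‖(1 + 2 * l * Complex.I : ℂ)‖ = (1 + 4 * l ^ 2) ^ (1 / 2 : ℝ) := by
    rw [← Real.sqrt_eq_rpow, Complex.norm_def, Complex.normSq_apply]
    congr 1
    simp
    ring
  have hl : (1 + (l : ℂ) ^ 2 * 4) ≠ 0 := by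
    have : (1 + l ^ 2 * 4 : ℝ) ≠ 0 := by positivity
    exact_mod_cast this
  have e1 : (Real.pi / (Real.pi * (1 + l * Complex.I)) : ℂ) = (1 + l * Complex.I)⁻¹ := by
    field_simp
  have e2 : (Real.pi / (Real.pi * (1 + 2 * l * Complex.I) / (1 + l * Complex.I)) : ℂ) =
      (1 + l * Complex.I) * (1 + 2 * l * Complex.I)⁻¹ := by
    field_simp
  have e3 : (Real.pi * (x - ξ * Complex.I) ^ 2 / (1 + l * Complex.I) - Real.pi * x ^ 2 -
          Real.pi * y ^ 2) +
        (2 * Real.pi * ((x - ξ * Complex.I) * (l * Complex.I) / (1 + l * Complex.I) +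
          (y - η * Complex.I))) ^ 2 /
          (4 * (Real.pi * (1 + 2 * l * Complex.I) / (1 + l * Complex.I))) =
      Real.pi * (((1 + l * Complex.I) * ((x - ξ * Complex.I) ^ 2 + (y - η * Complex.I) ^ 2) +
        2 * l * Complex.I * (x - ξ * Complex.I) * (y - η * Complex.I)) / (1 + 2 * l * Complex.I) -
        x ^ 2 - y ^ 2) := by
    have key : ∀ z w m : ℂ, m ≠ 0 → 2 * m - 1 ≠ 0 →
        (Real.pi * z ^ 2 / m - Real.pi * x ^ 2 - Real.pi * y ^ 2) +
          (2 * Real.pi * (z * (m - 1) / m + w)) ^ 2 / (4 * (Real.pi * (2 * m - 1) / m)) =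
        Real.pi * ((m * (z ^ 2 + w ^ 2) + 2 * (m - 1) * z * w) / (2 * m - 1) - x ^ 2 - y ^ 2) :=
      fun z w m hm hn => by
        have hn' : m * 2 - 1 ≠ 0 := by rwa [mul_comm]
        field_simp
        ring
    have h4 : 2 * (1 + l * Complex.I) - 1 = 1 + 2 * l * Complex.I := by ring
    have h5 := key (x - ξ * Complex.I) (y - η * Complex.I) _ h1 (h4 ▸ h2)
    rw [h4, add_sub_cancel_left] at h5
    rw [h5]
    ring
  have e4 : ((1 + l * Complex.I) * ((x - ξ * Complex.I) ^ 2 + (y - η * Complex.I) ^ 2) +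
        2 * l * Complex.I * (x - ξ * Complex.I) * (y - η * Complex.I)) / (1 + 2 * l * Complex.I) =
      ((((1 + 2 * l ^ 2) * (x ^ 2 + y ^ 2 - ξ ^ 2 - η ^ 2) - 2 * l * (x * ξ + y * η) +
        4 * l ^ 2 * (x * y - ξ * η) + 2 * l * (x * η + y * ξ)) / (1 + 4 * l ^ 2) : ℝ) : ℂ) +
      (((-(l * (x ^ 2 + y ^ 2 - ξ ^ 2 - η ^ 2)) - 2 * (1 + 2 * l ^ 2) * (x * ξ + y * η) +
        2 * l * (x * y - ξ * η) - 4 * l ^ 2 * (x * η + y * ξ)) / (1 + 4 * l ^ 2) : ℝ) : ℂ) *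
        Complex.I := by
    push_cast
    rw [div_eq_iff h2]
    field_simp
    ring_nf
    simp only [Complex.I_sq, Complex.I_pow_three]
    ring
  have hc : (1 / 2 : ℂ) = ((1 / 2 : ℝ) : ℂ) := by push_cast; ring
  rw [e1, e2, e3, e4, norm_mul, norm_mul, hc, Complex.norm_cpow_real, Complex.norm_cpow_real,
    ← Real.mul_rpow (norm_nonneg _) (norm_nonneg _), ← norm_mul, ← mul_assoc,
    inv_mul_cancel₀ h1, one_mul, norm_inv, hnorm, Complex.norm_exp,
    ← Real.rpow_neg (by positivity), ← Real.rpow_mul (by positivity), mul_assoc _ _ (Real.exp _),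
    ← Real.exp_add]
  congr 1
  · norm_num
  · congr 1
    rw [← Complex.ofReal_pow, ← Complex.ofReal_pow, Complex.re_ofReal_mul]
    simp only [Complex.add_re, Complex.sub_re, Complex.ofReal_re, Complex.mul_re, Complex.I_re,
      mul_zero, Complex.ofReal_im, Complex.I_im, mul_one, sub_self, add_zero]
    have : (1 + 4 * l ^ 2 : ℝ) ≠ 0 := by positivity
    have : (1 + 2 * l ^ 2 : ℝ) ≠ 0 := by positivity
    field_simp
    ring

/-- The Gaussian matrix coefficients of the convolution with the chirp of `-N`, in an eigenbasis of
`N`. Both the convolution and the outer Fourier transform are Gaussian integrals. -/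
theorem norm_fourier_chirp_convolution {N : Matrix (Fin d) (Fin d) ℝ} (hN : N.IsHermitian)
    (x y ξ η : Rd d) {Φ : Rd d → ℂ}
    (hΦ : ∀ t, Φ t = gaussian d (t - y) *
      ∫ r, chirp (-N) (t - r) * (character ξ r * gaussian d (r - x))) :
    ‖𝓕 Φ η‖ = ∏ i, ((1 + 4 * hN.eigenvalues i ^ 2) ^ (-(1 / 4) : ℝ) *
        Real.exp (-(Real.pi / (1 + 2 * hN.eigenvalues i ^ 2)) *
          (hN.eigenvectorBasis.repr ξ i -
            hN.eigenvalues i * hN.eigenvectorBasis.repr (y - x) i) ^ 2)) *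
      Real.exp (-(Real.pi / ((1 + 4 * hN.eigenvalues i ^ 2) / (1 + 2 * hN.eigenvalues i ^ 2))) *
        (hN.eigenvectorBasis.repr η i -
          (-(hN.eigenvalues i * hN.eigenvectorBasis.repr (y - x) i) -
            2 * hN.eigenvalues i ^ 2 / (1 + 2 * hN.eigenvalues i ^ 2) *
            (hN.eigenvectorBasis.repr ξ i -
              hN.eigenvalues i * hN.eigenvectorBasis.repr (y - x) i))) ^ 2) := by
  set b := hN.eigenvectorBasis with hb
  set l := hN.eigenvalues with hl
  have hneg : ∀ s : Rd d, chirp (-N) s =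
      Complex.exp (((-(Real.pi * ∑ i, l i * b.repr s i ^ 2) : ℝ) : ℂ) * Complex.I) := fun s => by
    rw [chirp, ← inner_toEuclideanLin_eq_sum hN, map_neg, LinearMap.neg_apply, inner_neg_right,
      mul_neg]
  have hinner : ∀ t, ∫ r, chirp (-N) (t - r) * (character ξ r * gaussian d (r - x)) =
      Complex.exp (∑ i, (-(Real.pi * l i * Complex.I * (b.repr t i) ^ 2) -
          Real.pi * (b.repr x i) ^ 2)) *
        ∏ i, ((Real.pi / (Real.pi * (1 + l i * Complex.I)) : ℂ) ^ (1 / 2 : ℂ) *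
          Complex.exp ((2 * Real.pi * (b.repr x i - b.repr ξ i * Complex.I +
            l i * Complex.I * b.repr t i)) ^ 2 / (4 * (Real.pi * (1 + l i * Complex.I))))) :=
    fun t => by
      have h1 : ∀ r, chirp (-N) (t - r) * (character ξ r * gaussian d (r - x)) =
          Complex.exp (∑ i, (-(Real.pi * l i * Complex.I * (b.repr t i) ^ 2) -
            Real.pi * (b.repr x i) ^ 2)) *
          Complex.exp (-∑ i, (Real.pi * (1 + l i * Complex.I)) * ((b.repr r i : ℝ) : ℂ) ^ 2 +
            ∑ i, (2 * Real.pi * (b.repr x i - b.repr ξ i * Complex.I +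
              l i * Complex.I * b.repr t i)) * ((b.repr r i : ℝ) : ℂ)) := fun r => by
        rw [hneg, gaussian_apply, character, inner_eq_sum_repr b ξ r, ← real_inner_self_eq_norm_sq,
          inner_eq_sum_repr b (r - x), ← Complex.exp_add, ← Complex.exp_add, ← Complex.exp_add]
        congr 1
        simp only [map_sub, PiLp.sub_apply]
        push_cast
        simp only [Finset.mul_sum, Finset.sum_mul, ← Finset.sum_neg_distrib,
          ← Finset.sum_add_distrib]
        refine Finset.sum_congr rfl fun i _ => ?_
        ring
      simp_rw [h1]
      rw [integral_const_mul, integral_comp_repr b (fun v : Fin d → ℝ =>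
          Complex.exp (-∑ i, (Real.pi * (1 + l i * Complex.I)) * ((v i : ℝ) : ℂ) ^ 2 +
            ∑ i, (2 * Real.pi * (b.repr x i - b.repr ξ i * Complex.I +
              l i * Complex.I * b.repr t i)) * ((v i : ℝ) : ℂ))),
        GaussianFourier.integral_cexp_neg_sum_mul_add
          (b := fun i => Real.pi * (1 + l i * Complex.I)) (fun i => by simp [Real.pi_pos])]
  have hne : ∀ i, (1 + l i * Complex.I : ℂ) ≠ 0 := fun i h => by
    have := congrArg Complex.re h
    simp at this
  have hpos : ∀ i, 0 < (Real.pi * (1 + 2 * l i * Complex.I) / (1 + l i * Complex.I) : ℂ).re :=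
    fun i => by
      have h1 : (Real.pi * (1 + 2 * l i * Complex.I) / (1 + l i * Complex.I) : ℂ) =
          ((Real.pi * (1 + 2 * l i ^ 2) / (1 + l i ^ 2) : ℝ) : ℂ) +
            ((Real.pi * l i / (1 + l i ^ 2) : ℝ) : ℂ) * Complex.I := by
        have h2 : (1 + (l i : ℂ) ^ 2) ≠ 0 := by
          have : (1 + l i ^ 2 : ℝ) ≠ 0 := by positivity
          exact_mod_cast this
        rw [div_eq_iff (hne i)]
        push_cast
        field_simp
        ring_nf
        simp only [Complex.I_sq]
        ring
      rw [h1, Complex.add_re, Complex.ofReal_re, Complex.re_ofReal_mul, Complex.I_re,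
        mul_zero, add_zero]
      have := Real.pi_pos
      positivity
  have houter : ∀ t, character η t * Φ t =
      (∏ i, ((Real.pi / (Real.pi * (1 + l i * Complex.I)) : ℂ) ^ (1 / 2 : ℂ) *
        Complex.exp (Real.pi * (b.repr x i - b.repr ξ i * Complex.I) ^ 2 / (1 + l i * Complex.I) -
          Real.pi * (b.repr x i) ^ 2 - Real.pi * (b.repr y i) ^ 2))) *
      Complex.exp (-∑ i, (Real.pi * (1 + 2 * l i * Complex.I) / (1 + l i * Complex.I)) *
          ((b.repr t i : ℝ) : ℂ) ^ 2 +
        ∑ i, (2 * Real.pi * ((b.repr x i - b.repr ξ i * Complex.I) * (l i * Complex.I) /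
          (1 + l i * Complex.I) + (b.repr y i - b.repr η i * Complex.I))) *
          ((b.repr t i : ℝ) : ℂ)) := fun t => by
    rw [hΦ, hinner, gaussian_apply, character, inner_eq_sum_repr b η t,
      ← real_inner_self_eq_norm_sq, inner_eq_sum_repr b (t - y), Finset.prod_mul_distrib,
      Finset.prod_mul_distrib, ← Complex.exp_sum, ← Complex.exp_sum, mul_left_comm (Complex.exp _)
        (∏ i, _), mul_left_comm (Complex.exp _) (∏ i, _), mul_left_comm (Complex.exp _) (∏ i, _),
      mul_assoc (∏ i, _), ← Complex.exp_add, ← Complex.exp_add, ← Complex.exp_add, ← Complex.exp_add]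
    congr 2
    simp only [map_sub, PiLp.sub_apply]
    push_cast
    simp only [Finset.mul_sum, Finset.sum_mul, ← Finset.sum_neg_distrib,
      ← Finset.sum_add_distrib]
    refine Finset.sum_congr rfl fun i _ => ?_
    have h1 := hne i
    have hπ : (Real.pi : ℂ) ≠ 0 := Complex.ofReal_ne_zero.2 Real.pi_ne_zero
    have key : ∀ z m u v w t : ℂ, 1 + m ≠ 0 →
        -(Real.pi * ((t - v) * (t - v))) + (-(Real.pi * m * t ^ 2) - Real.pi * u ^ 2 +
          (2 * Real.pi * (z + m * t)) ^ 2 / (4 * (Real.pi * (1 + m)))) - 2 * Real.pi * w * t =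
        Real.pi * z ^ 2 / (1 + m) - Real.pi * u ^ 2 - Real.pi * v ^ 2 +
          (-(Real.pi * (1 + 2 * m) / (1 + m) * t ^ 2) +
            2 * Real.pi * (z * m / (1 + m) + (v - w)) * t) := fun z m u v w t h => by
      field_simp
      ring
    linear_combination key (b.repr x i - b.repr ξ i * Complex.I) (l i * Complex.I) (b.repr x i)
      (b.repr y i) (b.repr η i * Complex.I) (b.repr t i) h1
  rw [fourier_apply_eq_integral_character]
  simp_rw [houter]
  rw [integral_const_mul, integral_comp_repr b (fun v : Fin d → ℝ =>
      Complex.exp (-∑ i, (Real.pi * (1 + 2 * l i * Complex.I) / (1 + l i * Complex.I)) *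
          ((v i : ℝ) : ℂ) ^ 2 +
        ∑ i, (2 * Real.pi * ((b.repr x i - b.repr ξ i * Complex.I) * (l i * Complex.I) /
          (1 + l i * Complex.I) + (b.repr y i - b.repr η i * Complex.I))) *
          ((v i : ℝ) : ℂ))),
    GaussianFourier.integral_cexp_neg_sum_mul_add hpos, ← Finset.prod_mul_distrib, norm_prod]
  refine Finset.prod_congr rfl fun i _ => ?_
  rw [map_sub, PiLp.sub_apply, ← norm_matrixCoeff_factor, Complex.exp_add]
  congr 1
  ring

/-- A bound for the Schwartz function `Φ = T_y γ · (c * M_{-ξ} T_x γ)`, with `γ` the Gaussian and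
`c` the chirp of `-N`: the `L¹` norm of `𝓕 Φ` is a Gaussian in `ξ`. -/
theorem lintegral_fourier_chirp_convolution {N : Matrix (Fin d) (Fin d) ℝ} (hN : N.IsHermitian)
    (x y ξ : Rd d) {Φ : Rd d → ℂ}
    (hΦ : ∀ t, Φ t = gaussian d (t - y) *
      ∫ r, chirp (-N) (t - r) * (character ξ r * gaussian d (r - x))) :
    ∫⁻ η, ‖𝓕 Φ η‖ₑ = ENNReal.ofReal (∏ i,
      ((1 + 4 * hN.eigenvalues i ^ 2) ^ (1 / 4 : ℝ) *
        (1 + 2 * hN.eigenvalues i ^ 2) ^ (-(1 / 2) : ℝ)) *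
        Real.exp (-(Real.pi / (1 + 2 * hN.eigenvalues i ^ 2)) *
          (hN.eigenvectorBasis.repr ξ i -
            hN.eigenvalues i * hN.eigenvectorBasis.repr (y - x) i) ^ 2)) := by
  simp_rw [← ofReal_norm, norm_fourier_chirp_convolution hN x y ξ _ hΦ]
  rw [lintegral_prod_gaussian hN.eigenvectorBasis (fun i => by positivity)
    (fun i => by positivity)]
  congr 1
  refine Finset.prod_congr rfl fun i _ => ?_
  have h1 : (0 : ℝ) < 1 + 4 * hN.eigenvalues i ^ 2 := by positivity
  rw [Real.div_rpow (by positivity) (by positivity), Real.rpow_neg (by positivity) (1 / 2),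
    mul_right_comm, ← div_eq_mul_inv, ← mul_div_assoc, ← Real.rpow_add h1]
  norm_num

theorem prod_rpow_le_chirpConst {N : Matrix (Fin d) (Fin d) ℝ} (hN : N.IsHermitian) :
    ∏ i, (1 + 4 * hN.eigenvalues i ^ 2) ^ (1 / 4 : ℝ) ≤ 4 ^ d * chirpConst hN := by
  have h1 : (4 : ℝ) ^ d = ∏ _i : Fin d, 4 := by simp
  rw [h1, chirpConst, ← Finset.prod_mul_distrib]
  refine Finset.prod_le_prod (fun i _ => by positivity) fun i _ => ?_
  calc (1 + 4 * hN.eigenvalues i ^ 2) ^ (1 / 4 : ℝ)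
      ≤ (4 * (1 + hN.eigenvalues i ^ 2)) ^ (1 / 4 : ℝ) := by
        refine Real.rpow_le_rpow (by positivity) (by linarith) (by norm_num)
    _ = 4 ^ (1 / 4 : ℝ) * (1 + hN.eigenvalues i ^ 2) ^ (1 / 4 : ℝ) :=
        Real.mul_rpow (by norm_num) (by positivity)
    _ ≤ _ := by
        gcongr
        exact Real.rpow_le_self_of_one_le (by norm_num) (by norm_num)

/-- Convolution with the chirp of `-N` maps `W(𝓕L^∞, L¹)` to `W(𝓕L¹, L^∞)` with norm at most a
multiple of `|det(1 + iN)|^{1/2}`. -/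
theorem exists_amalgamNorm_precompose_convolution_le {g : 𝓢(Rd d, ℂ)}
    (hgc : HasCompactSupport g) (hg : g ≠ 0) :
    ∃ C : ℝ≥0∞, C ≠ ∞ ∧ ∀ (N : Matrix (Fin d) (Fin d) ℝ) (hN : N.IsHermitian)
      (K : 𝓢(Rd d, ℂ) →L[ℂ] 𝓢(Rd d, ℂ)), (∀ ψ t, K ψ t = ∫ r, chirp (-N) (t - r) * ψ r) →
      ∀ f : 𝓢'(Rd d, ℂ), amalgamNorm g 1 ∞ (precompose f K) ≤
        C * ENNReal.ofReal (chirpConst hN) * amalgamNorm g ∞ 1 f := by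
  -- `θ = γ φ` has integral `1`, for the resolution of `f`, and a Gaussian factor `γ`, for the explicit
  -- computation; the compactly supported factor `φ` remains as the window of `f`.
  obtain ⟨ψ, -, hψ⟩ := exists_dual_window hgc hg
  have hc : HasCompactSupport fun t : Rd d => (gaussian d t)⁻¹ * (ψ t * g t) :=
    (hgc.mul_left (f := fun t => ψ t)).mul_left (f := fun t => (gaussian d t)⁻¹)
  have hs : ContDiff ℝ ((⊤ : ℕ∞) : WithTop ℕ∞) fun t : Rd d => (gaussian d t)⁻¹ * (ψ t * g t) :=
    ((gaussian d).smooth'.inv gaussian_ne_zero).mul (ψ.smooth'.mul g.smooth')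
  set φ : 𝓢(Rd d, ℂ) := hc.toSchwartzMap hs
  have hφ : ∀ t, φ t = (gaussian d t)⁻¹ * (ψ t * g t) := fun t => rfl
  set θ : 𝓢(Rd d, ℂ) := smulLeftCLM ℂ (gaussian d) φ
  have hθ : ∀ t, θ t = gaussian d t * φ t := fun t => by
    rw [smulLeftCLM_apply_apply (gaussian d).hasTemperateGrowth, smul_eq_mul]
  have hθ1 : ∫ t, θ t = 1 := by
    rw [← hψ]
    congr with t
    rw [hθ, hφ, mul_inv_cancel_left₀ (gaussian_ne_zero t)]
  have hγ : gaussian d ≠ 0 := fun h => gaussian_ne_zero (0 : Rd d) (by rw [h]; rfl)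
  obtain ⟨C₁, hC₁⟩ := exists_amalgamNorm_le hγ hgc
  obtain ⟨C₂, hC₂⟩ := exists_amalgamNorm_le hg (show HasCompactSupport φ from hc)
  refine ⟨C₁ * ENNReal.ofReal (4 ^ d) * C₂, by finiteness, fun N hN K hK f => ?_⟩
  set b := hN.eigenvectorBasis with hb
  set l := hN.eigenvalues with hl
  set H : Rd d → Rd d → Rd d → ℝ≥0∞ := fun x ξ y => ENNReal.ofReal (∏ i,
      ((1 + 4 * l i ^ 2) ^ (1 / 4 : ℝ) * (1 + 2 * l i ^ 2) ^ (-(1 / 2) : ℝ)) *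
        Real.exp (-(Real.pi / (1 + 2 * l i ^ 2)) *
          (b.repr ξ i - l i * b.repr (y - x) i) ^ 2)) with hH
  set U : Rd d → ℝ≥0∞ := fun y => eLpNorm (fun η => stft φ f y η) ∞ volume with hU
  have hUm : Measurable U := measurable_eLpNorm_stft _ _ _
  have hHm : ∀ x, Measurable (Function.uncurry (H x)) := fun x => by
    simp only [hH, Function.uncurry_def]
    fun_prop
  have hpt : ∀ x ξ, ‖stft (gaussian d) (precompose f K) x ξ‖ₑ ≤ ∫⁻ y, H x ξ y * U y := by
    intro x ξ
    have h1 := apply_mul_integral_eq f θ (K (shiftedWindow (gaussian d) x ξ))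
    rw [hθ1, mul_one] at h1
    rw [stft, precompose_apply, h1]
    refine (enorm_integral_le_lintegral_enorm _).trans (lintegral_mono fun y => ?_)
    set m : 𝓢(Rd d, ℂ) := smulLeftCLM ℂ (translate y (gaussian d))
      (K (shiftedWindow (gaussian d) x ξ)) with hm
    have hmt : ∀ t, m t = gaussian d (t - y) *
        ∫ r, chirp (-N) (t - r) * (character ξ r * gaussian d (r - x)) := fun t => by
      rw [hm, smulLeftCLM_apply_apply (translate y (gaussian d)).hasTemperateGrowth, smul_eq_mul,
        compSubConstCLM_apply, hK]
      simp only [shiftedWindow_apply]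
    -- The modulation by `ξ` is part of `m`, whence the frequency `0` for the window of `f`.
    rw [apply_mul_eq_integral_stft f (m := m) (φ := φ) (x := y) (ξ := 0) fun t => ?_]
    · refine (enorm_integral_le_lintegral_enorm _).trans ?_
      calc ∫⁻ η, ‖𝓕 m η * stft φ f y (0 - η)‖ₑ ≤ ∫⁻ η, ‖𝓕 m η‖ₑ * U y := by
            refine lintegral_mono_ae ?_
            have h2 := (measurePreserving_const_sub (0 : Rd d)).quasiMeasurePreserving.ae
              (ae_le_eLpNormEssSup (f := fun η => stft φ f y η) (μ := volume))
            filter_upwards [h2] with η hη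
            rw [enorm_mul]
            refine mul_le_mul' le_rfl ?_
            simpa only [hU, eLpNorm_exponent_top] using hη
        _ = (∫⁻ η, ‖𝓕 m η‖ₑ) * U y := lintegral_mul_const _ (by fun_prop)
        _ = H x ξ y * U y := by
            have h3 := lintegral_fourier_chirp_convolution hN x y ξ (Φ := m) hmt
            rw [← SchwartzMap.fourier_coe] at h3
            rw [h3]
    · rw [smulLeftCLM_apply_apply (K _).hasTemperateGrowth, smul_eq_mul, compSubConstCLM_apply,
        hθ, shiftedWindow_apply, hm,
        smulLeftCLM_apply_apply (translate y (gaussian d)).hasTemperateGrowth, smul_eq_mul,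
        compSubConstCLM_apply, character]
      simp
      ring
  have hint : ∀ x, eLpNorm (fun ξ => stft (gaussian d) (precompose f K) x ξ) 1 volume ≤
      ENNReal.ofReal (4 ^ d * chirpConst hN) * amalgamNorm φ ∞ 1 f := fun x => by
    rw [eLpNorm_one_eq_lintegral_enorm]
    calc ∫⁻ ξ, ‖stft (gaussian d) (precompose f K) x ξ‖ₑ
        ≤ ∫⁻ ξ, ∫⁻ y, H x ξ y * U y := lintegral_mono fun ξ => hpt x ξ
      _ = ∫⁻ y, ∫⁻ ξ, H x ξ y * U y := lintegral_lintegral_swap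
          ((hHm x).mul (hUm.comp measurable_snd)).aemeasurable
      _ = ∫⁻ y, ENNReal.ofReal (∏ i, (1 + 4 * l i ^ 2) ^ (1 / 4 : ℝ)) * U y := by
          refine lintegral_congr fun y => ?_
          have h1 : Measurable fun ξ => H x ξ y := by
            simp only [hH]
            fun_prop
          rw [lintegral_mul_const _ h1, lintegral_prod_gaussian b (fun i => by positivity)
            (fun i => by positivity) (fun i => l i * b.repr (y - x) i)]
          congr 2
          refine Finset.prod_congr rfl fun i _ => ?_
          rw [mul_assoc, ← Real.rpow_add (by positivity)]
          norm_num
      _ = ENNReal.ofReal (∏ i, (1 + 4 * l i ^ 2) ^ (1 / 4 : ℝ)) * amalgamNorm φ ∞ 1 f := by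
          rw [lintegral_const_mul _ hUm, amalgamNorm, eLpNorm_one_eq_lintegral_enorm]
          simp only [enorm_eq_self, hU]
      _ ≤ _ := by
          gcongr
          exact prod_rpow_le_chirpConst hN
  calc amalgamNorm g 1 ∞ (precompose f K)
      ≤ C₁ * amalgamNorm (gaussian d) 1 ∞ (precompose f K) := hC₁ le_rfl le_top _
    _ ≤ C₁ * (ENNReal.ofReal (4 ^ d * chirpConst hN) * amalgamNorm φ ∞ 1 f) := by
        refine mul_le_mul' le_rfl ?_
        rw [amalgamNorm, eLpNorm_exponent_top]
        refine eLpNormEssSup_le_of_ae_enorm_bound (ae_of_all _ fun x => ?_)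
        simpa only [enorm_eq_self] using hint x
    _ ≤ C₁ * (ENNReal.ofReal (4 ^ d * chirpConst hN) * (C₂ * amalgamNorm g ∞ 1 f)) := by
        gcongr
        exact hC₂ le_top le_rfl f
    _ = _ := by
        rw [ENNReal.ofReal_mul (by positivity)]
        ring

end ChirpConvolution

/-! ### The metaplectic operator as a product of elementary operators -/

section Representation

open FourierTransform Filter
open scoped Topology ComplexConjugate

variable {d : ℕ}

/-- A continuous operator on `𝓢'` is the transpose of a map of `𝓢`, since every weak-* continuous
functional on `𝓢'` is the evaluation at a Schwartz function. -/
theorem exists_transpose (T : 𝓢'(Rd d, ℂ) →L[ℂ] 𝓢'(Rd d, ℂ)) :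
    ∃ S : 𝓢(Rd d, ℂ) → 𝓢(Rd d, ℂ), ∀ f ψ, T f ψ = f (S ψ) := by
  suffices h : ∀ ψ, ∃ χ : 𝓢(Rd d, ℂ), ∀ f, T f ψ = f χ by
    choose S hS using h
    exact ⟨S, fun f ψ => hS ψ f⟩
  intro ψ
  obtain ⟨χ, hχ⟩ := LinearMap.dualEmbedding_surjective (topDualPairing ℂ 𝓢(Rd d, ℂ))
    (((PointwiseConvergenceCLM.evalCLM (RingHom.id ℂ) ℂ ψ).comp T).comp
      (PointwiseConvergenceCLM.equivWeakDual ℂ 𝓢(Rd d, ℂ)).symm.toContinuousLinearMap)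
  refine ⟨χ, fun f => ?_⟩
  have h := DFunLike.congr_fun hχ (PointwiseConvergenceCLM.equivWeakDual ℂ 𝓢(Rd d, ℂ) f)
  exact h.symm

/-- The complex conjugate of a Schwartz function, as an element of `L²`. -/
noncomputable def conjL2 (ψ : 𝓢(Rd d, ℂ)) : L2 d := star (ψ.toLp 2)

theorem coeFn_conjL2 (ψ : 𝓢(Rd d, ℂ)) : conjL2 ψ =ᵐ[volume] fun t => conj (ψ t) := by
  filter_upwards [Lp.coeFn_star (ψ.toLp 2), ψ.coeFn_toLp 2] with t h1 h2
  rw [conjL2, h1, Pi.star_apply, h2]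
  rfl

theorem conjL2_injective : Function.Injective (conjL2 (d := d)) := fun φ ψ h => by
  ext t
  have h1 : (fun t => conj (φ t)) =ᵐ[volume] fun t => conj (ψ t) :=
    (coeFn_conjL2 φ).symm.trans (h ▸ coeFn_conjL2 ψ)
  have h2 := (Continuous.ae_eq_iff_eq volume (by fun_prop) (by fun_prop)).1 h1
  exact (starRingEnd ℂ).injective (congrFun h2 t)

theorem inner_conjL2 (ψ : 𝓢(Rd d, ℂ)) (f : L2 d) :
    inner ℂ (conjL2 ψ) f = Lp.toTemperedDistribution f ψ := by
  rw [L2.inner_def, Lp.toTemperedDistribution_apply]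
  refine integral_congr_ae ?_
  filter_upwards [coeFn_conjL2 ψ] with t ht
  rw [ht, RCLike.inner_apply, Complex.conj_conj, smul_eq_mul, mul_comm]

theorem inner_conjL2_conjL2 (φ ψ : 𝓢(Rd d, ℂ)) :
    inner ℂ (conjL2 φ) (conjL2 ψ) = ∫ t, φ t * conj (ψ t) := by
  rw [inner_conjL2, Lp.toTemperedDistribution_apply]
  refine integral_congr_ae ?_
  filter_upwards [coeFn_conjL2 ψ] with t ht
  rw [ht, smul_eq_mul]

/-- The transpose `t ↦ e^{2πi v·t - πi u·v} ψ(t - u)` of the operator `ρ(u, v)`, on Schwartz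
functions. -/
noncomputable def phaseShift (u v : Rd d) (ψ : 𝓢(Rd d, ℂ)) : 𝓢(Rd d, ℂ) :=
  Complex.exp (((-(Real.pi * inner ℝ u v) : ℝ) : ℂ) * Complex.I) • shiftedWindow ψ u (-v)

theorem phaseShift_apply (u v : Rd d) (ψ : 𝓢(Rd d, ℂ)) (t : Rd d) :
    phaseShift u v ψ t =
      Complex.exp (((2 * Real.pi * inner ℝ v t - Real.pi * inner ℝ u v : ℝ) : ℂ) * Complex.I) *
        ψ (t - u) := by
  rw [phaseShift, _root_.smul_apply, shiftedWindow_apply, smul_eq_mul, character, ← mul_assoc,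
    ← Complex.exp_add, inner_neg_left]
  congr 2
  push_cast
  ring

/-- Two maps of `𝓢` that intertwine the Schrödinger representation in the same way and have
proportional sesquilinear forms are proportional. -/
theorem exists_eq_smul_of_intertwining {S S' : 𝓢(Rd d, ℂ) → 𝓢(Rd d, ℂ)} {k : ℝ} (hk : 0 < k)
    (hS : Function.Surjective S)
    (h : ∀ u v, ∃ τ : 𝓢(Rd d, ℂ) → 𝓢(Rd d, ℂ), ∀ ψ, S (τ ψ) = phaseShift u v (S ψ) ∧
      S' (τ ψ) = phaseShift u v (S' ψ))
    (hi : ∀ φ ψ, ∫ t, S' φ t * conj (S' ψ t) = k ^ 2 * ∫ t, S φ t * conj (S ψ t)) :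
    ∃ c : ℂ, ‖c‖ = k ∧ ∀ ψ, S' ψ = c • S ψ := by
  have hint : ∀ φ ψ : 𝓢(Rd d, ℂ), Integrable fun t => φ t * conj (ψ t) := fun φ ψ => by
    have h1 := (φ.memLp 2 volume).integrable_mul ((ψ.memLp 2 volume).star)
    exact h1
  -- Modulating `φ` shows that the products agree, not only their integrals.
  have hpt : ∀ φ ψ t, S' φ t * conj (S' ψ t) = k ^ 2 * (S φ t * conj (S ψ t)) := by
    intro φ ψ
    set F : Rd d → ℂ := fun t => S' φ t * conj (S' ψ t) - k ^ 2 * (S φ t * conj (S ψ t)) with hF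
    have hFi : Integrable F := (hint _ _).sub ((hint _ _).const_mul _)
    have hFc : Continuous F := by fun_prop
    have hF0 : 𝓕 F = 0 := by
      funext ξ
      obtain ⟨τ, hτ⟩ := h 0 (-ξ)
      have hps : ∀ (χ : 𝓢(Rd d, ℂ)) t, phaseShift 0 (-ξ) χ t = character ξ t * χ t := fun χ t => by
        rw [phaseShift_apply, character]
        simp
      have h1 := hi (τ φ) ψ
      rw [(hτ φ).1, (hτ φ).2] at h1
      simp only [hps] at h1
      rw [fourier_apply_eq_integral_character, Pi.zero_apply]
      have h2 : ∀ t, character ξ t * F t = phaseShift 0 (-ξ) (S' φ) t * conj (S' ψ t) -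
          k ^ 2 * (phaseShift 0 (-ξ) (S φ) t * conj (S ψ t)) := fun t => by
        rw [hps, hps, hF]
        ring
      simp_rw [h2]
      rw [integral_sub (hint _ _) ((hint _ _).const_mul _), integral_const_mul]
      simp only [hps]
      rw [h1, sub_self]
    have h3 := hFc.fourierInv_fourier_eq hFi (by rw [hF0]; exact integrable_zero _ _ _)
    intro t
    have h4 : F t = 0 := by
      rw [← h3, hF0, Real.fourierInv_eq]
      simp
    exact sub_eq_zero.1 h4
  -- The Gaussian vanishes nowhere, so that it can be divided out.
  obtain ⟨ψ₀, hψ₀⟩ := hS (gaussian d)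
  have hne : ∀ t, S' ψ₀ t ≠ 0 := fun t h0 => by
    have := hpt ψ₀ ψ₀ t
    rw [h0, zero_mul, hψ₀] at this
    simp [hk.ne', gaussian_ne_zero] at this
  set c : Rd d → ℂ := fun t => k ^ 2 * conj (gaussian d t) / conj (S' ψ₀ t) with hc
  have hmul : ∀ φ t, S' φ t = c t * S φ t := fun φ t => by
    have h1 := hpt φ ψ₀ t
    rw [hψ₀] at h1
    have h2 : conj (S' ψ₀ t) ≠ 0 := (map_ne_zero _).2 (hne t)
    rw [hc]
    field_simp
    linear_combination h1
  -- Translation invariance makes the multiplier constant.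
  have hconst : ∀ u, c u = c 0 := fun u => by
    obtain ⟨τ, hτ⟩ := h u 0
    have h1 := hmul (τ ψ₀) u
    rw [(hτ ψ₀).1, (hτ ψ₀).2, phaseShift_apply, phaseShift_apply, hmul, hψ₀] at h1
    simp only [inner_zero_left, inner_zero_right, mul_zero, Complex.ofReal_zero, zero_mul,
      Complex.exp_zero, one_mul, sub_self] at h1
    exact (mul_right_cancel₀ (gaussian_ne_zero 0) h1).symm
  refine ⟨c 0, ?_, fun ψ => ?_⟩
  · have h1 := congrArg norm (hpt ψ₀ ψ₀ 0)
    rw [hmul, hψ₀] at h1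
    simp only [norm_mul, RCLike.norm_conj, norm_pow, Complex.norm_real, Real.norm_eq_abs,
      abs_of_pos hk] at h1
    have h2 : 0 < ‖gaussian d 0‖ := norm_pos_iff.2 (gaussian_ne_zero 0)
    have h3 : ‖c 0‖ ^ 2 = k ^ 2 := by
      have : ‖c 0‖ ^ 2 * (‖gaussian d 0‖ * ‖gaussian d 0‖) =
          k ^ 2 * (‖gaussian d 0‖ * ‖gaussian d 0‖) := by linear_combination h1
      exact mul_right_cancel₀ (by positivity) this
    exact (pow_left_inj₀ (norm_nonneg _) hk.le two_ne_zero).1 h3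
  · ext t
    rw [_root_.smul_apply, smul_eq_mul, hmul, hconst t]

/-- Chirps act on phase space by shears. -/
theorem chirpMul_phaseShift {P : Matrix (Fin d) (Fin d) ℝ} (hP : P.IsHermitian) (u v : Rd d)
    (ψ : 𝓢(Rd d, ℂ)) : chirpMul P (phaseShift u v ψ) =
      phaseShift u (v + P.toEuclideanLin u) (chirpMul P ψ) := by
  ext t
  have h1 := (Matrix.isSymmetric_toEuclideanLin_iff.2 hP) u t
  have h2 := real_inner_comm t (P.toEuclideanLin u)
  rw [chirpMul_apply, phaseShift_apply, phaseShift_apply, chirpMul_apply, chirp, chirp, ← mul_assoc,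
    ← mul_assoc, ← Complex.exp_add, ← Complex.exp_add, ← add_mul, ← add_mul, ← Complex.ofReal_add,
    ← Complex.ofReal_add]
  congr 4
  simp only [map_sub, inner_sub_left, inner_sub_right, inner_add_left, inner_add_right, ← h1, h2]
  ring

/-- The Fourier transform acts on phase space by a right-angle rotation. -/
theorem fourier_phaseShift (u v : Rd d) (ψ : 𝓢(Rd d, ℂ)) :
    𝓕 (phaseShift u v ψ) = phaseShift v (-u) (𝓕 ψ) := by
  ext ξ
  rw [SchwartzMap.fourier_coe, fourier_apply_eq_integral_character, phaseShift_apply,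
    SchwartzMap.fourier_coe, fourier_apply_eq_integral_character]
  have h1 : ∀ t, character ξ t * phaseShift u v ψ t =
      Complex.exp (((2 * Real.pi * inner ℝ (-u) ξ - Real.pi * inner ℝ v (-u) : ℝ) : ℂ) *
        Complex.I) * (character (ξ - v) (t - u) * ψ (t - u)) := fun t => by
    rw [phaseShift_apply, character, character, ← mul_assoc, ← mul_assoc, ← Complex.exp_add,
      ← Complex.exp_add, ← add_mul, ← add_mul, ← Complex.ofReal_add, ← Complex.ofReal_add]
    congr 4
    simp only [inner_sub_left, inner_sub_right, inner_neg_left, inner_neg_right,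
      real_inner_comm u]
    ring
  simp_rw [h1]
  rw [integral_const_mul, integral_sub_right_eq_self (fun t => character (ξ - v) t * ψ t)]

theorem dilate_phaseShift (L : Rd d ≃L[ℝ] Rd d) (u : Rd d) {v w : Rd d}
    (h : ∀ t, inner ℝ v (L t) = inner ℝ w t) (ψ : 𝓢(Rd d, ℂ)) :
    dilate L (phaseShift (L u) v ψ) = phaseShift u w (dilate L ψ) := by
  ext t
  rw [dilate_apply, phaseShift_apply, phaseShift_apply, dilate_apply, h, real_inner_comm v (L u), h,
    real_inner_comm w u, map_sub L]

theorem toEuclideanLin_mul_apply (M N : Matrix (Fin d) (Fin d) ℝ) (t : Rd d) :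
    (M * N).toEuclideanLin t = M.toEuclideanLin (N.toEuclideanLin t) := by
  simp [Matrix.toLpLin_apply]

theorem inner_toEuclideanLin_right (M : Matrix (Fin d) (Fin d) ℝ) (s t : Rd d) :
    inner ℝ s (M.toEuclideanLin t) = inner ℝ (M.transpose.toEuclideanLin s) t := by
  rw [← Matrix.conjTranspose_eq_transpose_of_trivial, Matrix.toEuclideanLin_conjTranspose_eq_adjoint,
    LinearMap.adjoint_inner_left]

/-- The transpose of a metaplectic operator over a matrix with invertible upper right block `B`, up
to a constant: a product of a chirp, the Fourier transform, a dilation by `L = -B` and a chirp. -/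
noncomputable def metaplecticFactor (P Q : Matrix (Fin d) (Fin d) ℝ) (L : Rd d ≃L[ℝ] Rd d) :
    𝓢(Rd d, ℂ) →L[ℂ] 𝓢(Rd d, ℂ) :=
  (chirpMul P).comp ((fourierCLM ℂ 𝓢(Rd d, ℂ)).comp ((dilate L).comp (chirpMul Q)))

theorem metaplecticFactor_apply (P Q : Matrix (Fin d) (Fin d) ℝ) (L : Rd d ≃L[ℝ] Rd d)
    (ψ : 𝓢(Rd d, ℂ)) : metaplecticFactor P Q L ψ = chirpMul P (𝓕 (dilate L (chirpMul Q ψ))) := rfl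

theorem chirpMul_chirpMul_neg (P : Matrix (Fin d) (Fin d) ℝ) (ψ : 𝓢(Rd d, ℂ)) :
    chirpMul P (chirpMul (-P) ψ) = ψ := by
  ext t
  rw [chirpMul_apply, chirpMul_apply, chirp, chirp, ← mul_assoc, ← Complex.exp_add]
  simp

theorem metaplecticFactor_surjective (P Q : Matrix (Fin d) (Fin d) ℝ) (L : Rd d ≃L[ℝ] Rd d) :
    Function.Surjective (metaplecticFactor P Q L) := fun ψ => by
  refine ⟨chirpMul (-Q) (dilate L.symm (𝓕⁻ (chirpMul (-P) ψ))), ?_⟩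
  rw [metaplecticFactor_apply, chirpMul_chirpMul_neg]
  have h1 : ∀ χ : 𝓢(Rd d, ℂ), dilate L (dilate L.symm χ) = χ := fun χ => by
    ext t
    rw [dilate_apply, dilate_apply, L.symm_apply_apply]
  rw [h1, FourierTransform.fourier_fourierInv_eq, chirpMul_chirpMul_neg]

theorem integral_comp_equiv (L : Rd d ≃L[ℝ] Rd d) (F : Rd d → ℂ) :
    ((absDet L).toReal : ℂ) * ∫ t, F (L t) = ∫ t, F t := by
  have h1 := L.toHomeomorph.measurableEmbedding.integral_map (μ := volume) F
  have h2 : Measure.map L.toHomeomorph volume = _ := map_volume_equiv L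
  rw [h2, integral_smul_measure] at h1
  have h3 : ∀ t, L.toHomeomorph t = L t := fun t => rfl
  simp only [h3] at h1
  have h4 : (absDet L).toReal ≠ 0 := ENNReal.toReal_ne_zero.2 ⟨absDet_ne_zero L, absDet_ne_top L⟩
  rw [← h1, ENNReal.toReal_inv, Complex.real_smul, Complex.ofReal_inv,
    mul_inv_cancel_left₀ (Complex.ofReal_ne_zero.2 h4)]

/-- Up to the factor `|det L|^{1/2}`, the product is isometric for the `L²` norm. -/
theorem integral_metaplecticFactor_mul_conj (P Q : Matrix (Fin d) (Fin d) ℝ) (L : Rd d ≃L[ℝ] Rd d)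
    (φ ψ : 𝓢(Rd d, ℂ)) :
    ((absDet L).toReal : ℂ) *
      ∫ t, metaplecticFactor P Q L φ t * conj (metaplecticFactor P Q L ψ t) =
      ∫ t, φ t * conj (ψ t) := by
  have hchirp : ∀ (M : Matrix (Fin d) (Fin d) ℝ) (χ₁ χ₂ : 𝓢(Rd d, ℂ)) t,
      chirpMul M χ₁ t * conj (chirpMul M χ₂ t) = χ₁ t * conj (χ₂ t) := fun M χ₁ χ₂ t => by
    have h1 : chirp M t * conj (chirp M t) = 1 := by
      rw [Complex.mul_conj, Complex.normSq_eq_norm_sq, norm_chirp]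
      simp
    rw [chirpMul_apply, chirpMul_apply, map_mul]
    linear_combination χ₁ t * conj (χ₂ t) * h1
  have hplanch : ∀ χ₁ χ₂ : 𝓢(Rd d, ℂ),
      ∫ t, 𝓕 χ₁ t * conj (𝓕 χ₂ t) = ∫ t, χ₁ t * conj (χ₂ t) := fun χ₁ χ₂ => by
    simpa only [RCLike.inner_apply] using SchwartzMap.integral_inner_fourier_fourier χ₂ χ₁
  simp only [metaplecticFactor_apply, hchirp]
  rw [hplanch]
  simp only [dilate_apply, hchirp]
  rw [integral_comp_equiv L fun t => φ t * conj (ψ t)]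

/-- With `L = -B`, `P = -B⁻¹A` and `Q = -DB⁻¹` the factor acts on phase space as the given symplectic
matrix: these choices come from the decomposition of that matrix into two shears, a dilation and a
rotation. -/
theorem metaplecticFactor_phaseShift {A B C D : Matrix (Fin d) (Fin d) ℝ}
    (hmem : Matrix.fromBlocks A B C D ∈ Matrix.symplecticGroup (Fin d) ℝ) (hB : B.det ≠ 0)
    {P Q : Matrix (Fin d) (Fin d) ℝ} (hP : P = -(B⁻¹ * A)) (hQ : Q = -(D * B⁻¹))
    (hPs : P.IsHermitian) (hQs : Q.IsHermitian) {L : Rd d ≃L[ℝ] Rd d}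
    (hL : ∀ t, L t = -B.toEuclideanLin t) (x y : Rd d) (ψ : 𝓢(Rd d, ℂ)) :
    metaplecticFactor P Q L (phaseShift (A.toEuclideanLin x + B.toEuclideanLin y)
        (C.toEuclideanLin x + D.toEuclideanLin y) ψ) =
      phaseShift x y (metaplecticFactor P Q L ψ) := by
  obtain ⟨-, h2, h3⟩ := SymplecticGroup.fromBlocks_mem_iff.1 hmem
  have hBu : IsUnit B.det := isUnit_iff_ne_zero.2 hB
  have hBP : B * P = -A := by
    rw [hP, Matrix.mul_neg, Matrix.mul_nonsing_inv_cancel_left _ _ hBu]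
  have hu : A.toEuclideanLin x + B.toEuclideanLin y = L (P.toEuclideanLin x - y) := by
    rw [hL, map_sub, ← toEuclideanLin_mul_apply, hBP]
    simp [add_comm]
  have hQB : Q * B = -D := by
    rw [hQ, Matrix.neg_mul, Matrix.nonsing_inv_mul_cancel_right _ _ hBu]
  have hv : C.toEuclideanLin x + D.toEuclideanLin y +
      Q.toEuclideanLin (A.toEuclideanLin x + B.toEuclideanLin y) =
      (C + Q * A).toEuclideanLin x := by
    rw [map_add, ← toEuclideanLin_mul_apply, ← toEuclideanLin_mul_apply, hQB]
    simp only [map_add, map_neg, LinearMap.add_apply, LinearMap.neg_apply]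
    abel
  have hBC : B.transpose * (C + Q * A) = -1 := by
    have h4 : B.transpose * Q = -D.transpose := by
      rw [hQ, Matrix.mul_neg, ← Matrix.mul_assoc, h2, Matrix.mul_nonsing_inv_cancel_right _ _ hBu]
    rw [Matrix.mul_add, ← Matrix.mul_assoc, h4]
    have h5 := congrArg Matrix.transpose h3
    simp only [Matrix.transpose_sub, Matrix.transpose_mul, Matrix.transpose_transpose,
      Matrix.transpose_one] at h5
    rw [← h5, Matrix.neg_mul]
    abel
  have hw : ∀ t, inner ℝ ((C + Q * A).toEuclideanLin x) (L t) = inner ℝ x t := fun t => by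
    rw [hL, inner_neg_right, inner_toEuclideanLin_right, ← toEuclideanLin_mul_apply, hBC]
    simp
  rw [metaplecticFactor_apply, chirpMul_phaseShift hQs, hv, hu, dilate_phaseShift L _ hw,
    fourier_phaseShift, chirpMul_phaseShift hPs, metaplecticFactor_apply]
  congr 1
  abel

/-- Complex conjugation carries the transpose of `ρ(u, v)` to its adjoint `ρ(-u, -v)`. -/
theorem heisenberg_conj_ae (u v : Rd d) {f : Rd d → ℂ} {ψ : 𝓢(Rd d, ℂ)}
    (h : f =ᵐ[volume] fun t => conj (ψ t)) :
    heisenberg (-u) (-v) f =ᵐ[volume] fun t => conj (phaseShift u v ψ t) := by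
  have h1 := (measurePreserving_add_right (volume : Measure (Rd d))
    (-u)).quasiMeasurePreserving.ae h
  filter_upwards [h1] with t ht
  rw [heisenberg, ht, phaseShift_apply, map_mul, ← Complex.exp_conj, map_mul, Complex.conj_ofReal,
    Complex.conj_I, ← sub_eq_add_neg]
  congr 2
  rw [mul_neg, ← neg_mul, ← Complex.ofReal_neg]
  congr 2
  simp only [inner_neg_left, inner_neg_right]
  ring

/-- The metaplectic operator on `𝓢'` is a multiple, of modulus `|det B|^{1/2}`, of the transpose of
a product of two chirps, a dilation and the Fourier transform. -/
theorem IsMetaplectic.exists_eq_smul_precompose {A B C D : Matrix (Fin d) (Fin d) ℝ}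
    {T : 𝓢'(Rd d, ℂ) →L[ℂ] 𝓢'(Rd d, ℂ)} (hT : IsMetaplectic A B C D T)
    (hmem : Matrix.fromBlocks A B C D ∈ Matrix.symplecticGroup (Fin d) ℝ) (hB : B.det ≠ 0)
    {P Q : Matrix (Fin d) (Fin d) ℝ} (hP : P = -(B⁻¹ * A)) (hQ : Q = -(D * B⁻¹))
    (hPs : P.IsHermitian) (hQs : Q.IsHermitian) {L : Rd d ≃L[ℝ] Rd d}
    (hL : ∀ t, L t = -B.toEuclideanLin t) :
    ∃ c : ℂ, ‖c‖ = Real.sqrt (absDet L).toReal ∧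
      ∀ f, T f = c • precompose f (metaplecticFactor P Q L) := by
  obtain ⟨U, hU, hTU⟩ := hT
  obtain ⟨S, hS⟩ := exists_transpose T
  have hpos : 0 < (absDet L).toReal := ENNReal.toReal_pos (absDet_ne_zero L) (absDet_ne_top L)
  -- Transposes are adjoints conjugated by complex conjugation.
  have hSU : ∀ ψ, conjL2 (S ψ) = U.symm (conjL2 ψ) := fun ψ => by
    refine ext_inner_right ℂ fun f => ?_
    rw [inner_conjL2, ← hS, hTU, ← inner_conjL2, ← U.inner_map_map (U.symm _), U.apply_symm_apply]
  have hSw : ∀ (x y : Rd d) ψ, S (phaseShift (A.toEuclideanLin x + B.toEuclideanLin y)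
      (C.toEuclideanLin x + D.toEuclideanLin y) ψ) = phaseShift x y (S ψ) := fun x y ψ => by
    have h1 := hU (-x) (-y) (conjL2 (S ψ)) (conjL2 (phaseShift x y (S ψ)))
      ((coeFn_conjL2 _).trans (heisenberg_conj_ae x y (coeFn_conjL2 (S ψ))).symm)
    rw [hSU ψ, U.apply_symm_apply] at h1
    have h2 := heisenberg_conj_ae (A.toEuclideanLin x + B.toEuclideanLin y)
      (C.toEuclideanLin x + D.toEuclideanLin y) (coeFn_conjL2 ψ)
    simp only [map_neg, ← neg_add] at h1
    have h3 : U (conjL2 (phaseShift x y (S ψ))) =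
        conjL2 (phaseShift (A.toEuclideanLin x + B.toEuclideanLin y)
          (C.toEuclideanLin x + D.toEuclideanLin y) ψ) :=
      Lp.ext (h1.trans (h2.trans (coeFn_conjL2 _).symm))
    refine conjL2_injective ?_
    rw [hSU, ← h3, U.symm_apply_apply]
  obtain ⟨c, hc, hcS⟩ := exists_eq_smul_of_intertwining (S := metaplecticFactor P Q L) (S' := S)
    (Real.sqrt_pos.2 hpos) (metaplecticFactor_surjective P Q L)
    (fun x y => ⟨_, fun ψ => ⟨metaplecticFactor_phaseShift hmem hB hP hQ hPs hQs hL x y ψ,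
      hSw x y ψ⟩⟩) (fun φ ψ => by
        rw [← inner_conjL2_conjL2, hSU, hSU, U.symm.inner_map_map, inner_conjL2_conjL2,
          ← integral_metaplecticFactor_mul_conj P Q L, ← Complex.ofReal_pow,
          Real.sq_sqrt hpos.le])
  refine ⟨c, hc, fun f => ?_⟩
  ext ψ
  rw [hS, hcS, map_smul, _root_.smul_apply, precompose_apply]

end Representation

/-! ### Bounds for metaplectic operators -/

section Assembly

open FourierTransform Filter
open scoped Topology ComplexConjugate

variable {d : ℕ}

theorem amalgamNorm_smul (g : 𝓢(Rd d, ℂ)) (p q : ℝ≥0∞) (c : ℂ) (f : 𝓢'(Rd d, ℂ)) :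
    amalgamNorm g p q (c • f) = ‖c‖ₑ * amalgamNorm g p q f := by
  have h1 : ∀ x, eLpNorm (fun ξ => stft g (c • f) x ξ) p volume =
      ‖c‖ₑ * eLpNorm (fun ξ => stft g f x ξ) p volume := fun x =>
    eLpNorm_const_smul c (fun ξ => stft g f x ξ) p volume
  simp only [amalgamNorm, h1]
  exact eLpNorm_const_mul_ennreal (f := fun x => eLpNorm (fun ξ => stft g f x ξ) p volume)
    (measurable_eLpNorm_stft _ _ _).aemeasurable _ _

/-- `|det(1 + iP)|` is the product of the `|1 + iλⱼ| = (1 + λⱼ²)^{1/2}`. -/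
theorem norm_det_cplx_one {P : Matrix (Fin d) (Fin d) ℝ} (hP : P.IsHermitian) :
    ‖(cplx 1 P).det‖ = chirpConst hP ^ 2 := by
  have h1 : cplx 1 P = (-Complex.I) • (Matrix.scalar (Fin d) Complex.I - P.map Complex.ofRealHom) := by
    ext i j
    rcases eq_or_ne i j with rfl | hij
    · simp [cplx, mul_sub]
    · simp [cplx, hij]
  have h2 : (Matrix.scalar (Fin d) Complex.I - P.map Complex.ofRealHom).det =
      ∏ i, (Complex.I - hP.eigenvalues i) := by
    rw [← Matrix.eval_charpoly, Matrix.charpoly_map, hP.charpoly_eq]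
    simp [Polynomial.map_prod, Polynomial.eval_prod]
  rw [h1, Matrix.det_smul, h2, norm_mul, norm_pow, norm_neg, Complex.norm_I, one_pow, one_mul,
    norm_prod, chirpConst, ← Finset.prod_pow]
  refine Finset.prod_congr rfl fun i _ => ?_
  rw [← Real.rpow_natCast, ← Real.rpow_mul (by positivity), Complex.norm_def,
    Complex.normSq_apply, Real.sqrt_eq_rpow]
  congr 1
  · simp
    ring
  · norm_num

theorem norm_det_cplx_one_neg (P : Matrix (Fin d) (Fin d) ℝ) :
    ‖(cplx 1 (-P)).det‖ = ‖(cplx 1 P).det‖ := by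
  have h1 : cplx 1 (-P) = (starRingEnd ℂ).mapMatrix (cplx 1 P) := by
    ext i j
    rcases eq_or_ne i j with rfl | hij
    · simp [cplx]
    · simp [cplx, hij]
  rw [h1, ← RingHom.map_det, RCLike.norm_conj]

theorem cplx_mul_left (M X Y : Matrix (Fin d) (Fin d) ℝ) :
    cplx (M * X) (M * Y) = Complex.ofRealHom.mapMatrix M * cplx X Y := by
  have h1 : ∀ X : Matrix (Fin d) (Fin d) ℝ, X.map Complex.ofReal = Complex.ofRealHom.mapMatrix X :=
    fun X => rfl
  simp only [cplx, h1, map_mul, Matrix.mul_add, Matrix.mul_smul]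

theorem cplx_mul_right (M X Y : Matrix (Fin d) (Fin d) ℝ) :
    cplx (X * M) (Y * M) = cplx X Y * Complex.ofRealHom.mapMatrix M := by
  have h1 : ∀ X : Matrix (Fin d) (Fin d) ℝ, X.map Complex.ofReal = Complex.ofRealHom.mapMatrix X :=
    fun X => rfl
  simp only [cplx, h1, map_mul, Matrix.add_mul, Matrix.smul_mul]

theorem norm_det_mapMatrix (M : Matrix (Fin d) (Fin d) ℝ) :
    ‖(Complex.ofRealHom.mapMatrix M).det‖ = |M.det| := by
  rw [← RingHom.map_det, Complex.ofRealHom_eq_coe, Complex.norm_real, Real.norm_eq_abs]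

theorem norm_det_cplx_left {M Y : Matrix (Fin d) (Fin d) ℝ} (hM : M.det ≠ 0)
    (h : (M⁻¹ * Y).IsHermitian) : ‖(cplx M Y).det‖ = |M.det| * chirpConst h ^ 2 := by
  rw [← norm_det_cplx_one h, ← norm_det_mapMatrix, ← norm_mul, ← Matrix.det_mul, ← cplx_mul_left,
    Matrix.mul_nonsing_inv_cancel_left _ _ (isUnit_iff_ne_zero.2 hM), Matrix.mul_one]

theorem norm_det_cplx_right {M Y : Matrix (Fin d) (Fin d) ℝ} (hM : M.det ≠ 0)
    (h : (Y * M⁻¹).IsHermitian) : ‖(cplx M Y).det‖ = |M.det| * chirpConst h ^ 2 := by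
  rw [← norm_det_cplx_one h, ← norm_det_mapMatrix, mul_comm, ← norm_mul, ← Matrix.det_mul,
    ← cplx_mul_right, Matrix.nonsing_inv_mul_cancel_right _ _ (isUnit_iff_ne_zero.2 hM),
    Matrix.one_mul]

theorem chirpConst_nonneg {P : Matrix (Fin d) (Fin d) ℝ} (hP : P.IsHermitian) :
    0 ≤ chirpConst hP := Finset.prod_nonneg fun i _ => by positivity

theorem chirpConst_neg {P : Matrix (Fin d) (Fin d) ℝ} (hP : P.IsHermitian)
    (hP' : (-P).IsHermitian) : chirpConst hP' = chirpConst hP := by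
  rw [← pow_left_inj₀ (chirpConst_nonneg _) (chirpConst_nonneg _) two_ne_zero,
    ← norm_det_cplx_one, ← norm_det_cplx_one, norm_det_cplx_one_neg]

/-- Transposing a symplectic matrix gives `AB* = BA*`, so that `B⁻¹A` is symmetric. -/
theorem isHermitian_inv_mul {A B C D : Matrix (Fin d) (Fin d) ℝ}
    (hmem : Matrix.fromBlocks A B C D ∈ Matrix.symplecticGroup (Fin d) ℝ) (hB : B.det ≠ 0) :
    (B⁻¹ * A).IsHermitian := by
  have h1 := SymplecticGroup.transpose_mem hmem
  rw [Matrix.fromBlocks_transpose] at h1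
  obtain ⟨h2, -, -⟩ := SymplecticGroup.fromBlocks_mem_iff.1 h1
  rw [Matrix.transpose_transpose, Matrix.transpose_transpose] at h2
  have hBu : IsUnit B.det := isUnit_iff_ne_zero.2 hB
  have hBt : IsUnit B.transpose.det := by rwa [Matrix.det_transpose]
  rw [Matrix.IsHermitian, Matrix.conjTranspose_eq_transpose_of_trivial, Matrix.transpose_mul,
    Matrix.transpose_nonsing_inv]
  calc A.transpose * B.transpose⁻¹ = B⁻¹ * (B * A.transpose) * B.transpose⁻¹ := by
        rw [Matrix.nonsing_inv_mul_cancel_left _ _ hBu]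
    _ = B⁻¹ * A := by
        rw [← h2, ← Matrix.mul_assoc, Matrix.mul_nonsing_inv_cancel_right _ _ hBt]

theorem isHermitian_mul_inv {M N : Matrix (Fin d) (Fin d) ℝ} (hM : M.det ≠ 0)
    (h : M.transpose * N = N.transpose * M) : (N * M⁻¹).IsHermitian := by
  have hMu : IsUnit M.det := isUnit_iff_ne_zero.2 hM
  have hMt : IsUnit M.transpose.det := by rwa [Matrix.det_transpose]
  rw [Matrix.IsHermitian, Matrix.conjTranspose_eq_transpose_of_trivial, Matrix.transpose_mul,
    Matrix.transpose_nonsing_inv]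
  calc M.transpose⁻¹ * N.transpose = M.transpose⁻¹ * (N.transpose * M * M⁻¹) := by
        rw [Matrix.mul_nonsing_inv_cancel_right _ _ hMu]
    _ = N * M⁻¹ := by
        rw [← h, Matrix.mul_assoc, Matrix.nonsing_inv_mul_cancel_left _ _ hMt]

theorem abs_det_neg (M : Matrix (Fin d) (Fin d) ℝ) : |(-M).det| = |M.det| := by
  rw [Matrix.det_neg, abs_mul, abs_pow, abs_neg, abs_one, one_pow, one_mul]

theorem exists_equiv_toEuclideanLin {M : Matrix (Fin d) (Fin d) ℝ} (hM : M.det ≠ 0) :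
    ∃ L : Rd d ≃L[ℝ] Rd d, (∀ t, L t = M.toEuclideanLin t) ∧ (absDet L).toReal = |M.det| := by
  have hdet : LinearMap.det (M.toEuclideanLin : Rd d →ₗ[ℝ] Rd d) = M.det := by
    rw [Matrix.toEuclideanLin, Matrix.toLpLin_eq_toLin, LinearMap.det_toLin]
  have hu : IsUnit (LinearMap.det (M.toEuclideanLin : Rd d →ₗ[ℝ] Rd d)) := by
    rw [hdet]
    exact isUnit_iff_ne_zero.2 hM
  refine ⟨(LinearMap.equivOfIsUnitDet hu).toContinuousLinearEquiv, fun t => by simp, ?_⟩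
  have h1 : (((LinearMap.equivOfIsUnitDet hu).toContinuousLinearEquiv).toLinearEquiv :
      Rd d →ₗ[ℝ] Rd d) = M.toEuclideanLin := by
    ext t
    simp
  rw [absDet, h1, hdet, ENNReal.toReal_ofReal (abs_nonneg _)]

/-- For `1/q ≤ 1/p`, the three cases of `μ₁` merge into one formula. -/
theorem mu1_eq {p q : ℝ≥0∞} (h : recip q ≤ recip p) :
    mu1 p q = recip q - recip p - min (recip q) (1 - recip p) := by
  simp only [mu1, min_def]
  split_ifs <;> linarith

/-- For `1/q ≤ 1/p`, the three cases of `μ₂` merge into one formula. -/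
theorem mu2_eq {p q : ℝ≥0∞} (h : recip q ≤ recip p) :
    mu2 p q = recip q - recip p - max (recip p) (1 - recip p) := by
  simp only [mu2, max_def]
  split_ifs <;> linarith

/-- Powers of `|det|` are absorbed into the eigenvalue products, since
`|λ| = max(1, |λ|) min(1, |λ|)`. -/
theorem prod_max_rpow_mul_min_rpow {ι : Type*} [Fintype ι] (ev : ι → ℝ) (hev : ∀ i, ev i ≠ 0)
    (r s t : ℝ) : (∏ i, |ev i|) ^ t * ∏ i, (max 1 (|ev i|)) ^ r * (min 1 (|ev i|)) ^ s =
      ∏ i, (max 1 (|ev i|)) ^ (r + t) * (min 1 (|ev i|)) ^ (s + t) := by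
  rw [← Real.finsetProd_rpow _ _ (fun i _ => abs_nonneg _), ← Finset.prod_mul_distrib]
  refine Finset.prod_congr rfl fun i _ => ?_
  have h1 : 0 < max 1 (|ev i|) := lt_max_of_lt_left one_pos
  have h2 : 0 < min 1 (|ev i|) := lt_min one_pos (abs_pos.2 (hev i))
  have h3 : |ev i| ^ t = (max 1 (|ev i|)) ^ t * (min 1 (|ev i|)) ^ t := by
    rw [← Real.mul_rpow h1.le h2.le, max_mul_min, one_mul]
  rw [h3, Real.rpow_add h1, Real.rpow_add h2]
  ring

theorem precompose_metaplecticFactor (f : 𝓢'(Rd d, ℂ)) (P Q : Matrix (Fin d) (Fin d) ℝ)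
    (L : Rd d ≃L[ℝ] Rd d) : precompose f (metaplecticFactor P Q L) =
      precompose (precompose (precompose (precompose f (chirpMul P)) (fourierCLM ℂ 𝓢(Rd d, ℂ)))
        (dilate L)) (chirpMul Q) := rfl

/-- The factors of the metaplectic operator contribute the two chirp constants, the dilation constant
of `B`, and a constant for the Fourier transform, which exchanges the two exponents. -/
theorem exists_amalgamNorm_le_alpha' {g : 𝓢(Rd d, ℂ)} (hgc : HasCompactSupport g) (hg : g ≠ 0)
    {p q : ℝ≥0∞} (hp : 1 ≤ p) (hpq : p ≤ q) : ∃ K : ℝ, 0 < K ∧ ∀ A B C D : Matrix (Fin d) (Fin d) ℝ,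
      Matrix.fromBlocks A B C D ∈ Matrix.symplecticGroup (Fin d) ℝ → B.det ≠ 0 →
      ∀ (hB : B.IsHermitian) (T : 𝓢'(Rd d, ℂ) →L[ℂ] 𝓢'(Rd d, ℂ)), IsMetaplectic A B C D T →
      ∀ f : 𝓢'(Rd d, ℂ), amalgamNorm g p q (T f) ≤
        ENNReal.ofReal (K * alpha' A B D hB.eigenvalues p q) * amalgamNorm g q p f := by
  have hq : 1 ≤ q := hp.trans hpq
  obtain ⟨C₁, hC₁⟩ := exists_amalgamNorm_precompose_chirpMul_le hgc hg
  obtain ⟨C₂, hC₂⟩ := exists_amalgamNorm_precompose_fourier_le hgc hg hp hpq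
  obtain ⟨C₃, hC₃top, hC₃⟩ := exists_amalgamNorm_precompose_diagEquiv_le hgc hg hp hpq
  -- The summand `1` makes the constant positive even if the product vanishes.
  set K : ℝ := (C₁ * C₁ * C₂ * C₃ : ℝ≥0∞).toReal + 1 with hK
  have hKle : (C₁ * C₁ * C₂ * C₃ : ℝ≥0∞) ≤ ENNReal.ofReal K := by
    rw [ENNReal.le_ofReal_iff_toReal_le (by finiteness) (by positivity)]
    linarith
  refine ⟨K, by positivity, fun A B C D hmem hBdet hB T hT f => ?_⟩
  have hev : ∀ i, hB.eigenvalues i ≠ 0 := fun i h0 => by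
    apply hBdet
    rw [hB.det_eq_prod_eigenvalues]
    exact Finset.prod_eq_zero (Finset.mem_univ i) (by simp [h0])
  have hdet : |B.det| = ∏ i, |hB.eigenvalues i| := by
    rw [hB.det_eq_prod_eigenvalues, Finset.abs_prod]
    simp
  have hμ : ∀ i, -hB.eigenvalues i ≠ 0 := fun i => neg_ne_zero.2 (hev i)
  set L := diagEquiv hB.eigenvectorBasis hμ with hLdef
  have hL : ∀ t, L t = -B.toEuclideanLin t := fun t => by
    refine hB.eigenvectorBasis.repr.injective ?_
    ext i
    rw [hLdef, repr_diagEquiv, map_neg, PiLp.neg_apply, repr_toEuclideanLin, neg_mul]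
  have hLdet : (absDet L).toReal = |B.det| := by
    rw [hLdef, absDet_diagEquiv, ENNReal.toReal_ofReal (by positivity), hdet]
    simp only [abs_neg]
  obtain ⟨-, hBD, -⟩ := SymplecticGroup.fromBlocks_mem_iff.1 hmem
  have hP' := isHermitian_inv_mul hmem hBdet
  have hQ' := isHermitian_mul_inv hBdet hBD
  obtain ⟨c, hc, hTc⟩ := hT.exists_eq_smul_precompose hmem hBdet rfl rfl hP'.neg hQ'.neg hL
  rw [hLdet] at hc
  have hrecip := recip_le_recip hp hpq
  set E : ℝ := ∏ i, max 1 (|hB.eigenvalues i|) ^ mu1 p q * min 1 (|hB.eigenvalues i|) ^ mu2 p q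
    with hE
  have hdil : ∀ f, amalgamNorm g p q (precompose f (dilate L)) ≤
      C₃ * ENNReal.ofReal E * amalgamNorm g p q f := fun f => by
    have h1 := hC₃ hB.eigenvectorBasis _ hμ f
    simpa only [abs_neg, ← mu1_eq hrecip, ← mu2_eq hrecip] using h1
  have hE0 : 0 ≤ E := by positivity
  have hα : alpha' A B D hB.eigenvalues p q =
      Real.sqrt |B.det| * (chirpConst hQ'.neg * E * chirpConst hP'.neg) := by
    have h1 : ‖(cplx B A * cplx B D).det‖ =
        (|B.det| * (chirpConst hP' * chirpConst hQ')) ^ 2 := by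
      rw [Matrix.det_mul, norm_mul, norm_det_cplx_left hBdet hP', norm_det_cplx_right hBdet hQ']
      ring
    have h2 := prod_max_rpow_mul_min_rpow hB.eigenvalues hev (mu1 p q) (mu2 p q) (-(1 / 2))
    rw [alpha', h1, chirpConst_neg hP', chirpConst_neg hQ', ← Real.sqrt_eq_rpow,
      Real.sqrt_sq (mul_nonneg (abs_nonneg _)
        (mul_nonneg (chirpConst_nonneg _) (chirpConst_nonneg _)))]
    simp only [← sub_eq_add_neg, ← hdet] at h2
    rw [← h2, ← hE, Real.sqrt_eq_rpow]
    have h3 : |B.det| * |B.det| ^ (-(1 / 2) : ℝ) = |B.det| ^ (1 / 2 : ℝ) := by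
      nth_rewrite 1 [← Real.rpow_one |B.det|]
      rw [← Real.rpow_add (abs_pos.2 hBdet)]
      norm_num
    rw [← h3]
    ring
  rw [hTc, amalgamNorm_smul, precompose_metaplecticFactor, hα]
  have hc' : ‖c‖ₑ = ENNReal.ofReal (Real.sqrt |B.det|) := by
    rw [← hc, ofReal_norm]
  have h0 := chirpConst_nonneg hP'.neg
  have h0' := chirpConst_nonneg hQ'.neg
  calc _ ≤ ‖c‖ₑ * (C₁ * ENNReal.ofReal (chirpConst hQ'.neg) * (C₃ * ENNReal.ofReal E *
        (C₂ * (C₁ * ENNReal.ofReal (chirpConst hP'.neg) * amalgamNorm g q p f)))) := by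
        refine mul_le_mul' le_rfl ((hC₁ _ hQ'.neg hp hq _).trans (mul_le_mul' le_rfl
          ((hdil _).trans (mul_le_mul' le_rfl ((hC₂ _).trans (mul_le_mul' le_rfl
            (hC₁ _ hP'.neg hq hp f)))))))
    _ = (C₁ * C₁ * C₂ * C₃) * (ENNReal.ofReal (Real.sqrt |B.det| *
          (chirpConst hQ'.neg * E * chirpConst hP'.neg))) * amalgamNorm g q p f := by
        rw [hc', ENNReal.ofReal_mul (Real.sqrt_nonneg _), ENNReal.ofReal_mul (by positivity),
          ENNReal.ofReal_mul h0']
        ring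
    _ ≤ _ := by
        rw [ENNReal.ofReal_mul (p := K) (by positivity)]
        gcongr

/-- If `A` is invertible, the transposed metaplectic operator, followed on the right by the chirp of
`CA⁻¹` and the dilation by `A⁻¹`, is a multiple of the convolution with the chirp of `-B⁻¹A`. -/
theorem metaplecticFactor_eq_convolution {A B C D : Matrix (Fin d) (Fin d) ℝ}
    (hmem : Matrix.fromBlocks A B C D ∈ Matrix.symplecticGroup (Fin d) ℝ) (hA : A.det ≠ 0)
    (hB : B.det ≠ 0) (hAs : A.IsHermitian) {L L' : Rd d ≃L[ℝ] Rd d}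
    (hL : ∀ t, L t = -B.toEuclideanLin t) (hL' : ∀ t, L' t = A.toEuclideanLin t)
    (ψ : 𝓢(Rd d, ℂ)) (t : Rd d) :
    metaplecticFactor (-(B⁻¹ * A)) (-(D * B⁻¹)) L (chirpMul (C * A⁻¹) (dilate L'.symm ψ)) t =
      (|A.det| / |B.det| : ℝ) * ∫ r, chirp (-(B⁻¹ * A)) (t - r) * ψ r := by
  obtain ⟨hAC, hBD, hADCB⟩ := SymplecticGroup.fromBlocks_mem_iff.1 hmem
  have hAt : A.transpose = A := by
    rw [← Matrix.conjTranspose_eq_transpose_of_trivial]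
    exact hAs
  have hAu : IsUnit A.det := isUnit_iff_ne_zero.2 hA
  have hBu : IsUnit B.det := isUnit_iff_ne_zero.2 hB
  set N := B⁻¹ * A with hN
  have hNs : N.IsHermitian := isHermitian_inv_mul hmem hB
  have hNdet : |(-N).det| = |A.det| / |B.det| := by
    rw [abs_det_neg, hN, Matrix.det_mul, Matrix.det_nonsing_inv, Ring.inverse_eq_inv', abs_mul, abs_inv]
    ring
  obtain ⟨E, hE, hEdet⟩ := exists_equiv_toEuclideanLin (M := -N) (by
    rw [← abs_ne_zero, hNdet]
    exact div_ne_zero (abs_ne_zero.2 hA) (abs_ne_zero.2 hB))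
  rw [hNdet] at hEdet
  have hLE : ∀ r, L (E r) = L' r := fun r => by
    rw [hL, hE, hL', map_neg, LinearMap.neg_apply, map_neg, neg_neg, ← toEuclideanLin_mul_apply,
      hN, Matrix.mul_nonsing_inv_cancel_left _ _ hBu]
  -- The chirps of `-DB⁻¹` and `CA⁻¹` combine, after the substitution `r ↦ Ar`, to that of `-B⁻¹A`.
  have hmat : A.transpose * ((-(D * B⁻¹) + C * A⁻¹) * A) = -N := by
    have h1 : A.transpose * D = 1 + C.transpose * B := by rw [← hADCB]; abel
    have h2 : A.transpose * (D * B⁻¹ * A) = N + C.transpose * A := by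
      rw [← Matrix.mul_assoc, ← Matrix.mul_assoc, h1, Matrix.add_mul, Matrix.add_mul,
        Matrix.mul_nonsing_inv_cancel_right _ _ hBu, Matrix.one_mul]
    rw [Matrix.add_mul, Matrix.nonsing_inv_mul_cancel_right _ _ hAu, Matrix.neg_mul,
      Matrix.mul_add, Matrix.mul_neg, h2, hAC]
    abel
  have hquad : ∀ r, inner ℝ (L' r) ((-(D * B⁻¹)).toEuclideanLin (L' r)) +
      inner ℝ (L' r) ((C * A⁻¹).toEuclideanLin (L' r)) =
      -inner ℝ r (N.toEuclideanLin r) := fun r => by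
    rw [← inner_add_right, ← LinearMap.add_apply, ← map_add, hL', ← toEuclideanLin_mul_apply,
      real_inner_comm, inner_toEuclideanLin_right, ← toEuclideanLin_mul_apply, hmat, map_neg,
      LinearMap.neg_apply, inner_neg_left, real_inner_comm]
  have hker : ∀ r, chirp (-N) t * (character t (E r) * (chirp (-(D * B⁻¹)) (L' r) *
      (chirp (C * A⁻¹) (L' r) * ψ r))) = chirp (-N) (t - r) * ψ r := fun r => by
    have h1 := (Matrix.isSymmetric_toEuclideanLin_iff.2 hNs) r t
    have h2 := real_inner_comm t (N.toEuclideanLin r)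
    rw [← mul_assoc, ← mul_assoc, ← mul_assoc]
    congr 1
    simp only [chirp, character, ← Complex.exp_add, ← add_mul, ← Complex.ofReal_add]
    congr 3
    rw [hE]
    simp only [map_neg (Matrix.toEuclideanLin), LinearMap.neg_apply, map_sub, inner_sub_left,
      inner_sub_right, inner_neg_right]
    have h3 := hquad r
    rw [map_neg, LinearMap.neg_apply, inner_neg_right] at h3
    rw [← h1, h2]
    linear_combination Real.pi * h3
  rw [metaplecticFactor_apply, chirpMul_apply, SchwartzMap.fourier_coe,
    fourier_apply_eq_integral_character, ← integral_comp_equiv E, hEdet, mul_left_comm,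
    ← integral_const_mul]
  congr 2 with r
  rw [← hker, dilate_apply, chirpMul_apply, chirpMul_apply, dilate_apply, hLE, L'.symm_apply_apply]

/-- If `A` is invertible, the metaplectic operator is a multiple of a convolution with the chirp of
`-B⁻¹A`, a dilation by `A` and the chirp of `-CA⁻¹`; the convolution exchanges the exponents, so
that the Fourier transform, and with it the dilation by `B`, is not needed. -/
theorem exists_amalgamNorm_le_beta' {g : 𝓢(Rd d, ℂ)} (hgc : HasCompactSupport g) (hg : g ≠ 0) :
    ∃ K : ℝ, 0 < K ∧ ∀ A B C D : Matrix (Fin d) (Fin d) ℝ,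
      Matrix.fromBlocks A B C D ∈ Matrix.symplecticGroup (Fin d) ℝ → A.det ≠ 0 → B.det ≠ 0 →
      ∀ (hA : A.IsHermitian) (T : 𝓢'(Rd d, ℂ) →L[ℂ] 𝓢'(Rd d, ℂ)), IsMetaplectic A B C D T →
      ∀ f : 𝓢'(Rd d, ℂ), amalgamNorm g 1 ∞ (T f) ≤
        ENNReal.ofReal (K * beta' A B C hA.eigenvalues) * amalgamNorm g ∞ 1 f := by
  obtain ⟨C₁, hC₁⟩ := exists_amalgamNorm_precompose_chirpMul_le hgc hg
  obtain ⟨C₂, hC₂top, hC₂⟩ := exists_amalgamNorm_precompose_convolution_le hgc hg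
  obtain ⟨C₃, hC₃top, hC₃⟩ :=
    exists_amalgamNorm_precompose_diagEquiv_le hgc hg (p := 1) (q := ∞) le_rfl le_top
  -- The summand `1` makes the constant positive even if the product vanishes.
  set K : ℝ := (C₁ * C₂ * C₃ : ℝ≥0∞).toReal + 1 with hK
  have hKle : (C₁ * C₂ * C₃ : ℝ≥0∞) ≤ ENNReal.ofReal K := by
    rw [ENNReal.le_ofReal_iff_toReal_le (by finiteness) (by positivity)]
    linarith
  refine ⟨K, by positivity, fun A B C D hmem hAdet hBdet hA T hT f => ?_⟩
  have hev : ∀ i, hA.eigenvalues i ≠ 0 := fun i h0 => by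
    apply hAdet
    rw [hA.det_eq_prod_eigenvalues]
    exact Finset.prod_eq_zero (Finset.mem_univ i) (by simp [h0])
  have hdet : |A.det| = ∏ i, |hA.eigenvalues i| := by
    rw [hA.det_eq_prod_eigenvalues, Finset.abs_prod]
    simp
  obtain ⟨hAC, hBD, -⟩ := SymplecticGroup.fromBlocks_mem_iff.1 hmem
  have hN := isHermitian_inv_mul hmem hBdet
  have hQ := isHermitian_mul_inv hBdet hBD
  have hR := isHermitian_mul_inv hAdet hAC
  obtain ⟨L, hL, hLdet⟩ := exists_equiv_toEuclideanLin (M := -B) (by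
    rw [← abs_ne_zero, abs_det_neg]
    exact abs_ne_zero.2 hBdet)
  simp only [map_neg, LinearMap.neg_apply] at hL
  rw [abs_det_neg] at hLdet
  set L' := diagEquiv hA.eigenvectorBasis hev with hLdef
  have hL' : ∀ t, L' t = A.toEuclideanLin t := fun t => by
    refine hA.eigenvectorBasis.repr.injective ?_
    ext i
    rw [hLdef, repr_diagEquiv, repr_toEuclideanLin]
  obtain ⟨c, hc, hTc⟩ := hT.exists_eq_smul_precompose hmem hBdet rfl rfl hN.neg hQ.neg hL
  rw [hLdet] at hc
  set s : ℝ := |A.det| / |B.det| with hs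
  have hs0 : 0 < s := div_pos (abs_pos.2 hAdet) (abs_pos.2 hBdet)
  have hs0' : (s : ℂ) ≠ 0 := Complex.ofReal_ne_zero.2 hs0.ne'
  set S := metaplecticFactor (-(B⁻¹ * A)) (-(D * B⁻¹)) L with hS
  -- The convolution with the chirp of `-B⁻¹A`, as an operator on Schwartz functions.
  set V : 𝓢(Rd d, ℂ) →L[ℂ] 𝓢(Rd d, ℂ) :=
    (s : ℂ)⁻¹ • S.comp ((chirpMul (C * A⁻¹)).comp (dilate L'.symm)) with hV
  have hVker : ∀ ψ t, V ψ t = ∫ r, chirp (-(B⁻¹ * A)) (t - r) * ψ r := fun ψ t => by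
    have h1 := metaplecticFactor_eq_convolution hmem hAdet hBdet hA hL hL' ψ t
    have h2 : V ψ t = (s : ℂ)⁻¹ * S (chirpMul (C * A⁻¹) (dilate L'.symm ψ)) t := rfl
    rw [h2, hS, h1, ← hs, inv_mul_cancel_left₀ hs0']
  have hfac : precompose f S = (s : ℂ) •
      precompose (precompose (precompose f V) (dilate L')) (chirpMul (-(C * A⁻¹))) := by
    ext ψ
    have h1 : dilate L'.symm (dilate L' (chirpMul (-(C * A⁻¹)) ψ)) = chirpMul (-(C * A⁻¹)) ψ := by
      ext t
      rw [dilate_apply, dilate_apply, L'.apply_symm_apply]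
    have h2 : V (dilate L' (chirpMul (-(C * A⁻¹)) ψ)) = (s : ℂ)⁻¹ • S ψ := by
      have h3 : V (dilate L' (chirpMul (-(C * A⁻¹)) ψ)) = (s : ℂ)⁻¹ •
        S (chirpMul (C * A⁻¹) (dilate L'.symm (dilate L' (chirpMul (-(C * A⁻¹)) ψ)))) := rfl
      rw [h3, h1, chirpMul_chirpMul_neg]
    rw [_root_.smul_apply, precompose_apply, precompose_apply, precompose_apply, precompose_apply,
      h2, map_smul, smul_smul, mul_inv_cancel₀ hs0', one_smul]
  set E : ℝ := ∏ i, max 1 (|hA.eigenvalues i|) ^ (-1 : ℝ) * min 1 (|hA.eigenvalues i|) ^ (-2 : ℝ)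
    with hE
  have hdil : ∀ f, amalgamNorm g 1 ∞ (precompose f (dilate L')) ≤
      C₃ * ENNReal.ofReal E * amalgamNorm g 1 ∞ f := fun f => by
    have h1 := hC₃ hA.eigenvectorBasis _ hev f
    have h2 : recip 1 = 1 := by simp [recip]
    have h3 : recip ∞ = 0 := by simp [recip]
    rw [h2, h3] at h1
    have h4 : (0 - 1 - min 0 (1 - 1) : ℝ) = -1 := by norm_num
    have h5 : (0 - 1 - max 1 (1 - 1) : ℝ) = -2 := by norm_num
    rwa [h4, h5] at h1
  have hE0 : 0 ≤ E := by positivity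
  have hβ : beta' A B C hA.eigenvalues =
      Real.sqrt |B.det| * (s * (chirpConst hR.neg * E * chirpConst hN)) := by
    have h1 : ‖(cplx B A * cplx A C).det‖ =
        (Real.sqrt |B.det| * Real.sqrt |A.det| * (chirpConst hN * chirpConst hR)) ^ 2 := by
      rw [Matrix.det_mul, norm_mul, norm_det_cplx_left hBdet hN, norm_det_cplx_right hAdet hR,
        mul_pow, mul_pow, Real.sq_sqrt (abs_nonneg _), Real.sq_sqrt (abs_nonneg _)]
      ring
    have h2 := prod_max_rpow_mul_min_rpow hA.eigenvalues hev (-1) (-2) (1 / 2)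
    have h3 : (-1 + 1 / 2 : ℝ) = -1 / 2 := by norm_num
    have h4 : (-2 + 1 / 2 : ℝ) = -3 / 2 := by norm_num
    rw [h3, h4, ← hdet, ← hE, ← Real.sqrt_eq_rpow] at h2
    rw [beta', h1, ← Real.sqrt_eq_rpow, Real.sqrt_sq (mul_nonneg (by positivity)
        (mul_nonneg (chirpConst_nonneg _) (chirpConst_nonneg _))), ← h2, chirpConst_neg hR]
    have h5 := Real.mul_self_sqrt (abs_nonneg A.det)
    rw [hs, div_eq_mul_inv]
    linear_combination |B.det|⁻¹ * Real.sqrt |B.det| * chirpConst hN * chirpConst hR * E * h5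
  rw [hTc, hfac, smul_smul, amalgamNorm_smul, hβ]
  have hc' : ‖c * s‖ₑ = ENNReal.ofReal (Real.sqrt |B.det|) * ENNReal.ofReal s := by
    rw [enorm_mul, ← hc, ofReal_norm, ← ofReal_norm (s : ℂ), Complex.norm_real, Real.norm_eq_abs,
      abs_of_pos hs0]
  have h0 := chirpConst_nonneg hN
  have h0' := chirpConst_nonneg hR.neg
  calc _ ≤ ‖c * s‖ₑ * (C₁ * ENNReal.ofReal (chirpConst hR.neg) * (C₃ * ENNReal.ofReal E *
        (C₂ * ENNReal.ofReal (chirpConst hN) * amalgamNorm g ∞ 1 f))) :=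
        mul_le_mul' le_rfl ((hC₁ _ hR.neg le_rfl le_top _).trans (mul_le_mul' le_rfl
          ((hdil _).trans (mul_le_mul' le_rfl (hC₂ _ hN V hVker f)))))
    _ = (C₁ * C₂ * C₃) * (ENNReal.ofReal (Real.sqrt |B.det| *
          (s * (chirpConst hR.neg * E * chirpConst hN)))) * amalgamNorm g ∞ 1 f := by
        rw [hc', ENNReal.ofReal_mul (Real.sqrt_nonneg _), ENNReal.ofReal_mul hs0.le,
          ENNReal.ofReal_mul (by positivity), ENNReal.ofReal_mul h0']
        ring
    _ ≤ _ := by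
        rw [ENNReal.ofReal_mul (p := K) (by positivity)]
        gcongr

end Assembly

end Metaplectic

theorem theorem4p2 (d : ℕ) (g : 𝓢(Metaplectic.Rd d, ℂ)) (hgc : HasCompactSupport g) (hg0 : g ≠ 0) :
    (∀ p q : ℝ≥0∞, 1 ≤ p → p ≤ q →
      ∃ K : ℝ, 0 < K ∧
        ∀ A B C D : Matrix (Fin d) (Fin d) ℝ,
          Matrix.fromBlocks A B C D ∈ Matrix.symplecticGroup (Fin d) ℝ →
          B.det ≠ 0 →
          ∀ (hB : B.IsHermitian) (T : 𝓢'(Metaplectic.Rd d, ℂ) →L[ℂ] 𝓢'(Metaplectic.Rd d, ℂ)),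
            Metaplectic.IsMetaplectic A B C D T →
            ∀ f : 𝓢'(Metaplectic.Rd d, ℂ),
              Metaplectic.amalgamNorm g p q (T f) ≤
                ENNReal.ofReal (K * Metaplectic.alpha' A B D hB.eigenvalues p q) *
                  Metaplectic.amalgamNorm g q p f) ∧
    (∃ K : ℝ, 0 < K ∧
      ∀ A B C D : Matrix (Fin d) (Fin d) ℝ,
        Matrix.fromBlocks A B C D ∈ Matrix.symplecticGroup (Fin d) ℝ →
        A.det ≠ 0 → B.det ≠ 0 →
        ∀ (hA : A.IsHermitian) (T : 𝓢'(Metaplectic.Rd d, ℂ) →L[ℂ] 𝓢'(Metaplectic.Rd d, ℂ)),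
          Metaplectic.IsMetaplectic A B C D T →
          ∀ f : 𝓢'(Metaplectic.Rd d, ℂ),
            Metaplectic.amalgamNorm g 1 ∞ (T f) ≤
              ENNReal.ofReal (K * Metaplectic.beta' A B C hA.eigenvalues) *
                Metaplectic.amalgamNorm g ∞ 1 f) := by
  exact ⟨fun p q hp hpq => Metaplectic.exists_amalgamNorm_le_alpha' hgc hg0 hp hpq,
    Metaplectic.exists_amalgamNorm_le_beta' hgc hg0⟩
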